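/- Let $\Bbbk$ be a field, $Q$ a finite quiver, $I\subseteq \Bbbk Q$ an admissible ideal and $A=\Bbbk Q/I$. Assume that $A$ is quadratic, i.e. that $I$ is generated by linear combinations of paths of length two; then $A$ is graded by path length. Let $L=A/\operatorname{rad}A$ as a left $A$-module, concentrated in internal degree $0$. Say that a class in $\operatorname{Ext}^n_A(L,L)$ has internal (Adams) degree $j$ if it is represented, on a graded projective resolution $P_\bullet\to L$ (with differentials and augmentation of degree $0$), by a cocycle $P_n\to L$ that maps the degree-$i$ part of $P_n$ to the degree-$(i-j)$ part of $L$ for all $i$. (1) Let $(m_n)_{n\ge 1}$ be any $A_\infty$-structure on $\operatorname{Ext}^*_A(L,L)$ (graded by homological degree, $m_n$ of homological degree $2-n$) whose $m_2$ is the Yoneda product, and suppose that the restricted multiplications $$m_n\colon \operatorname{Ext}^1_A(L,L)^{\otimes n}\to \operatorname{Ext}^2_A(L,L),\qquad n\ge 1,$$ have internal degree $0$, i.e. they send classes of internal degrees $d_1,\dots,d_n$ to a class of internal degree $d_1+\dots+d_n$. Then these restricted maps vanish for all $n\neq 2$. (2) The algebra can be recovered from the Yoneda product alone: write $\mathbb{D}$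 for the $\Bbbk$-dual, regard $\mathbb{D}\operatorname{Ext}^1_A(L,L)$ as a bimodule over the commutative semisimple algebra $S=A/\operatorname{rad}A$ via $(a\varphi b)(x)=\varphi(a\circ x\circ b)$ (where $a,b\in S$ act on $L$ by multiplication), and let $m_2^{\#}\colon \mathbb{D}\operatorname{Ext}^2_A(L,L)\to \mathbb{D}\operatorname{Ext}^1_A(L,L)\otimes_{\Bbbk} \mathbb{D}\operatorname{Ext}^1_A(L,L)$ be the dual of the Yoneda product $x\otimes y\mapsto x\circ y$ on $\operatorname{Ext}^1_A(L,L)$. Then, as $\Bbbk$-algebras, $$A\;\cong\; T_{S}\bigl(\mathbb{D}\operatorname{Ext}^1_A(L,L)\bigr)\big/\bigl(\operatorname{im} m_2^{\#}\bigr),$$ the quotient of the tensor algebra over $S$ by the two-sided ideal generated by the image of $\operatorname{im} m_2^\#$ in it. -/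

import Mathlib

open CategoryTheory
open scoped TensorProduct

universe u v w

noncomputable section

/-! ### Path algebras of quivers -/

/-- A path in the quiver `V`, bundled with its source and its target. -/
structure QuiverPath (V : Type v) [Quiver.{w} V] where
  src : V
  tgt : V
  path : Quiver.Path src tgt

namespace QuiverPath

variable {V : Type v} [Quiver.{w} V]

/-- The number of arrows in a path. -/
def length (p : QuiverPath V) : ℕ := p.path.length

/-- The trivial path at a vertex. -/
def nil (a : V) : QuiverPath V := ⟨a, a, Quiver.Path.nil⟩

/-- The product `p q` of two composable paths: first `q`, then `p`. -/
def comp (p q : QuiverPath V) (h : q.tgt = p.src) : QuiverPath V :=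
  ⟨q.src, p.tgt, (q.path.cast rfl h).comp p.path⟩

theorem comp_assoc (p q r : QuiverPath V) (h : q.tgt = p.src) (h' : r.tgt = q.src) :
    comp (comp p q h) r h' = comp p (comp q r h') h := by
  obtain ⟨a, b, p⟩ := p
  obtain ⟨c, d, q⟩ := q
  obtain ⟨e, f, r⟩ := r
  dsimp only at h h'
  subst h h'
  simp [comp, Quiver.Path.comp_assoc]

theorem nil_comp (q : QuiverPath V) (a : V) (h : q.tgt = a) : comp (nil a) q h = q := by
  subst h
  simp [comp, nil]

theorem comp_nil (p : QuiverPath V) (a : V) (h : a = p.src) : comp p (nil a) h = p := by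
  subst h
  simp [comp, nil]

end QuiverPath

/-- The path algebra `kQ` of the quiver `Q` with vertex type `V`: the `k`-vector space with basis
all paths of `Q`. -/
def PathAlgebra (k : Type u) (V : Type v) [Field k] [Quiver.{w} V] : Type max u v w :=
  QuiverPath V →₀ k

namespace PathAlgebra

variable (k : Type u) {V : Type v} [Field k] [Quiver.{w} V]

instance : AddCommGroup (PathAlgebra k V) := inferInstanceAs (AddCommGroup (QuiverPath V →₀ k))

instance : Module k (PathAlgebra k V) := inferInstanceAs (Module k (QuiverPath V →₀ k))

/-- The basis element of `kQ` given by a path. -/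
def ofPath (p : QuiverPath V) : PathAlgebra k V := Finsupp.single p (1 : k)

/-- The basis of `kQ` given by the paths. -/
def pathBasis : Module.Basis (QuiverPath V) k (PathAlgebra k V) := ⟨LinearEquiv.refl k _⟩

theorem pathBasis_apply (p : QuiverPath V) : pathBasis k p = ofPath k p := rfl

open Classical in
/-- The product of two paths in `kQ`: their composite if they are composable, zero otherwise. -/
def pathMul (p q : QuiverPath V) : PathAlgebra k V :=
  if h : q.tgt = p.src then ofPath k (p.comp q h) else 0

/-- The multiplication of `kQ`, extended bilinearly from the paths. -/
def mulBilin : PathAlgebra k V →ₗ[k] PathAlgebra k V →ₗ[k] PathAlgebra k V :=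
  (pathBasis k).constr k fun p => (pathBasis k).constr k fun q => pathMul k p q

theorem mulBilin_ofPath (p q : QuiverPath V) :
    mulBilin k (ofPath k p) (ofPath k q) = pathMul k p q := by
  simp [mulBilin, ← pathBasis_apply, Module.Basis.constr_basis]

variable {k}

@[ext high]
theorem hom_ext {M : Type*} [AddCommMonoid M] [Module k M] {f g : PathAlgebra k V →ₗ[k] M}
    (h : ∀ p, f (ofPath k p) = g (ofPath k p)) : f = g :=
  (pathBasis k).ext h

instance : Mul (PathAlgebra k V) := ⟨fun x y => mulBilin k x y⟩

theorem mul_def (x y : PathAlgebra k V) : x * y = mulBilin k x y := rfl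

theorem ofPath_mul (p q : QuiverPath V) : ofPath k p * ofPath k q = pathMul k p q :=
  mulBilin_ofPath k p q

theorem ofPath_mul_of_eq (p q : QuiverPath V) (h : q.tgt = p.src) :
    ofPath k p * ofPath k q = ofPath k (p.comp q h) := by
  rw [ofPath_mul, pathMul, dif_pos h]

theorem ofPath_mul_of_ne (p q : QuiverPath V) (h : q.tgt ≠ p.src) :
    ofPath k p * ofPath k q = 0 := by
  rw [ofPath_mul, pathMul, dif_neg h]

/-- The unit of `kQ` is the sum of the trivial paths. -/
instance [Fintype V] : One (PathAlgebra k V) := ⟨∑ a : V, ofPath k (QuiverPath.nil a)⟩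

theorem one_def [Fintype V] : (1 : PathAlgebra k V) = ∑ a : V, ofPath k (QuiverPath.nil a) := rfl

theorem mul_assoc_ofPath (p q r : QuiverPath V) :
    ofPath k p * ofPath k q * ofPath k r = ofPath k p * (ofPath k q * ofPath k r) := by
  by_cases h : q.tgt = p.src
  · by_cases h' : r.tgt = q.src
    · rw [ofPath_mul_of_eq p q h, ofPath_mul_of_eq q r h',
        ofPath_mul_of_eq (p.comp q h) r h', ofPath_mul_of_eq p (q.comp r h') h,
        QuiverPath.comp_assoc]
    · rw [ofPath_mul_of_eq p q h, ofPath_mul_of_ne q r h',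
        ofPath_mul_of_ne (p.comp q h) r h', mul_def, map_zero]
  · by_cases h' : r.tgt = q.src
    · rw [ofPath_mul_of_ne p q h, ofPath_mul_of_eq q r h',
        ofPath_mul_of_ne p (q.comp r h') h, mul_def, map_zero, LinearMap.zero_apply]
    · rw [ofPath_mul_of_ne p q h, ofPath_mul_of_ne q r h', mul_def, mul_def,
        map_zero, map_zero, LinearMap.zero_apply]

instance [Fintype V] : Ring (PathAlgebra k V) :=
  { (inferInstance : AddCommGroup (PathAlgebra k V)) with
    mul := (· * ·)
    one := 1
    left_distrib := fun x y z => by simp only [mul_def, map_add]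
    right_distrib := fun x y z => by simp only [mul_def, map_add, LinearMap.add_apply]
    zero_mul := fun x => by simp only [mul_def, map_zero, LinearMap.zero_apply]
    mul_zero := fun x => by simp only [mul_def, map_zero]
    mul_assoc := fun x y z => by
      have h₁ : ∀ (p q : QuiverPath V) (z : PathAlgebra k V),
          ofPath k p * ofPath k q * z = ofPath k p * (ofPath k q * z) := fun p q =>
        LinearMap.congr_fun (f := mulBilin k (ofPath k p * ofPath k q))
          (g := mulBilin k (ofPath k p) ∘ₗ mulBilin k (ofPath k q))
          (hom_ext fun r => mul_assoc_ofPath p q r)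
      have h₂ : ∀ (p : QuiverPath V) (y : PathAlgebra k V),
          ofPath k p * y * z = ofPath k p * (y * z) := fun p =>
        LinearMap.congr_fun (f := (mulBilin k).flip z ∘ₗ mulBilin k (ofPath k p))
          (g := mulBilin k (ofPath k p) ∘ₗ (mulBilin k).flip z)
          (hom_ext fun q => h₁ p q z)
      exact LinearMap.congr_fun (f := (mulBilin k).flip z ∘ₗ (mulBilin k).flip y)
          (g := (mulBilin k).flip (y * z)) (hom_ext fun p => h₂ p y) x
    one_mul := fun x => by
      have key : mulBilin k (1 : PathAlgebra k V) = LinearMap.id := by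
        ext q
        rw [← mul_def, one_def, mul_def, map_sum, LinearMap.sum_apply,
          Finset.sum_eq_single q.tgt]
        · rw [← mul_def,
            ofPath_mul_of_eq (QuiverPath.nil q.tgt) q (show q.tgt = q.tgt from rfl),
            QuiverPath.nil_comp q q.tgt rfl, LinearMap.id_apply]
        · intro b _ hb
          rw [← mul_def, ofPath_mul_of_ne _ _ hb.symm]
        · simp
      rw [mul_def, key, LinearMap.id_apply]
    mul_one := fun x => by
      have key : (mulBilin k).flip (1 : PathAlgebra k V) = LinearMap.id := by
        ext q
        rw [one_def, map_sum, LinearMap.sum_apply, Finset.sum_eq_single q.src]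
        · rw [LinearMap.flip_apply, ← mul_def,
            ofPath_mul_of_eq q (QuiverPath.nil q.src) (show q.src = q.src from rfl),
            QuiverPath.comp_nil q q.src rfl, LinearMap.id_apply]
        · intro b _ hb
          rw [LinearMap.flip_apply, ← mul_def, ofPath_mul_of_ne _ _ hb]
        · simp
      exact LinearMap.congr_fun key x }

instance [Fintype V] : Algebra k (PathAlgebra k V) :=
  Algebra.ofModule (fun r x y => by simp only [mul_def, map_smul, LinearMap.smul_apply])
    (fun r x y => by simp only [mul_def, map_smul])

variable (k V)

/-- The span of the paths of length `n` in `kQ`. -/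
def lengthPart (n : ℕ) : Submodule k (PathAlgebra k V) :=
  Submodule.span k {x | ∃ p : QuiverPath V, p.length = n ∧ x = ofPath k p}

/-- The span of the paths of length at least `n` in `kQ`, i.e. the `n`-th power of the ideal
generated by the arrows. -/
def arrowPower (n : ℕ) : Submodule k (PathAlgebra k V) :=
  Submodule.span k {x | ∃ p : QuiverPath V, n ≤ p.length ∧ x = ofPath k p}

end PathAlgebra

/-! ### Bound quiver algebras -/

section BoundQuiver

variable {k : Type u} {V : Type v} [Field k] [Quiver.{w} V] [Fintype V]

/-- An ideal of `kQ` is admissible if it lies between some power of the arrow ideal and the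
square of the arrow ideal. -/
def IsAdmissible (I : TwoSidedIdeal (PathAlgebra k V)) : Prop :=
  (∃ m : ℕ, 2 ≤ m ∧ ∀ x ∈ PathAlgebra.arrowPower k V m, x ∈ I) ∧
    ∀ x ∈ I, x ∈ PathAlgebra.arrowPower k V 2

/-- An ideal of `kQ` is quadratic if it is generated by linear combinations of paths of length
two. -/
def IsQuadratic (I : TwoSidedIdeal (PathAlgebra k V)) : Prop :=
  ∃ S : Set (PathAlgebra k V), S ⊆ PathAlgebra.lengthPart k V 2 ∧ I = TwoSidedIdeal.span S

/-- The algebra `A = kQ / I`. -/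
abbrev BoundQuiverAlgebra (I : TwoSidedIdeal (PathAlgebra k V)) : Type max u v w :=
  PathAlgebra k V ⧸ I.asIdeal

namespace BoundQuiverAlgebra

variable (I : TwoSidedIdeal (PathAlgebra k V))

/-- The part `A_n` of `A = kQ / I`: the span of the classes of the paths of length `n`. When `I`
is generated by homogeneous elements these are the parts of the grading of `A` by path length. -/
def gradedPart (n : ℕ) : Submodule k (BoundQuiverAlgebra I) :=
  (PathAlgebra.lengthPart k V n).map (Ideal.Quotient.mkₐ k I.asIdeal).toLinearMap

/-- The ring `A / rad A`. -/
abbrev Top : Type max u v w := BoundQuiverAlgebra I ⧸ Ring.jacobson (BoundQuiverAlgebra I)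

/-- The left `A`-module `L = A / rad A`. -/
abbrev L : ModuleCat.{max u v w} (BoundQuiverAlgebra I) :=
  ModuleCat.of (BoundQuiverAlgebra I) (Top I)

/-- The space `Ext^n_A(L, L)`. -/
abbrev ExtL (n : ℕ) : Type max u v w := Abelian.Ext (L I) (L I) n

/-- The Yoneda product `(x, y) ↦ x ∘ y` on the `Ext`-algebra of `L` (first `y`, then `x`). -/
def yoneda (p q r : ℕ) (h : p + q = r) : ExtL I p →ₗ[k] ExtL I q →ₗ[k] ExtL I r :=
  (Abelian.Ext.bilinearCompOfLinear k (L I) (L I) (L I) q p r (by omega)).flip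

/-! ### The internal grading on `Ext` -/

/-- A graded projective resolution of `L`, where `L` is concentrated in internal degree `0`:
a projective resolution whose terms are `ℤ`-graded `A`-modules and whose differentials and
augmentation are homogeneous of degree `0`. -/
structure GradedProjectiveResolution where
  res : ProjectiveResolution (L I)
  part : (n : ℕ) → ℤ → AddSubgroup (res.complex.X n)
  isInternal : ∀ n, DirectSum.IsInternal (part n)
  smul_mem : ∀ (n i : ℕ) (j : ℤ) (a : BoundQuiverAlgebra I) (p : res.complex.X n),
    a ∈ gradedPart I i → p ∈ part n j → a • p ∈ part n (i + j)
  d_mem : ∀ (n : ℕ) (j : ℤ) (p : res.complex.X (n + 1)), p ∈ part (n + 1) j →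
    (res.complex.d (n + 1) n).hom p ∈ part n j
  augmentation : ∀ (j : ℤ) (p : res.complex.X 0), p ∈ part 0 j → j ≠ 0 →
    (res.π.f 0).hom p = 0

/-- The class `x ∈ Ext^n_A(L, L)` has internal degree `j`: it is represented, on some graded
projective resolution `P` of `L`, by a cocycle `P_n → L` which is homogeneous, i.e. maps
the part of degree `i` of `P_n` to the part of degree `i - j` of `L`; as `L` is concentrated in
degree `0`, this means that it kills all parts of degree `i ≠ j`. -/
def HasInternalDegree {n : ℕ} (x : ExtL I n) (j : ℤ) : Prop :=
  ∃ (P : GradedProjectiveResolution I) (f : P.res.complex.X n ⟶ L I)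
    (hf : P.res.complex.d (n + 1) n ≫ f = 0),
    (∀ (i : ℤ) (p : P.res.complex.X n), p ∈ P.part n i → i ≠ j → f.hom p = 0) ∧
      x = P.res.extMk f (n + 1) rfl hf

end BoundQuiverAlgebra

end BoundQuiver

/-! ### `A_∞`-algebras -/

/-- An `A_∞`-algebra structure on the vector space `E` with grading `𝒢`: multilinear maps
`m n : E^n → E` for `n ≥ 1` (with `m 0 = 0`), homogeneous of degree `2 - n`, with
`∑ (-1)^(r + s t) m_(r+1+t) (id^r ⊗ m_s ⊗ id^t) = 0`, the sum being over `r + s + t = n` with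
`s ≥ 1`. On homogeneous elements `x 0, …, x (n - 1)` of degrees `d 0, …, d (n - 1)` the Koszul rule
contributes the sign `(-1)^((2 - s) (d 0 + ⋯ + d (r - 1)))`. -/
structure AInfinityStructure (k : Type*) {E : Type*} [Field k] [AddCommGroup E] [Module k E]
    (𝒢 : ℤ → Submodule k E) where
  m : (n : ℕ) → MultilinearMap k (fun _ : Fin n => E) E
  m_zero : m 0 = 0
  degree : ∀ (n : ℕ), 1 ≤ n → ∀ (d : Fin n → ℤ) (x : Fin n → E), (∀ i, x i ∈ 𝒢 (d i)) →
    m n x ∈ 𝒢 (∑ i, d i + 2 - n)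
  stasheff : ∀ (n : ℕ), 1 ≤ n → ∀ (d : ℕ → ℤ) (x : ℕ → E), (∀ i < n, x i ∈ 𝒢 (d i)) →
    ∑ s ∈ Finset.Icc 1 n, ∑ r ∈ Finset.range (n - s + 1),
      ((r : ℤ) + s * (n - s - r : ℕ) + (2 - s) * ∑ i ∈ Finset.range r, d i).negOnePow •
        m (r + 1 + (n - s - r)) (fun i =>
          if (i : ℕ) < r then x i
          else if (i : ℕ) = r then m s (fun j => x (r + j))
          else x (i + s - 1)) = 0

section Ext

variable {k : Type u} {V : Type v} [Field k] [Quiver.{w} V] [Fintype V]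
  (I : TwoSidedIdeal (PathAlgebra k V))

open BoundQuiverAlgebra

/-- The total space `Ext^*_A(L, L)`. -/
abbrev ExtTotal : Type max u v w := DirectSum ℕ (fun n => ExtL I n)

/-- The inclusion of `Ext^n_A(L, L)` into `Ext^*_A(L, L)`. -/
abbrev ExtTotal.incl (n : ℕ) : ExtL I n →ₗ[k] ExtTotal I :=
  DirectSum.lof k ℕ (fun n => ExtL I n) n

/-- The homological grading on `Ext^*_A(L, L)`, which is zero in negative degrees. -/
def extGrading (d : ℤ) : Submodule k (ExtTotal I) where
  carrier := {z | ∀ n : ℕ, (n : ℤ) ≠ d → z n = 0}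
  zero_mem' := fun _ _ => rfl
  add_mem' := fun {a b} ha hb n hn => by
    rw [DirectSum.add_apply, ha n hn, hb n hn, add_zero]
  smul_mem' := fun c z hz n hn => by
    rw [DirectSum.smul_apply, hz n hn, smul_zero]

/-- An `A_∞`-structure on the `Ext`-algebra `Ext^*_A(L, L)`: an `A_∞`-structure on this graded
vector space whose binary multiplication is the Yoneda product. -/
structure ExtAInfinityStructure extends AInfinityStructure k (extGrading I) where
  m_two : ∀ (p q : ℕ) (x : ExtL I p) (y : ExtL I q),
    m 2 ![ExtTotal.incl I p x, ExtTotal.incl I q y] =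
      ExtTotal.incl I (p + q) (yoneda I p q _ rfl x y)

namespace ExtAInfinityStructure

variable {I}

/-- The restricted multiplication `m_n : Ext^1_A(L, L)^{⊗ n} → Ext^2_A(L, L)`. -/
def mExt (M : ExtAInfinityStructure I) (n : ℕ) :
    MultilinearMap k (fun _ : Fin n => ExtL I 1) (ExtL I 2) :=
  (DirectSum.component k ℕ (fun n => ExtL I n) 2).compMultilinearMap
    ((M.m n).compLinearMap fun _ => ExtTotal.incl I 1)

/-- The restricted multiplications `m_n : Ext^1_A(L, L)^{⊗ n} → Ext^2_A(L, L)` have internal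
degree `0`. -/
def HasInternalDegreeZero (M : ExtAInfinityStructure I) : Prop :=
  ∀ (n : ℕ), 1 ≤ n → ∀ (x : Fin n → ExtL I 1) (d : Fin n → ℤ),
    (∀ i, HasInternalDegree I (x i) (d i)) → HasInternalDegree I (M.mExt n x) (∑ i, d i)

end ExtAInfinityStructure

end Ext

/-! ### Reconstruction from the Yoneda product -/

section TensorAlgebraOver

variable {k : Type*} {Λ M : Type*} [Field k] [Ring Λ] [Algebra k Λ] [AddCommGroup M] [Module k M]

/-- The relations, in the free `k`-algebra on the vector space `Λ ⊕ M`, defining the tensor algebra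
over `Λ` of the `Λ`-bimodule `M` with left action `l` and right action `r`. -/
inductive TensorAlgebraOver.Rel (l : Λ → M → M) (r : M → Λ → M) :
    TensorAlgebra k (Λ × M) → TensorAlgebra k (Λ × M) → Prop
  | one : Rel l r (TensorAlgebra.ι k (1, 0)) 1
  | mul (a b : Λ) : Rel l r (TensorAlgebra.ι k (a, 0) * TensorAlgebra.ι k (b, 0))
      (TensorAlgebra.ι k (a * b, 0))
  | left (a : Λ) (x : M) : Rel l r (TensorAlgebra.ι k (a, 0) * TensorAlgebra.ι k (0, x))
      (TensorAlgebra.ι k (0, l a x))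
  | right (x : M) (a : Λ) : Rel l r (TensorAlgebra.ι k (0, x) * TensorAlgebra.ι k (a, 0))
      (TensorAlgebra.ι k (0, r x a))

variable (k) in
/-- The tensor algebra `T_Λ(M)` of the `Λ`-bimodule `M` with left action `l` and right action
`r`, by its universal property: the `k`-algebra generated by the algebra `Λ` and
the `Λ`-bimodule `M`. -/
abbrev TensorAlgebraOver (l : Λ → M → M) (r : M → Λ → M) : Type _ :=
  RingQuot (TensorAlgebraOver.Rel (k := k) l r)

/-- The map `M → T_Λ(M)`. -/
def TensorAlgebraOver.ι (l : Λ → M → M) (r : M → Λ → M) : M →ₗ[k] TensorAlgebraOver k l r :=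
  (RingQuot.mkAlgHom k (TensorAlgebraOver.Rel (k := k) l r)).toLinearMap ∘ₗ
    TensorAlgebra.ι k ∘ₗ LinearMap.inr k Λ M

/-- The map `M ⊗ M → T_Λ(M)`, `x ⊗ y ↦ x y`. -/
def TensorAlgebraOver.ι₂ (l : Λ → M → M) (r : M → Λ → M) :
    M ⊗[k] M →ₗ[k] TensorAlgebraOver k l r :=
  TensorProduct.lift ((LinearMap.mul k (TensorAlgebraOver k l r)).compl₁₂
    (TensorAlgebraOver.ι l r) (TensorAlgebraOver.ι l r))

end TensorAlgebraOver

namespace BoundQuiverAlgebra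

variable {k : Type u} {V : Type v} [Field k] [Quiver.{w} V] [Fintype V]
  (I : TwoSidedIdeal (PathAlgebra k V))

/-- The endomorphism `x ↦ x a` of the left `A`-module `L = A / rad A`. -/
def rightMul (a : Top I) : L I ⟶ L I :=
  ModuleCat.ofHom
    { toFun := fun x : Top I => x * a
      map_add' := fun x y => add_mul x y a
      map_smul' := fun b x => smul_mul_assoc b x a }

/-- The `k`-dual `D Ext^1_A(L, L)`. -/
abbrev DExt₁ : Type max u v w := Module.Dual k (ExtL I 1)

/-- The left action of the commutative algebra `A / rad A` on `D Ext^1_A(L, L)`: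
`(a φ)(x) = φ(a ∘ x)`, where `a` acts on `L` by multiplication. Thus the dual of `Ext^1(L_i, L_j)`
is `e_j (D Ext^1_A(L, L)) e_i`. -/
def leftAct (a : Top I) (φ : DExt₁ I) : DExt₁ I :=
  φ ∘ₗ yoneda I 0 1 1 rfl (Abelian.Ext.mk₀ (rightMul I a))

/-- The right action of the commutative algebra `A / rad A` on `D Ext^1_A(L, L)`:
`(φ a)(x) = φ(x ∘ a)`. -/
def rightAct (φ : DExt₁ I) (a : Top I) : DExt₁ I :=
  φ ∘ₗ (yoneda I 1 0 1 rfl).flip (Abelian.Ext.mk₀ (rightMul I a))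

/-- The tensor algebra of `D Ext^1_A(L, L)` over the semisimple algebra `A / rad A`. -/
abbrev TensorDExt₁ : Type max u v w := TensorAlgebraOver k (leftAct I) (rightAct I)

/-- `t ∈ D Ext^1 ⊗ D Ext^1` lies in the image of the dual
`D Ext^2 → D (Ext^1 ⊗ Ext^1) = D Ext^1 ⊗ D Ext^1` of the Yoneda product. -/
def InImageDualYoneda (t : DExt₁ I ⊗[k] DExt₁ I) : Prop :=
  ∃ φ : Module.Dual k (ExtL I 2),
    TensorProduct.dualDistrib k (ExtL I 1) (ExtL I 1) t =
      φ ∘ₗ TensorProduct.lift (yoneda I 1 1 2 rfl)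

/-- The relations `t = 0` for `t` in the image of the dual of the Yoneda product. -/
inductive DualYonedaRel : TensorDExt₁ I → TensorDExt₁ I → Prop
  | mk (t : DExt₁ I ⊗[k] DExt₁ I) (ht : InImageDualYoneda I t) :
      DualYonedaRel (TensorAlgebraOver.ι₂ (leftAct I) (rightAct I) t) 0

/-- The quotient of the tensor algebra of `D Ext^1_A(L, L)` over `A / rad A` by the ideal generated
by the image of the dual of the Yoneda product `Ext^1 ⊗ Ext^1 → Ext^2`. -/
abbrev YonedaReconstruction : Type max u v w := RingQuot (DualYonedaRel I)

end BoundQuiverAlgebra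

end

/-!
Both parts rest on the first terms of the minimal projective resolution of the left module
`L = A / rad A`. By `mem_jacobson_iff` the radical of `A = kQ / I` is the image of the arrow ideal,
and `⨁ A e_(t β)`, the sum being over the arrows `β`, covers it by sending the generators to the
arrows (`coverToRad`). The kernel of this cover is described by the derivatives `deriv β` of the path
algebra, which satisfy `x = ∑ (deriv β x) β` for `x` in the arrow ideal: by `relOf_surjective`
the relations between the arrows in `A` are exactly the vectors of derivatives of the elements of
`I`. If `I` is generated in degree two, so is the module of relations (`relations_induction`): modulo
`I`, the derivatives of `a s b` with `s ∈ I` are `a` times those of `s b₀`, where `b₀` is the component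
of `b` of degree zero.

For the vanishing of the restricted multiplications it follows that `L` has a graded projective
resolution whose terms in homological degrees `1` and `2` are generated in the same internal degrees
(`gradedResolution`). Hence all classes in `Ext¹` have internal degree one
(`hasInternalDegree_one`). A class in `Ext²` of internal degree `j` may be represented on any graded
projective resolution `P`, but there is a chain map from `gradedResolution` to `P` which preserves
the internal degrees of the generators in homological degrees up to two, and the cocycle pulls back
along it to zero if `j ≠ 2` (`eq_zero_of_hasInternalDegree`). As `m_n` takes values of internal degree `n` on `Ext¹`, it
vanishes for `n ≠ 2`.

For the reconstruction, dimension shifting identifies `Ext¹ (L, L)` with the functions on the arrows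
(`extOne_bijective`), and the Yoneda product of two functions with the class in `Ext² (L, L)` of the
map that pairs their product with the coefficients of the relations (`yoneda_extOne`). So a tensor
in `Ext¹ ⊗ Ext¹` is killed by the Yoneda product if and only if it annihilates the quadratic
coefficients of all elements of `I` (`relHom_eq_zero_iff`), and the image of the dual of the Yoneda
product consists of the quadratic coefficients of the elements of `I`
(`exists_twoCoef_of_inImageDualYoneda`, `inImageDualYoneda_twoCoef`). The bimodule actions on the dual
of `Ext¹` are given by the targets and the sources of the arrows, so that the tensor algebra over
`A / rad A` is the path algebra, and its quotient by the image is `A` (`reconEquiv`).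
-/

noncomputable section

/-! ### Arrows, characters and the universal property of the path algebra -/

/-- An arrow of the quiver `V`, bundled with its source and its target. -/
def QuiverArrow (V : Type v) [Quiver.{w} V] : Type max v w := Σ a : V, Σ b : V, (a ⟶ b)

namespace QuiverArrow

variable {V : Type v} [Quiver.{w} V]

instance [Fintype V] [∀ a b : V, Finite (a ⟶ b)] : Fintype (QuiverArrow V) :=
  haveI : Finite (QuiverArrow V) := inferInstanceAs (Finite (Σ a : V, Σ b : V, (a ⟶ b)))
  Fintype.ofFinite _

/-- The source of an arrow. -/
def src (α : QuiverArrow V) : V := α.1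

/-- The target of an arrow. -/
def tgt (α : QuiverArrow V) : V := α.2.1

/-- An arrow, as a path of length one. -/
def toPath (α : QuiverArrow V) : QuiverPath V := ⟨α.1, α.2.1, α.2.2.toPath⟩

end QuiverArrow

namespace QuiverPath

variable {V : Type v} [Quiver.{w} V]

theorem length_comp (p q : QuiverPath V) (h : q.tgt = p.src) :
    (p.comp q h).length = p.length + q.length := by
  obtain ⟨a, b, p⟩ := p
  obtain ⟨c, d, q⟩ := q
  dsimp only at h
  subst h
  simp [comp, length, add_comm]

theorem eq_nil_of_length_eq_zero {p : QuiverPath V} (h : p.length = 0) : p = nil p.src := by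
  obtain ⟨a, b, p⟩ := p
  cases p with
  | nil => rfl
  | cons p e => simp [length] at h

theorem tgt_eq_src_of_length_eq_zero {p : QuiverPath V} (h : p.length = 0) : p.tgt = p.src := by
  rw [eq_nil_of_length_eq_zero h]; rfl

/-- Induction on paths which adds an arrow at the target, i.e. on the left in the notation of
`kQ`. -/
@[elab_as_elim]
theorem arrow_induction {motive : QuiverPath V → Prop} (nil : ∀ a, motive (nil a))
    (comp : ∀ (α : QuiverArrow V) (p : QuiverPath V) (h : p.tgt = α.toPath.src), motive p →
      motive (α.toPath.comp p h)) (p : QuiverPath V) : motive p := by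
  obtain ⟨a, b, p⟩ := p
  induction p with
  | nil => exact nil a
  | cons p e ih => exact comp ⟨_, _, e⟩ ⟨a, _, p⟩ rfl ih

theorem length_toPath (α : QuiverArrow V) : α.toPath.length = 1 := rfl

end QuiverPath

namespace PathAlgebra

section General

variable {k : Type u} {V : Type v} [Field k] [Quiver.{w} V]

/-- The idempotent of `kQ` given by the trivial path at a vertex. -/
def idem (k : Type u) {V : Type v} [Field k] [Quiver.{w} V] (a : V) : PathAlgebra k V :=
  ofPath k (QuiverPath.nil a)

/-- The element of `kQ` given by an arrow. -/
def arr (k : Type u) {V : Type v} [Field k] [Quiver.{w} V] (α : QuiverArrow V) :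
    PathAlgebra k V :=
  ofPath k α.toPath

theorem idem_mul_ofPath_self (p : QuiverPath V) : idem k p.tgt * ofPath k p = ofPath k p := by
  rw [idem, ofPath_mul_of_eq _ _ rfl, QuiverPath.nil_comp _ _ rfl]

theorem ofPath_mul_idem_self (p : QuiverPath V) : ofPath k p * idem k p.src = ofPath k p := by
  rw [idem, ofPath_mul_of_eq _ _ rfl, QuiverPath.comp_nil _ _ rfl]

open Classical in
theorem idem_mul_idem (a b : V) : idem k a * idem k b = if a = b then idem k a else 0 := by
  split_ifs with h
  · subst h; exact idem_mul_ofPath_self (k := k) (QuiverPath.nil a)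
  · exact ofPath_mul_of_ne _ _ (fun h' => h h'.symm)

theorem idem_tgt_mul_arr (α : QuiverArrow V) : idem k α.tgt * arr k α = arr k α :=
  idem_mul_ofPath_self α.toPath

theorem arr_mul_idem_src (α : QuiverArrow V) : arr k α * idem k α.src = arr k α :=
  ofPath_mul_idem_self α.toPath

theorem arr_mul_ofPath (α : QuiverArrow V) (p : QuiverPath V) (h : p.tgt = α.toPath.src) :
    arr k α * ofPath k p = ofPath k (α.toPath.comp p h) := ofPath_mul_of_eq _ _ h

end General

variable {k : Type u} {V : Type v} [Field k] [Quiver.{w} V] [Fintype V]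

theorem sum_idem : ∑ a : V, idem k a = 1 := rfl

@[elab_as_elim]
theorem induction_path {motive : PathAlgebra k V → Prop} (x : PathAlgebra k V)
    (path : ∀ p, motive (ofPath k p)) (zero : motive 0)
    (add : ∀ x y, motive x → motive y → motive (x + y))
    (smul : ∀ (c : k) x, motive x → motive (c • x)) : motive x := by
  have hx : x ∈ Submodule.span k (Set.range (pathBasis k (V := V))) := by
    rw [(pathBasis k).span_eq]; trivial
  induction hx using Submodule.span_induction with
  | mem x h => obtain ⟨p, rfl⟩ := h; exact path p
  | zero => exact zero
  | add x y _ _ hx hy => exact add x y hx hy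
  | smul c x _ hx => exact smul c x hx

section Lift

variable {B : Type*} [Ring B] [Algebra k B] (e : V → B) (a : QuiverArrow V → B)

/-- The value on a path of the algebra map `kQ → B` with prescribed values on the trivial paths
and on the arrows. -/
def liftPath {i : V} : {j : V} → Quiver.Path i j → B
  | _, .nil => e i
  | _, .cons p f => a ⟨_, _, f⟩ * liftPath p

/-- The linear map underlying `PathAlgebra.lift`. -/
def liftLinear : PathAlgebra k V →ₗ[k] B :=
  (pathBasis k).constr k fun p => liftPath e a p.path

theorem liftLinear_ofPath (p : QuiverPath V) :
    liftLinear (k := k) e a (ofPath k p) = liftPath e a p.path := by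
  rw [← pathBasis_apply, liftLinear, Module.Basis.constr_basis]

theorem liftLinear_comp (α : QuiverArrow V) (p : QuiverPath V) (h : p.tgt = α.toPath.src) :
    liftLinear (k := k) e a (ofPath k (α.toPath.comp p h)) =
      a α * liftLinear (k := k) e a (ofPath k p) := by
  obtain ⟨x, y, p⟩ := p
  obtain ⟨y', z, f⟩ := α
  obtain rfl : y = y' := h
  rw [liftLinear_ofPath, liftLinear_ofPath]
  rfl

theorem liftLinear_idem (i : V) : liftLinear (k := k) e a (idem k i) = e i := by
  rw [idem, liftLinear_ofPath]
  rfl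

variable {e a}

theorem mul_liftLinear (he : ∀ i, e i * e i = e i) (hl : ∀ α, e α.tgt * a α = a α)
    (p : QuiverPath V) :
    e p.tgt * liftLinear (k := k) e a (ofPath k p) = liftLinear (k := k) e a (ofPath k p) := by
  induction p using QuiverPath.arrow_induction with
  | nil i => rw [← idem, liftLinear_idem]; exact he i
  | comp α p h _ =>
    rw [liftLinear_comp, ← mul_assoc]
    congr 1
    exact hl α

theorem liftLinear_mul (he : ∀ i, e i * e i = e i) (p : QuiverPath V) :
    liftLinear (k := k) e a (ofPath k p) * e p.src = liftLinear (k := k) e a (ofPath k p) := by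
  induction p using QuiverPath.arrow_induction with
  | nil i => rw [← idem, liftLinear_idem]; exact he i
  | comp α p h ih =>
    rw [liftLinear_comp, mul_assoc]
    congr 1

theorem liftLinear_ofPath_mul (he : ∀ i, e i * e i = e i) (he' : ∀ i j, i ≠ j → e i * e j = 0)
    (hl : ∀ α, e α.tgt * a α = a α) (p q : QuiverPath V) :
    liftLinear e a (ofPath k p * ofPath k q) =
      liftLinear e a (ofPath k p) * liftLinear e a (ofPath k q) := by
  by_cases h : q.tgt = p.src
  · induction p using QuiverPath.arrow_induction with
    | nil i =>
      rw [ofPath_mul_of_eq _ _ h, QuiverPath.nil_comp q i h, ← idem, liftLinear_idem]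
      obtain rfl : q.tgt = i := h
      exact (mul_liftLinear he hl q).symm
    | comp α p h' ih =>
      rw [liftLinear_comp, mul_assoc, ← ih h, ← arr_mul_ofPath, mul_assoc,
        ofPath_mul_of_eq p q h, arr_mul_ofPath α (p.comp q h) h']
      exact liftLinear_comp e a α (p.comp q h) h'
  · rw [ofPath_mul_of_ne _ _ h, map_zero, ← mul_liftLinear he hl q, ← liftLinear_mul he p,
      mul_assoc, ← mul_assoc (e p.src), he' _ _ (fun h' => h h'.symm), zero_mul, mul_zero]

variable (he : ∀ i, e i * e i = e i) (he' : ∀ i j, i ≠ j → e i * e j = 0) (h1 : ∑ i, e i = 1)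
    (hl : ∀ α, e α.tgt * a α = a α)

/-- The universal property of the path algebra: orthogonal idempotents `e i` with sum `1` and
elements `a α` of `e (t α) B` define an algebra map `kQ → B`, sending `α` to `a α * e (s α)`. -/
def lift : PathAlgebra k V →ₐ[k] B :=
  AlgHom.ofLinearMap (liftLinear e a)
    (by
      rw [← sum_idem, map_sum, ← h1]
      exact Finset.sum_congr rfl fun i _ => liftLinear_idem e a i)
    (fun x y => by
      induction x using induction_path with
      | path p =>
        induction y using induction_path with
        | path q => exact liftLinear_ofPath_mul he he' hl p q
        | zero => simp only [mul_zero, map_zero]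
        | add y y' h h' => simp only [mul_add, map_add, h, h']
        | smul c y h => simp only [mul_smul_comm, map_smul, h]
      | zero => simp only [zero_mul, map_zero]
      | add x x' h h' => simp only [add_mul, map_add, h, h']
      | smul c x h => simp only [smul_mul_assoc, map_smul, h])

theorem lift_idem (i : V) : lift (k := k) he he' h1 hl (idem k i) = e i :=
  liftLinear_idem e a i

theorem lift_arr (α : QuiverArrow V) (hr : a α * e α.src = a α) :
    lift (k := k) he he' h1 hl (arr k α) = a α :=
  (liftLinear_ofPath e a _).trans hr

/-- Algebra maps out of `kQ` are determined by the trivial paths and the arrows. -/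
theorem algHom_ext {f g : PathAlgebra k V →ₐ[k] B} (hi : ∀ i, f (idem k i) = g (idem k i))
    (ha : ∀ α, f (arr k α) = g (arr k α)) : f = g := by
  refine AlgHom.toLinearMap_injective (hom_ext fun p => ?_)
  simp only [AlgHom.toLinearMap_apply]
  induction p using QuiverPath.arrow_induction with
  | nil i => exact hi i
  | comp α p h ih => rw [← arr_mul_ofPath, map_mul, map_mul, ih, ha]

end Lift

open Classical in
/-- The character of `kQ` at the vertex `i`: the coefficient of the trivial path at `i`. -/
def char (i : V) : PathAlgebra k V →ₐ[k] k :=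
  lift (e := Pi.single i 1) (a := fun _ => 0)
    (fun j => by by_cases h : j = i <;> simp [h])
    (fun j l h => by
      by_cases h' : j = i
      · subst h'; simp [h.symm]
      · simp [Pi.single_apply, h'])
    (by simp) (fun _ => mul_zero _)

open Classical in
theorem char_idem (i j : V) : char (k := k) i (idem k j) = if j = i then 1 else 0 := by
  rw [char, lift_idem, Pi.single_apply]

theorem char_arr (i : V) (α : QuiverArrow V) : char (k := k) i (arr k α) = 0 := by
  rw [char, lift_arr _ _ _ _ _ (zero_mul _)]

theorem char_ofPath_of_pos (i : V) (p : QuiverPath V) (h : 0 < p.length) :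
    char (k := k) i (ofPath k p) = 0 := by
  induction p using QuiverPath.arrow_induction with
  | nil j => exact absurd h (lt_irrefl _)
  | comp α p h ih => rw [← arr_mul_ofPath, map_mul, char_arr, zero_mul]

open Classical in
theorem char_ofPath_of_zero (i : V) (p : QuiverPath V) (h : p.length = 0) :
    char (k := k) i (ofPath k p) = if p.src = i then 1 else 0 := by
  rw [QuiverPath.eq_nil_of_length_eq_zero h]
  exact char_idem i _

end PathAlgebra

namespace PathAlgebra

variable {k : Type u} {V : Type v} [Field k] [Quiver.{w} V]

/-! ### The derivations of the path algebra given by the arrows -/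

open Classical in
/-- The value on a path of the derivation `PathAlgebra.deriv β`. -/
def derivPath (k : Type u) [Field k] (β : QuiverArrow V) {i : V} :
    {j : V} → Quiver.Path i j → PathAlgebra k V
  | _, .nil => 0
  | j, .cons p f => arr k ⟨_, _, f⟩ * derivPath k β p +
      if p.length = 0 ∧ β = ⟨_, _, f⟩ then idem k j else 0

/-- The linear endomorphism of `kQ` which cancels the arrow `β` at the beginning of a path, i.e.
on the right of it: it sends `p β` to `p`, and it kills the paths that do not begin with `β`.
It is a derivation with values in `kQ`, on which `kQ` acts from the right through the
character at the source of `β`. -/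
def deriv (β : QuiverArrow V) : PathAlgebra k V →ₗ[k] PathAlgebra k V :=
  (pathBasis k).constr k fun p => derivPath k β p.path

variable (β : QuiverArrow V)

theorem deriv_ofPath (p : QuiverPath V) : deriv β (ofPath k p) = derivPath k β p.path := by
  rw [← pathBasis_apply, deriv, Module.Basis.constr_basis]

theorem deriv_idem (i : V) : deriv β (idem k i) = 0 := by
  rw [idem, deriv_ofPath]
  rfl

open Classical in
theorem deriv_comp (α : QuiverArrow V) (p : QuiverPath V) (h : p.tgt = α.toPath.src) :
    deriv β (ofPath k (α.toPath.comp p h)) = arr k α * deriv β (ofPath k p) +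
      if p.length = 0 ∧ β = α then idem k α.tgt else 0 := by
  obtain ⟨x, y, p⟩ := p
  obtain ⟨y', z, f⟩ := α
  obtain rfl : y = y' := h
  rw [deriv_ofPath, deriv_ofPath]
  rfl

variable [Fintype V]

theorem idem_mul_deriv (p : QuiverPath V) :
    idem k p.tgt * deriv β (ofPath k p) = deriv β (ofPath k p) := by
  induction p using QuiverPath.arrow_induction with
  | nil i => rw [← idem, deriv_idem, mul_zero]
  | comp α p h _ =>
    classical
    have h1 : idem k (α.toPath.comp p h).tgt = idem k α.tgt := rfl
    rw [deriv_comp, mul_add, ← mul_assoc, h1, idem_tgt_mul_arr, mul_ite, mul_zero,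
      idem_mul_idem, if_pos rfl]

theorem deriv_idem_mul (i : V) (x : PathAlgebra k V) :
    deriv β (idem k i * x) = idem k i * deriv β x := by
  induction x using induction_path with
  | path p =>
    by_cases h : p.tgt = i
    · subst h
      rw [idem_mul_ofPath_self, idem_mul_deriv]
    · classical
      rw [idem, ofPath_mul_of_ne _ _ h, map_zero, ← idem_mul_deriv, ← mul_assoc, ← idem,
        idem_mul_idem, if_neg (fun h' => h h'.symm), zero_mul]
  | zero => simp only [mul_zero, map_zero]
  | add x y hx hy => simp only [mul_add, map_add, hx, hy]
  | smul c x hx => simp only [mul_smul_comm, map_smul, hx]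

open Classical in
theorem deriv_arr_mul (α : QuiverArrow V) (x : PathAlgebra k V) :
    deriv β (arr k α * x) = arr k α * deriv β x +
      if β = α then char α.src x • idem k α.tgt else 0 := by
  induction x using induction_path with
  | path p =>
    by_cases h : p.tgt = α.toPath.src
    · rw [arr_mul_ofPath α p h, deriv_comp]
      congr 1
      rcases Nat.eq_zero_or_pos p.length with h' | h'
      · have h1 : p.src = α.src := by
          rw [← QuiverPath.tgt_eq_src_of_length_eq_zero h']; exact h
        simp [h', char_ofPath_of_zero, h1]
      · simp [h'.ne', char_ofPath_of_pos _ _ h']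
    · have h1 : arr k α * deriv β (ofPath k p) = 0 := by
        rw [← idem_mul_deriv, ← arr_mul_idem_src, mul_assoc, ← mul_assoc (idem k _),
          idem_mul_idem, if_neg (fun h' => h h'.symm), zero_mul, mul_zero]
      have h2 : char (k := k) α.src (ofPath k p) = 0 := by
        rcases Nat.eq_zero_or_pos p.length with h' | h'
        · rw [char_ofPath_of_zero _ _ h', if_neg]
          rwa [← QuiverPath.tgt_eq_src_of_length_eq_zero h']
        · exact char_ofPath_of_pos _ _ h'
      rw [arr, ofPath_mul_of_ne _ _ h, ← arr, h1, h2]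
      simp
  | zero => simp
  | add x y hx hy =>
    rw [mul_add, map_add, map_add, map_add, hx, hy]
    split_ifs
    · rw [add_smul, mul_add]; abel
    · rw [mul_add]; abel
  | smul c x hx =>
    rw [mul_smul_comm, map_smul, map_smul, map_smul, hx, smul_add, mul_smul_comm]
    split_ifs
    · rw [smul_eq_mul, mul_smul]
    · rw [smul_zero]

/-- The Leibniz rule, which makes `deriv β` an analogue of a Fox derivative. -/
theorem deriv_mul (x y : PathAlgebra k V) :
    deriv β (x * y) = x * deriv β y + char β.src y • deriv β x := by
  induction x using induction_path with
  | path p =>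
    induction p using QuiverPath.arrow_induction with
    | nil i => rw [← idem, deriv_idem_mul, deriv_idem, smul_zero, add_zero]
    | comp α p h ih =>
      classical
      rw [← arr_mul_ofPath, mul_assoc, deriv_arr_mul, deriv_arr_mul, ih, map_mul]
      split_ifs with h'
      · subst h'
        rw [mul_add, smul_add, mul_assoc, mul_smul_comm, smul_smul, mul_comm (char _ y), add_assoc]
      · rw [mul_add, mul_assoc, mul_smul_comm, add_zero, add_zero]
  | zero => simp only [zero_mul, map_zero, smul_zero, add_zero]
  | add x x' hx hx' => rw [add_mul, map_add, map_add, hx, hx', add_mul, smul_add]; abel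
  | smul c x hx => rw [smul_mul_assoc, map_smul, map_smul, hx, smul_add, smul_mul_assoc, smul_comm]

open Classical in
theorem deriv_arr (α : QuiverArrow V) :
    deriv β (arr k α) = if β = α then idem k α.tgt else 0 := by
  have h := deriv_arr_mul β α (idem k α.src)
  rw [arr_mul_idem_src, deriv_idem, mul_zero, zero_add, char_idem, if_pos rfl, one_smul] at h
  exact h

theorem deriv_mul_idem_tgt (x : PathAlgebra k V) : deriv β x * idem k β.tgt = deriv β x := by
  induction x using induction_path with
  | path p =>
    induction p using QuiverPath.arrow_induction with
    | nil i => rw [← idem, deriv_idem, zero_mul]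
    | comp α p h ih =>
      classical
      rw [deriv_comp, add_mul, mul_assoc, ih]
      congr 1
      split_ifs with h'
      · rw [h'.2, idem_mul_idem, if_pos rfl]
      · exact zero_mul _
  | zero => rw [map_zero, zero_mul]
  | add x y hx hy => rw [map_add, add_mul, hx, hy]
  | smul c x hx => rw [map_smul, smul_mul_assoc, hx]

theorem arr_mul_idem (α : QuiverArrow V) (x : PathAlgebra k V) :
    arr k α * ∑ i, char i x • idem k i = char α.src x • arr k α := by
  classical
  rw [← arr_mul_idem_src, mul_assoc, Finset.mul_sum, Finset.sum_eq_single α.src]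
  · rw [mul_smul_comm, mul_smul_comm, idem_mul_idem, if_pos rfl]
  · intro i _ hi
    rw [mul_smul_comm, idem_mul_idem, if_neg hi.symm, smul_zero]
  · simp

section

variable [∀ a b : V, Finite (a ⟶ b)]

/-- Every element of `kQ` is the sum of its component of degree zero and of the products of its
derivatives with the arrows. -/
theorem sum_char_add_sum_deriv (x : PathAlgebra k V) :
    ∑ i, char i x • idem k i + ∑ β, deriv β x * arr k β = x := by
  classical
  induction x using induction_path with
  | path p =>
    induction p using QuiverPath.arrow_induction with
    | nil i =>
      rw [show ofPath k (QuiverPath.nil i) = idem k i from rfl]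
      simp [deriv_idem, char_idem]
    | comp α p h ih =>
      rw [← arr_mul_ofPath]
      have h1 : ∑ i, char (k := k) i (arr k α * ofPath k p) • idem k i = 0 :=
        Finset.sum_eq_zero fun i _ => by rw [map_mul, char_arr, zero_mul, zero_smul]
      have h2 : ∀ β, deriv β (arr k α * ofPath k p) * arr k β = arr k α * (deriv β (ofPath k p) *
          arr k β) + if β = α then char α.src (ofPath k p) • arr k α else 0 := by
        intro β
        rw [deriv_arr_mul, add_mul, mul_assoc]
        split_ifs with hβ
        · rw [hβ, smul_mul_assoc, idem_tgt_mul_arr]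
        · rw [zero_mul]
      rw [h1, zero_add, Finset.sum_congr rfl fun β _ => h2 β, Finset.sum_add_distrib,
        ← Finset.mul_sum, Finset.sum_ite_eq' Finset.univ, if_pos (Finset.mem_univ _),
        ← arr_mul_idem, add_comm, ← mul_add, ih]
  | zero => simp
  | add x y hx hy =>
    conv_rhs => rw [← hx, ← hy]
    simp only [map_add, add_smul, add_mul, Finset.sum_add_distrib]
    abel
  | smul c x hx =>
    conv_rhs => rw [← hx]
    simp only [map_smul, smul_add, smul_mul_assoc, Finset.smul_sum, smul_eq_mul, mul_smul]

end

/-! ### The grading of the path algebra by path length -/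

section Grading

variable {k : Type u} {V : Type v} [Field k] [Quiver.{w} V]

/-- The projection of `kQ` onto the span of the paths of length `j`; it is zero if `j < 0`. -/
def proj (j : ℤ) : PathAlgebra k V →ₗ[k] PathAlgebra k V :=
  (pathBasis k).constr k fun p => if (p.length : ℤ) = j then ofPath k p else 0

theorem proj_ofPath (j : ℤ) (p : QuiverPath V) :
    proj j (ofPath k p) = if (p.length : ℤ) = j then ofPath k p else 0 := by
  conv_lhs => rw [← pathBasis_apply, proj, Module.Basis.constr_basis]

theorem proj_idem (j : ℤ) (i : V) : proj j (idem k i) = if j = 0 then idem k i else 0 := by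
  rw [idem, proj_ofPath]
  exact if_congr eq_comm rfl rfl

theorem proj_arr (j : ℤ) (α : QuiverArrow V) :
    proj j (arr k α) = if j = 1 then arr k α else 0 := by
  rw [arr, proj_ofPath]
  exact if_congr eq_comm rfl rfl

theorem arrowPower_anti {m n : ℕ} (h : m ≤ n) : arrowPower k V n ≤ arrowPower k V m :=
  Submodule.span_mono fun _ ⟨p, hp, hx⟩ => ⟨p, h.trans hp, hx⟩

variable [Fintype V]

theorem proj_proj (i j : ℤ) (x : PathAlgebra k V) :
    proj i (proj j x) = if i = j then proj j x else 0 := by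
  induction x using induction_path with
  | path p =>
    rw [proj_ofPath]
    split_ifs with h h' h'
    · rw [proj_ofPath, if_pos (h.trans h'.symm)]
    · rw [proj_ofPath, if_neg (fun h'' => h' (h''.symm.trans h))]
    · exact map_zero _
    · exact map_zero _
  | zero => simp
  | add x y hx hy => rw [map_add, map_add, hx, hy]; split_ifs <;> simp
  | smul c x hx => rw [map_smul, map_smul, hx]; split_ifs <;> simp

theorem exists_sum_proj (x : PathAlgebra k V) :
    ∃ s : Finset ℤ, ∀ t, s ⊆ t → ∑ j ∈ t, proj j x = x := by
  induction x using induction_path with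
  | path p =>
    refine ⟨{(p.length : ℤ)}, fun t ht => ?_⟩
    simp_rw [proj_ofPath]
    rw [Finset.sum_ite_eq, if_pos (ht (Finset.mem_singleton_self _))]
  | zero => exact ⟨∅, fun t _ => by simp⟩
  | add x y hx hy =>
    obtain ⟨s, hs⟩ := hx
    obtain ⟨s', hs'⟩ := hy
    refine ⟨s ∪ s', fun t ht => ?_⟩
    simp_rw [map_add]
    rw [Finset.sum_add_distrib, hs t (Finset.union_subset_left ht),
      hs' t (Finset.union_subset_right ht)]
  | smul c x hx =>
    obtain ⟨s, hs⟩ := hx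
    refine ⟨s, fun t ht => ?_⟩
    simp_rw [map_smul]
    rw [← Finset.smul_sum, hs t ht]

theorem proj_ofPath_mul (j : ℤ) (p : QuiverPath V) (x : PathAlgebra k V) :
    proj j (ofPath k p * x) = ofPath k p * proj (j - p.length) x := by
  induction x using induction_path with
  | path q =>
    by_cases h : q.tgt = p.src
    · rw [ofPath_mul_of_eq _ _ h, proj_ofPath, proj_ofPath, QuiverPath.length_comp, mul_ite,
        mul_zero, ofPath_mul_of_eq _ _ h]
      refine if_congr ?_ rfl rfl
      push_cast
      constructor <;> intro h' <;> linarith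
    · rw [ofPath_mul_of_ne _ _ h, map_zero, proj_ofPath, mul_ite, ofPath_mul_of_ne _ _ h, mul_zero,
        ite_self]
  | zero => simp only [mul_zero, map_zero]
  | add x y hx hy => simp only [mul_add, map_add, hx, hy]
  | smul c x hx => simp only [mul_smul_comm, map_smul, hx]

theorem proj_proj_mul (i j : ℤ) (a x : PathAlgebra k V) :
    proj j (proj i a * x) = proj i a * proj (j - i) x := by
  induction a using induction_path with
  | path p =>
    rw [proj_ofPath]
    split_ifs with h
    · rw [proj_ofPath_mul, h]
    · rw [zero_mul, zero_mul, map_zero]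
  | zero => simp only [zero_mul, map_zero]
  | add x y hx hy => simp only [add_mul, map_add, hx, hy]
  | smul c x hx => simp only [smul_mul_assoc, map_smul, hx]

theorem proj_mul_idem (j : ℤ) (x : PathAlgebra k V) (i : V) :
    proj j (x * idem k i) = proj j x * idem k i := by
  induction x using induction_path with
  | path p =>
    rw [proj_ofPath_mul, proj_idem, proj_ofPath, mul_ite, ite_mul, mul_zero, zero_mul]
    exact if_congr (sub_eq_zero.trans eq_comm) rfl rfl
  | zero => simp only [zero_mul, map_zero]
  | add x y hx hy => simp only [add_mul, map_add, hx, hy]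
  | smul c x hx => simp only [smul_mul_assoc, map_smul, hx]

theorem proj_deriv (j : ℤ) (β : QuiverArrow V) (x : PathAlgebra k V) :
    proj j (deriv β x) = deriv β (proj (j + 1) x) := by
  classical
  induction x using induction_path with
  | path p =>
    induction p using QuiverPath.arrow_induction generalizing j with
    | nil i =>
      rw [← idem, proj_idem, deriv_idem, map_zero]
      split_ifs
      · rw [deriv_idem]
      · rw [map_zero]
    | comp α p h ih =>
      have h1 := proj_ofPath_mul (k := k) (j + 1) α.toPath (ofPath k p)
      have h2 := proj_ofPath_mul (k := k) j α.toPath (deriv β (ofPath k p))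
      rw [QuiverPath.length_toPath, ← arr] at h1 h2
      have h3 : proj j (if p.length = 0 ∧ β = α then idem k α.tgt else 0) =
          if (p.length : ℤ) = j then (if p.length = 0 ∧ β = α then idem k α.tgt else 0) else 0 := by
        by_cases h' : p.length = 0 ∧ β = α
        · rw [if_pos h', proj_idem, h'.1]
          exact if_congr eq_comm rfl rfl
        · rw [if_neg h', map_zero, ite_self]
      have h4 : ((α.toPath.comp p h).length : ℤ) = j + 1 ↔ (p.length : ℤ) = j := by
        rw [QuiverPath.length_comp, QuiverPath.length_toPath]
        push_cast
        constructor <;> intro h' <;> linarith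
      rw [deriv_comp, map_add, h2, ih, h3, proj_ofPath, proj_ofPath]
      by_cases h' : (p.length : ℤ) = j
      · rw [if_pos (by rw [h']; push_cast; ring), if_pos h', if_pos (h4.2 h'), deriv_comp]
      · rw [if_neg (by push_cast; intro h''; exact h' (by linarith)), if_neg h',
          if_neg (fun h'' => h' (h4.1 h'')), map_zero, mul_zero, add_zero]
  | zero => simp only [map_zero]
  | add x y hx hy => simp only [map_add, hx, hy]
  | smul c x hx => simp only [map_smul, hx]

theorem mem_lengthPart_iff (n : ℕ) (x : PathAlgebra k V) :
    x ∈ lengthPart k V n ↔ proj n x = x := by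
  constructor
  · intro h
    induction h using Submodule.span_induction with
    | mem x hx =>
      obtain ⟨p, rfl, rfl⟩ := hx
      rw [proj_ofPath, if_pos rfl]
    | zero => exact map_zero _
    | add x y _ _ hx hy => rw [map_add, hx, hy]
    | smul c x _ hx => rw [map_smul, hx]
  · intro h
    rw [← h]
    clear h
    induction x using induction_path with
    | path p =>
      rw [proj_ofPath]
      split_ifs with h
      · exact Submodule.subset_span ⟨p, by exact_mod_cast h, rfl⟩
      · exact zero_mem _
    | zero => rw [map_zero]; exact zero_mem _
    | add x y hx hy => rw [map_add]; exact add_mem hx hy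
    | smul c x hx => rw [map_smul]; exact Submodule.smul_mem _ c hx

theorem proj_zero (x : PathAlgebra k V) : proj 0 x = ∑ i, char i x • idem k i := by
  classical
  induction x using induction_path with
  | path p =>
    rw [proj_ofPath]
    split_ifs with h
    · have h' : p.length = 0 := by exact_mod_cast h
      simp_rw [char_ofPath_of_zero _ _ h', ite_smul, one_smul, zero_smul]
      rw [Finset.sum_ite_eq, if_pos (Finset.mem_univ _), QuiverPath.eq_nil_of_length_eq_zero h']
      rfl
    · symm
      refine Finset.sum_eq_zero fun i _ => ?_
      rw [char_ofPath_of_pos, zero_smul]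
      exact Nat.pos_of_ne_zero fun h' => h (by exact_mod_cast h')
  | zero => simp
  | add x y hx hy => simp only [map_add, hx, hy, add_smul, Finset.sum_add_distrib]
  | smul c x hx => simp only [map_smul, hx, Finset.smul_sum, smul_eq_mul, mul_smul]

theorem char_eq_zero_of_proj {j : ℤ} (hj : j ≠ 0) {x : PathAlgebra k V} (hx : proj j x = x)
    (i : V) : char i x = 0 := by
  rw [← hx]
  clear hx
  induction x using induction_path with
  | path p =>
    rw [proj_ofPath]
    split_ifs with h
    · exact char_ofPath_of_pos _ _ (Nat.pos_of_ne_zero fun h' => hj (by rw [← h, h']; rfl))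
    · exact map_zero _
  | zero => simp
  | add x y hx hy => rw [map_add, map_add, hx, hy, add_zero]
  | smul c x hx => rw [map_smul, map_smul, hx, smul_zero]

theorem char_eq_zero_of_mem_arrowPower {x : PathAlgebra k V} (hx : x ∈ arrowPower k V 1) (i : V) :
    char i x = 0 := by
  induction hx using Submodule.span_induction with
  | mem x hx => obtain ⟨p, hp, rfl⟩ := hx; exact char_ofPath_of_pos _ _ hp
  | zero => exact map_zero _
  | add x y _ _ hx hy => rw [map_add, hx, hy, add_zero]
  | smul c x _ hx => rw [map_smul, hx, smul_zero]

theorem char_deriv_eq_zero_of_mem_arrowPower {x : PathAlgebra k V} (hx : x ∈ arrowPower k V 2)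
    (i : V) (β : QuiverArrow V) : char i (deriv β x) = 0 := by
  induction hx using Submodule.span_induction with
  | mem x hx =>
    obtain ⟨p, hp, rfl⟩ := hx
    induction p using QuiverPath.arrow_induction with
    | nil i => exact absurd hp (Nat.not_succ_le_zero 1)
    | comp α p h _ =>
      rw [QuiverPath.length_comp, QuiverPath.length_toPath] at hp
      classical
      rw [deriv_comp, if_neg (fun h' => by rw [h'.1] at hp; omega), add_zero, map_mul, char_arr,
        zero_mul]
  | zero => simp only [map_zero]
  | add x y _ _ hx hy => simp only [map_add, hx, hy, add_zero]
  | smul c x _ hx => simp only [map_smul, hx, smul_zero]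

theorem mul_mem_arrowPower {m n : ℕ} {x y : PathAlgebra k V} (hx : x ∈ arrowPower k V m)
    (hy : y ∈ arrowPower k V n) : x * y ∈ arrowPower k V (m + n) := by
  induction hx using Submodule.span_induction with
  | mem x hx =>
    obtain ⟨p, hp, rfl⟩ := hx
    induction hy using Submodule.span_induction with
    | mem y hy =>
      obtain ⟨q, hq, rfl⟩ := hy
      by_cases h : q.tgt = p.src
      · rw [ofPath_mul_of_eq _ _ h]
        exact Submodule.subset_span
          ⟨_, by rw [QuiverPath.length_comp]; exact add_le_add hp hq, rfl⟩
      · rw [ofPath_mul_of_ne _ _ h]; exact zero_mem _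
    | zero => rw [mul_zero]; exact zero_mem _
    | add x y _ _ hx hy => rw [mul_add]; exact add_mem hx hy
    | smul c x _ hx => rw [mul_smul_comm]; exact Submodule.smul_mem _ c hx
  | zero => rw [zero_mul]; exact zero_mem _
  | add x y _ _ hx hy => rw [add_mul]; exact add_mem hx hy
  | smul c x _ hx => rw [smul_mul_assoc]; exact Submodule.smul_mem _ c hx

theorem mem_arrowPower_zero (x : PathAlgebra k V) : x ∈ arrowPower k V 0 := by
  induction x using induction_path with
  | path p => exact Submodule.subset_span ⟨p, Nat.zero_le _, rfl⟩
  | zero => exact zero_mem _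
  | add x y hx hy => exact add_mem hx hy
  | smul c x hx => exact Submodule.smul_mem _ c hx

theorem pow_mem_arrowPower {x : PathAlgebra k V} (hx : x ∈ arrowPower k V 1) (n : ℕ) :
    x ^ n ∈ arrowPower k V n := by
  induction n with
  | zero => exact mem_arrowPower_zero _
  | succ n ih => rw [pow_succ]; exact mul_mem_arrowPower ih hx

theorem mem_arrowPower_one [∀ a b : V, Finite (a ⟶ b)] {x : PathAlgebra k V}
    (hx : ∀ i, char i x = 0) : x ∈ arrowPower k V 1 := by
  have h := sum_char_add_sum_deriv x
  simp only [hx, zero_smul, Finset.sum_const_zero, zero_add] at h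
  rw [← h]
  refine sum_mem fun β _ => ?_
  have h' := mul_mem_arrowPower (mem_arrowPower_zero (deriv β x))
    (Submodule.subset_span ⟨β.toPath, le_rfl, rfl⟩ : arr k β ∈ arrowPower k V 1)
  rwa [zero_add] at h'

end Grading

end PathAlgebra

namespace BoundQuiverAlgebra

open PathAlgebra

variable {k : Type u} {V : Type v} [Field k] [Quiver.{w} V] [Fintype V]
  (I : TwoSidedIdeal (PathAlgebra k V))

/-! ### Descent to the bound quiver algebra -/

/-- The projection `kQ → A`. -/
def mk : PathAlgebra k V →ₐ[k] BoundQuiverAlgebra I := Ideal.Quotient.mkₐ k I.asIdeal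

theorem mk_eq_zero_iff {x : PathAlgebra k V} : mk I x = 0 ↔ x ∈ I :=
  Ideal.Quotient.eq_zero_iff_mem.trans TwoSidedIdeal.mem_asIdeal

theorem mk_surjective : Function.Surjective (mk I) := Ideal.Quotient.mk_surjective

theorem mem_gradedPart_iff {n : ℕ} {a : BoundQuiverAlgebra I} :
    a ∈ gradedPart I n ↔ ∃ x, proj n x = x ∧ mk I x = a := by
  simp only [gradedPart, Submodule.mem_map, mem_lengthPart_iff]
  rfl

variable {I}

/-- A `k`-linear map on `kQ` that kills `I` descends to `A`. -/
def descend {M : Type*} [AddCommGroup M] [Module k M] (f : PathAlgebra k V →ₗ[k] M)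
    (hf : ∀ x ∈ I, f x = 0) : BoundQuiverAlgebra I →ₗ[k] M where
  toFun := QuotientAddGroup.lift I.asIdeal.toAddSubgroup f.toAddMonoidHom
    fun x hx => hf x (TwoSidedIdeal.mem_asIdeal.1 hx)
  map_add' := map_add _
  map_smul' c a := by
    obtain ⟨x, rfl⟩ := mk_surjective I a
    rw [← map_smul]
    exact map_smul f c x

variable (I) in
/-- The image in `A` of the trivial path at a vertex. -/
def idemA (i : V) : BoundQuiverAlgebra I := mk I (idem k i)

variable (I) in
/-- The image in `A` of an arrow. -/
def arrA (α : QuiverArrow V) : BoundQuiverAlgebra I := mk I (arr k α)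

open Classical in
theorem idemA_mul_idemA (i j : V) : idemA I i * idemA I j = if i = j then idemA I i else 0 := by
  rw [idemA, idemA, ← map_mul, idem_mul_idem]
  split_ifs <;> simp

theorem sum_idemA : ∑ i, idemA I i = 1 := by
  simp_rw [idemA]
  rw [← map_sum, sum_idem, map_one]

theorem idemA_tgt_mul_arrA (α : QuiverArrow V) : idemA I α.tgt * arrA I α = arrA I α := by
  rw [idemA, arrA, ← map_mul, idem_tgt_mul_arr]

theorem arrA_mul_idemA_src (α : QuiverArrow V) : arrA I α * idemA I α.src = arrA I α := by
  rw [idemA, arrA, ← map_mul, arr_mul_idem_src]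

/-! ### Characters and coefficients of arrows -/

section Admissible

variable (hadm : IsAdmissible I)

theorem char_eq_zero_of_mem (hadm : IsAdmissible I) (i : V) {x : PathAlgebra k V} (hx : x ∈ I) :
    char i x = 0 :=
  char_eq_zero_of_mem_arrowPower (arrowPower_anti one_le_two (hadm.2 x hx)) i

/-- The character of `A` at the vertex `i`. -/
def charA (i : V) : BoundQuiverAlgebra I →ₐ[k] k :=
  Ideal.Quotient.liftₐ I.asIdeal (char i) fun _ hx =>
    char_eq_zero_of_mem hadm i (TwoSidedIdeal.mem_asIdeal.1 hx)

theorem charA_mk (i : V) (x : PathAlgebra k V) : charA hadm i (mk I x) = char i x := rfl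

open Classical in
theorem charA_idemA (i j : V) : charA hadm i (idemA I j) = if j = i then 1 else 0 :=
  char_idem i j

/-- The coefficient of an arrow, as a linear form on `A`; it is well defined since the elements of
`I` have no component of degree one. -/
def coefA (β : QuiverArrow V) : BoundQuiverAlgebra I →ₗ[k] k :=
  descend ((char β.tgt).toLinearMap ∘ₗ deriv β)
    fun x hx => char_deriv_eq_zero_of_mem_arrowPower (hadm.2 x hx) _ _

theorem coefA_mk (β : QuiverArrow V) (x : PathAlgebra k V) :
    coefA hadm β (mk I x) = char β.tgt (deriv β x) := rfl

open Classical in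
theorem coefA_arrA (α β : QuiverArrow V) :
    coefA hadm β (arrA I α) = if β = α then 1 else 0 := by
  rw [arrA, coefA_mk, deriv_arr]
  split_ifs with h
  · rw [h, char_idem, if_pos rfl]
  · exact map_zero _

/-- The coefficient of an arrow is a derivation for the characters at its target and its
source. -/
theorem coefA_mul (β : QuiverArrow V) (a b : BoundQuiverAlgebra I) :
    coefA hadm β (a * b) =
      charA hadm β.tgt a * coefA hadm β b + charA hadm β.src b * coefA hadm β a := by
  obtain ⟨x, rfl⟩ := mk_surjective I a
  obtain ⟨y, rfl⟩ := mk_surjective I b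
  rw [← map_mul, coefA_mk, PathAlgebra.deriv_mul, map_add, map_mul, map_smul]
  rfl

variable [∀ a b : V, Finite (a ⟶ b)]

/-- The elements of `A` without component of degree zero are sums of left multiples of arrows. -/
theorem exists_sum_mul_arrA {a : BoundQuiverAlgebra I} (ha : ∀ i, charA hadm i a = 0) :
    ∃ c : QuiverArrow V → BoundQuiverAlgebra I, a = ∑ β, c β * arrA I β := by
  obtain ⟨x, rfl⟩ := mk_surjective I a
  refine ⟨fun β => mk I (deriv β x), ?_⟩
  have h := sum_char_add_sum_deriv x
  simp only [fun i => show char i x = 0 from ha i, zero_smul, Finset.sum_const_zero,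
    zero_add] at h
  conv_lhs => rw [← h]
  rw [map_sum]
  simp_rw [map_mul]
  rfl

/-- The radical of `A` is the image of the arrow ideal. -/
theorem mem_jacobson_iff (a : BoundQuiverAlgebra I) :
    a ∈ Ring.jacobson (BoundQuiverAlgebra I) ↔ ∀ i, charA hadm i a = 0 := by
  constructor
  · intro ha i
    have hs : Function.Surjective (charA hadm i : BoundQuiverAlgebra I →+* k) := fun c =>
      ⟨algebraMap k _ c, (charA hadm i).commutes c⟩
    have : RingHomSurjective (charA hadm i : BoundQuiverAlgebra I →+* k) := ⟨hs⟩
    have h := Ring.map_jacobson_le (charA hadm i : BoundQuiverAlgebra I →+* k)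
      ⟨a, ha, rfl⟩
    -- the field `k` has zero radical
    rw [IsArtinianRing.isSemisimpleRing_iff_jacobson.1 inferInstance] at h
    exact h
  · intro ha
    rw [← Ideal.jacobson_bot, Ideal.mem_jacobson_iff]
    intro y
    obtain ⟨m, -, hm⟩ := hadm.1
    have hn : (y * a) ^ m = 0 := by
      obtain ⟨x, hx⟩ := mk_surjective I (y * a)
      rw [← hx, ← map_pow, mk_eq_zero_iff]
      refine hm _ (pow_mem_arrowPower (mem_arrowPower_one fun i => ?_) m)
      rw [← charA_mk hadm, hx, map_mul, ha, mul_zero]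
    obtain ⟨z, hz⟩ := (IsNilpotent.isUnit_one_add ⟨m, hn⟩).exists_left_inv
    refine ⟨z, ?_⟩
    rw [Ideal.mem_bot, mul_assoc, ← hz, mul_add, mul_one]
    abel

end Admissible

/-! ### The grading of a quadratic algebra -/

section Quadratic

variable (hquad : IsQuadratic I)

/-- A quadratic ideal is homogeneous for the grading by path length. -/
theorem proj_mem (hquad : IsQuadratic I) {x : PathAlgebra k V} (hx : x ∈ I) (j : ℤ) :
    proj j x ∈ I := by
  obtain ⟨S, hS, rfl⟩ := hquad
  open Pointwise in
  rw [TwoSidedIdeal.mem_span_iff_mem_addSubgroup_closure] at hx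
  induction hx using AddSubgroup.closure_induction generalizing j with
  | mem x hx =>
    obtain ⟨_, ⟨a, -, s, hs, rfl⟩, b, -, rfl⟩ := hx
    have hs' : proj 2 s = s := (mem_lengthPart_iff 2 s).1 (hS hs)
    have hsm := TwoSidedIdeal.subset_span hs
    obtain ⟨t, ht⟩ := exists_sum_proj a
    have : proj j (a * s * b) = ∑ i ∈ t, proj i a * s * proj (j - i - 2) b := by
      conv_lhs => rw [← ht t subset_rfl]
      rw [Finset.sum_mul, Finset.sum_mul, map_sum]
      refine Finset.sum_congr rfl fun i _ => ?_
      rw [mul_assoc, proj_proj_mul, ← hs', proj_proj_mul, hs', mul_assoc]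
    dsimp only at this ⊢
    rw [this]
    exact sum_mem fun i _ =>
      TwoSidedIdeal.mul_mem_right _ _ _ (TwoSidedIdeal.mul_mem_left _ _ _ hsm)
  | zero => rw [map_zero]; exact zero_mem _
  | add x y _ _ hx hy => rw [map_add]; exact add_mem (hx j) (hy j)
  | neg x _ hx => rw [map_neg]; exact neg_mem (hx j)

/-- The projection of `A` onto its part of degree `j`. -/
def projA (j : ℤ) : BoundQuiverAlgebra I →ₗ[k] BoundQuiverAlgebra I :=
  descend ((mk I).toLinearMap ∘ₗ proj j) fun _ hx => (mk_eq_zero_iff I).2 (proj_mem hquad hx j)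

theorem projA_mk (j : ℤ) (x : PathAlgebra k V) : projA hquad j (mk I x) = mk I (proj j x) := rfl

theorem projA_projA (i j : ℤ) (a : BoundQuiverAlgebra I) :
    projA hquad i (projA hquad j a) = if i = j then projA hquad j a else 0 := by
  obtain ⟨x, rfl⟩ := mk_surjective I a
  rw [projA_mk, projA_mk, proj_proj]
  split_ifs <;> simp

theorem exists_sum_projA (a : BoundQuiverAlgebra I) :
    ∃ s : Finset ℤ, ∀ t, s ⊆ t → ∑ j ∈ t, projA hquad j a = a := by
  obtain ⟨x, rfl⟩ := mk_surjective I a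
  obtain ⟨s, hs⟩ := exists_sum_proj x
  refine ⟨s, fun t ht => ?_⟩
  simp_rw [projA_mk]
  rw [← map_sum, hs t ht]

theorem projA_projA_mul (i j : ℤ) (a b : BoundQuiverAlgebra I) :
    projA hquad j (projA hquad i a * b) = projA hquad i a * projA hquad (j - i) b := by
  obtain ⟨x, rfl⟩ := mk_surjective I a
  obtain ⟨y, rfl⟩ := mk_surjective I b
  rw [projA_mk, projA_mk, ← map_mul, projA_mk, proj_proj_mul, map_mul]

theorem projA_mul_idemA (j : ℤ) (a : BoundQuiverAlgebra I) (i : V) :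
    projA hquad j (a * idemA I i) = projA hquad j a * idemA I i := by
  obtain ⟨x, rfl⟩ := mk_surjective I a
  rw [idemA, ← map_mul, projA_mk, projA_mk, proj_mul_idem, map_mul]

theorem projA_arrA (α : QuiverArrow V) : projA hquad 1 (arrA I α) = arrA I α := by
  rw [arrA, projA_mk, proj_arr, if_pos rfl]

theorem projA_of_mem_gradedPart {n : ℕ} {a : BoundQuiverAlgebra I} (ha : a ∈ gradedPart I n) :
    projA hquad n a = a := by
  obtain ⟨x, hx, rfl⟩ := (mem_gradedPart_iff I).1 ha
  rw [projA_mk, hx]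

theorem charA_eq_zero_of_projA (hadm : IsAdmissible I) {j : ℤ} (hj : j ≠ 0)
    {a : BoundQuiverAlgebra I} (ha : projA hquad j a = a) (i : V) : charA hadm i a = 0 := by
  obtain ⟨x, rfl⟩ := mk_surjective I a
  rw [← ha, projA_mk, charA_mk]
  exact char_eq_zero_of_proj hj (by rw [proj_proj, if_pos rfl]) i

end Quadratic

/-! ### The relations -/

/-- The derivatives of `x ∈ kQ`, as a vector with entries in `A`. For `x ∈ I` this vector is the
relation between the arrows given by the equation `x = ∑ (deriv β x) β`. -/
def derivVec (I : TwoSidedIdeal (PathAlgebra k V)) (x : PathAlgebra k V)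
    (β : QuiverArrow V) : BoundQuiverAlgebra I := mk I (deriv β x)

/-- The relation vectors: the derivatives of the elements of degree two of `I`. -/
def relVecs (I : TwoSidedIdeal (PathAlgebra k V)) :
    Set (QuiverArrow V → BoundQuiverAlgebra I) :=
  {z | ∃ s ∈ I, proj 2 s = s ∧ derivVec I s = z}

/-- In the quadratic case, the derivatives of the elements of `I` are combinations of
the relation vectors. -/
theorem derivVec_mem_span (hadm : IsAdmissible I) (hquad : IsQuadratic I) {x : PathAlgebra k V}
    (hx : x ∈ I) : derivVec I x ∈ Submodule.span (BoundQuiverAlgebra I) (relVecs I) := by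
  have hc : ∀ x ∈ I, ∀ i, char i x = 0 := fun x hx i => char_eq_zero_of_mem hadm i hx
  obtain ⟨S, hS, hI⟩ := id hquad
  rw [hI] at hx
  open Pointwise in
  rw [TwoSidedIdeal.mem_span_iff_mem_addSubgroup_closure] at hx
  induction hx using AddSubgroup.closure_induction with
  | mem x hx =>
    obtain ⟨_, ⟨a, -, s, hs, rfl⟩, b, -, rfl⟩ := hx
    have hs' : proj 2 s = s := (mem_lengthPart_iff 2 s).1 (hS hs)
    have hsm : s ∈ I := hI ▸ TwoSidedIdeal.subset_span hs
    -- Modulo `I`, only the component of degree zero of `b` contributes.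
    have key : derivVec I (a * s * b) = mk I a • derivVec I (s * proj 0 b) := by
      funext β
      have h0 : char β.src (proj 0 b) = char β.src b := by
        classical
        rw [proj_zero, map_sum]
        simp [char_idem]
      have h1 : mk I (a * s * deriv β b) = 0 := (mk_eq_zero_iff I).2
        (TwoSidedIdeal.mul_mem_right _ _ _ (TwoSidedIdeal.mul_mem_left _ _ _ hsm))
      have h2 : mk I (s * deriv β (proj 0 b)) = 0 := (mk_eq_zero_iff I).2
        (TwoSidedIdeal.mul_mem_right _ _ _ hsm)
      simp only [derivVec, Pi.smul_apply, PathAlgebra.deriv_mul, map_add, map_smul, h1, h2, h0,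
        hc s hsm, zero_smul, add_zero, zero_add, map_mul, smul_eq_mul, mul_smul_comm]
    dsimp only
    rw [key]
    refine Submodule.smul_mem _ _ (Submodule.subset_span
      ⟨_, TwoSidedIdeal.mul_mem_right _ _ _ hsm, ?_, rfl⟩)
    conv_lhs => rw [← hs', proj_proj_mul, hs', sub_self, proj_proj, if_pos rfl]
  | zero =>
    have h : derivVec I 0 = 0 := by funext β; simp [derivVec]
    rw [h]
    exact zero_mem _
  | add x y _ _ hx hy => convert add_mem hx hy using 1; funext β; simp [derivVec]
  | neg x _ hx => convert neg_mem hx using 1; funext β; simp [derivVec]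

end BoundQuiverAlgebra

namespace BoundQuiverAlgebra

open PathAlgebra

variable {k : Type u} {V : Type v} [Field k] [Quiver.{w} V] [Fintype V]
  {I : TwoSidedIdeal (PathAlgebra k V)}

/-! ### The semisimple quotient -/

section Top

variable (I) in
/-- The projection `A → A / rad A`, as a map of left `A`-modules. -/
def toTop : BoundQuiverAlgebra I →ₗ[BoundQuiverAlgebra I] Top I :=
  (Ring.jacobson (BoundQuiverAlgebra I)).mkQ

theorem toTop_surjective : Function.Surjective (toTop I) := Submodule.mkQ_surjective _

theorem toTop_mul (a b : BoundQuiverAlgebra I) : toTop I (a * b) = toTop I a * toTop I b := rfl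

variable [∀ a b : V, Finite (a ⟶ b)] (hadm : IsAdmissible I)

/-- The character of `A / rad A` at a vertex. -/
def charTop (i : V) : Top I →ₐ[k] k :=
  Ideal.Quotient.liftₐ _ (charA hadm i) fun a ha => (mem_jacobson_iff hadm a).1 ha i

theorem charTop_toTop (i : V) (a : BoundQuiverAlgebra I) :
    charTop hadm i (toTop I a) = charA hadm i a := rfl

theorem charTop_smul (i : V) (a : BoundQuiverAlgebra I) (l : Top I) :
    charTop hadm i (a • l) = charA hadm i a * charTop hadm i l := by
  obtain ⟨b, rfl⟩ := toTop_surjective l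
  rw [← map_smul, charTop_toTop, charTop_toTop, smul_eq_mul, map_mul]

theorem toTop_eq_zero_iff (a : BoundQuiverAlgebra I) :
    toTop I a = 0 ↔ ∀ i, charA hadm i a = 0 := by
  rw [← mem_jacobson_iff]
  exact Submodule.Quotient.mk_eq_zero _

/-- The characters embed `A / rad A` into a product of copies of `k`. -/
theorem charTop_ext {l l' : Top I} (h : ∀ i, charTop hadm i l = charTop hadm i l') : l = l' := by
  rw [← sub_eq_zero]
  obtain ⟨a, ha⟩ := toTop_surjective (l - l')
  rw [← ha, toTop_eq_zero_iff hadm]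
  intro i
  rw [← charTop_toTop, ha, map_sub, h, sub_self]

/-- A family of additive maps `M → k`, on which `A` acts through its characters, as a map of left
`A`-modules to `A / rad A`. -/
def topHom {M : Type*} [AddCommGroup M] [Module (BoundQuiverAlgebra I) M] (χ : V → M →+ k)
    (hχ : ∀ i a m, χ i (a • m) = charA hadm i a * χ i m) :
    M →ₗ[BoundQuiverAlgebra I] Top I where
  toFun m := toTop I (∑ i, χ i m • idemA I i)
  map_add' m m' := by simp only [map_add, add_smul, Finset.sum_add_distrib]
  map_smul' a m := by
    classical
    refine charTop_ext hadm fun i => ?_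
    rw [RingHom.id_apply, charTop_smul, charTop_toTop, charTop_toTop]
    simp [hχ, charA_idemA]

theorem charTop_topHom {M : Type*} [AddCommGroup M] [Module (BoundQuiverAlgebra I) M]
    (χ : V → M →+ k) (hχ : ∀ i a m, χ i (a • m) = charA hadm i a * χ i m) (i : V) (m : M) :
    charTop hadm i (topHom hadm χ hχ m) = χ i m := by
  classical
  refine (charTop_toTop hadm i _).trans ?_
  simp [charA_idemA]

end Top

/-! ### The radical and its projective cover -/

section Syzygies

variable (I) in
/-- The radical of `A`, as the kernel of `A → A / rad A`. -/
abbrev Rad : Submodule (BoundQuiverAlgebra I) (BoundQuiverAlgebra I) := LinearMap.ker (toTop I)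

variable (I) in
/-- The projective module `⨁ A e_(t β)`, the sum being over the arrows `β`, as a submodule of the
free module of functions on the arrows. -/
def ArrowCover : Submodule (BoundQuiverAlgebra I) (QuiverArrow V → BoundQuiverAlgebra I) where
  carrier := {z | ∀ β, z β * idemA I β.tgt = z β}
  zero_mem' := fun β => zero_mul _
  add_mem' := fun {z z'} hz hz' β => by rw [Pi.add_apply, add_mul, hz, hz']
  smul_mem' := fun a z hz β => by
    rw [Pi.smul_apply, smul_eq_mul, mul_assoc, hz]

open Classical in
/-- The generator of `ArrowCover` given by an arrow. -/
def coverGen (I : TwoSidedIdeal (PathAlgebra k V)) (β : QuiverArrow V) : ArrowCover I :=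
  ⟨Pi.single β (idemA I β.tgt), fun γ => by
    by_cases h : γ = β
    · subst h; rw [Pi.single_eq_same, idemA_mul_idemA, if_pos rfl]
    · rw [Pi.single_eq_of_ne h, zero_mul]⟩

open Classical in
theorem charA_apply_eq_ite (hadm : IsAdmissible I) (z : ArrowCover I) (i : V) (β : QuiverArrow V) :
    charA hadm i (z.1 β) = if β.tgt = i then charA hadm β.tgt (z.1 β) else 0 := by
  have h := congrArg (charA hadm i) (z.2 β)
  rw [map_mul, charA_idemA] at h
  split_ifs with h'
  · rw [h']
  · rw [← h, if_neg h', mul_zero]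

variable [∀ a b : V, Finite (a ⟶ b)] (hadm : IsAdmissible I)

theorem mem_Rad_iff (a : BoundQuiverAlgebra I) : a ∈ Rad I ↔ ∀ i, charA hadm i a = 0 :=
  LinearMap.mem_ker.trans (toTop_eq_zero_iff hadm a)

theorem charA_eq_zero_of_mem_Rad (x : Rad I) (i : V) : charA hadm i x.1 = 0 :=
  (mem_Rad_iff hadm _).1 x.2 i

theorem sum_smul_coverGen (z : ArrowCover I) : ∑ β, z.1 β • coverGen I β = z := by
  classical
  refine Subtype.ext (funext fun γ => ?_)
  rw [AddSubmonoidClass.coe_finsetSum, Finset.sum_apply, Finset.sum_eq_single γ]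
  · refine Eq.trans ?_ (z.2 γ)
    simp [coverGen]
  · intro β _ hβ
    simp [coverGen, hβ.symm]
  · simp

/-- The map out of `ArrowCover` with prescribed values on the generators. -/
def coverDesc {M : Type*} [AddCommGroup M] [Module (BoundQuiverAlgebra I) M]
    (q : QuiverArrow V → M) : ArrowCover I →ₗ[BoundQuiverAlgebra I] M where
  toFun z := ∑ β, z.1 β • q β
  map_add' z z' := by simp [add_smul, Finset.sum_add_distrib]
  map_smul' a z := by simp [mul_smul, Finset.smul_sum]

theorem coverDesc_apply {M : Type*} [AddCommGroup M] [Module (BoundQuiverAlgebra I) M]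
    (q : QuiverArrow V → M) (z : ArrowCover I) : coverDesc q z = ∑ β, z.1 β • q β := rfl

theorem coverDesc_coverGen {M : Type*} [AddCommGroup M] [Module (BoundQuiverAlgebra I) M]
    (q : QuiverArrow V → M) (β : QuiverArrow V) :
    coverDesc q (coverGen I β) = idemA I β.tgt • q β := by
  classical
  rw [coverDesc_apply, Finset.sum_eq_single β]
  · simp [coverGen]
  · intro γ _ hγ
    simp [coverGen, hγ]
  · simp

instance : Module.Projective (BoundQuiverAlgebra I) (ArrowCover I) :=
  Module.Projective.of_split (ArrowCover I).subtype
    (∑ β, (LinearMap.toSpanSingleton (BoundQuiverAlgebra I) _ (coverGen I β)) ∘ₗ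
      LinearMap.proj β)
    (by
      ext z : 1
      simpa using sum_smul_coverGen z)

/-- An arrow, as an element of the radical. -/
def radArr (β : QuiverArrow V) : Rad I :=
  ⟨arrA I β, (mem_Rad_iff hadm _).2 fun i => (charA_mk hadm i _).trans (char_arr i β)⟩

theorem idemA_smul_radArr (β : QuiverArrow V) :
    idemA I β.tgt • radArr hadm β = radArr hadm β :=
  Subtype.ext (idemA_tgt_mul_arrA β)

theorem exists_sum_smul_radArr (x : Rad I) :
    ∃ c : QuiverArrow V → BoundQuiverAlgebra I, x = ∑ β, c β • radArr hadm β := by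
  obtain ⟨c, hc⟩ := exists_sum_mul_arrA hadm ((mem_Rad_iff hadm _).1 x.2)
  refine ⟨c, Subtype.ext ?_⟩
  rw [hc, AddSubmonoidClass.coe_finsetSum]
  rfl

theorem rad_hom_ext {M : Type*} [AddCommGroup M] [Module (BoundQuiverAlgebra I) M]
    {f g : Rad I →ₗ[BoundQuiverAlgebra I] M}
    (h : ∀ β, f (radArr hadm β) = g (radArr hadm β)) : f = g := by
  ext x
  obtain ⟨c, rfl⟩ := exists_sum_smul_radArr hadm x
  simp [h]

/-- The projective cover `⨁ A e_(t β) → rad A` sending the generators to the arrows. -/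
def coverToRad : ArrowCover I →ₗ[BoundQuiverAlgebra I] Rad I := coverDesc (radArr hadm)

theorem coverToRad_coverGen (β : QuiverArrow V) :
    coverToRad hadm (coverGen I β) = radArr hadm β := by
  rw [coverToRad, coverDesc_coverGen, idemA_smul_radArr]

theorem coverToRad_surjective : Function.Surjective (coverToRad hadm) := by
  intro x
  obtain ⟨c, rfl⟩ := exists_sum_smul_radArr hadm x
  exact ⟨∑ β, c β • coverGen I β, by simp [coverToRad_coverGen]⟩

theorem coe_coverToRad (z : ArrowCover I) :
    (coverToRad hadm z).1 = ∑ β, z.1 β * arrA I β := by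
  rw [coverToRad, coverDesc_apply, AddSubmonoidClass.coe_finsetSum]
  rfl

/-- The module of relations between the arrows. -/
abbrev Relations : Submodule (BoundQuiverAlgebra I) (ArrowCover I) :=
  LinearMap.ker (coverToRad hadm)

theorem coefA_coverToRad (z : ArrowCover I) (β : QuiverArrow V) :
    coefA hadm β (coverToRad hadm z).1 = charA hadm β.tgt (z.1 β) := by
  classical
  rw [coe_coverToRad, map_sum, Finset.sum_eq_single β]
  · rw [coefA_mul, coefA_arrA, if_pos rfl, mul_one, arrA, charA_mk, char_arr, zero_mul, add_zero]
  · intro γ _ hγ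
    rw [coefA_mul, coefA_arrA, if_neg hγ.symm, mul_zero, arrA, charA_mk, char_arr, zero_mul,
      add_zero]
  · simp

/-- The entries of a relation lie in the radical: the cover `⨁ A e_(t β) → rad A` is minimal. -/
theorem charA_relation (z : Relations hadm) (i : V) (β : QuiverArrow V) :
    charA hadm i (z.1.1 β) = 0 := by
  classical
  rw [charA_apply_eq_ite, ← coefA_coverToRad, LinearMap.mem_ker.1 z.2]
  simp

/-- The derivatives of an element of `I`, as a relation between the arrows. -/
def relOf (x : PathAlgebra k V) (hx : x ∈ I) : Relations hadm :=
  ⟨⟨derivVec I x, fun β => by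
    rw [derivVec, idemA, ← map_mul, deriv_mul_idem_tgt]⟩, by
    refine LinearMap.mem_ker.2 (Subtype.ext ?_)
    rw [coe_coverToRad]
    have h := sum_char_add_sum_deriv x
    simp only [fun i => char_eq_zero_of_mem hadm i hx, zero_smul, Finset.sum_const_zero,
      zero_add] at h
    refine Eq.trans ?_ ((mk_eq_zero_iff I).2 hx)
    conv_rhs => rw [← h, map_sum]
    exact Finset.sum_congr rfl fun β _ => (map_mul _ _ _).symm⟩

/-- Every relation between the arrows comes from an element of `I`. -/
theorem relOf_surjective (z : Relations hadm) : ∃ x hx, relOf hadm x hx = z := by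
  choose y hy using fun β => mk_surjective I (z.1.1 β)
  have hmk : mk I (∑ β, y β * idem k β.tgt * arr k β) = 0 := by
    refine Eq.trans ?_ (congrArg Subtype.val (LinearMap.mem_ker.1 z.2))
    rw [coe_coverToRad, map_sum]
    refine Finset.sum_congr rfl fun β _ => ?_
    rw [map_mul, map_mul, hy]
    exact congrArg (· * arrA I β) (z.1.2 β)
  refine ⟨_, (mk_eq_zero_iff I).1 hmk, Subtype.ext (Subtype.ext (funext fun γ => ?_))⟩
  classical
  refine Eq.trans (b := mk I (y γ * idem k γ.tgt)) ?_ ?_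
  · refine congrArg (mk I) ?_
    rw [map_sum, Finset.sum_eq_single γ]
    · rw [PathAlgebra.deriv_mul, deriv_arr, if_pos rfl, char_arr, zero_smul, add_zero, mul_assoc,
        idem_mul_idem, if_pos rfl]
    · intro β _ hβ
      rw [PathAlgebra.deriv_mul, deriv_arr, if_neg hβ.symm, char_arr, zero_smul, add_zero,
        mul_zero]
    · simp
  · rw [map_mul, hy]
    exact z.1.2 γ

/-- In the quadratic case, the module of relations is generated by the relations
of degree two. -/
theorem relations_induction (hquad : IsQuadratic I) {p : Relations hadm → Prop}
    (rel : ∀ s hs, proj 2 s = s → p (relOf hadm s hs)) (zero : p 0)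
    (add : ∀ z z', p z → p z' → p (z + z'))
    (smul : ∀ (a : BoundQuiverAlgebra I) z, p z → p (a • z)) (z : Relations hadm) : p z := by
  obtain ⟨x, hx, rfl⟩ := relOf_surjective hadm z
  have key : ∀ y ∈ Submodule.span (BoundQuiverAlgebra I) (relVecs I),
      ∃ z : Relations hadm, z.1.1 = y ∧ p z := by
    intro y hy
    induction hy using Submodule.span_induction with
    | mem y hy =>
      obtain ⟨s, hs, hs2, rfl⟩ := hy
      exact ⟨relOf hadm s hs, rfl, rel s hs hs2⟩
    | zero => exact ⟨0, rfl, zero⟩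
    | add y y' _ _ hy hy' =>
      obtain ⟨z, rfl, hz⟩ := hy
      obtain ⟨z', rfl, hz'⟩ := hy'
      exact ⟨z + z', rfl, add z z' hz hz'⟩
    | smul a y _ hy =>
      obtain ⟨z, rfl, hz⟩ := hy
      exact ⟨a • z, rfl, smul a z hz⟩
  obtain ⟨z, hz, hp⟩ := key _ (derivVec_mem_span hadm hquad hx)
  have : z = relOf hadm x hx := Subtype.ext (Subtype.ext hz)
  exact this ▸ hp

end Syzygies

/-! ### `Ext¹` and `Ext²` by dimension shifting -/

section DimensionShift

open Abelian

variable {C : Type*} [Category* C] [Abelian C] [HasExt C] {S : ShortComplex C}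

/-- If every map `S.X₂ ⟶ Y` vanishes on `S.X₁`, then the connecting map
`Hom (S.X₁, Y) → Ext¹ (S.X₃, Y)` is injective. -/
theorem eq_zero_of_extClass_comp_mk₀ (hS : S.ShortExact) {Y : C}
    (h : ∀ g : S.X₂ ⟶ Y, S.f ≫ g = 0) {f : S.X₁ ⟶ Y}
    (hf : hS.extClass.comp (Ext.mk₀ f) (add_zero 1) = 0) : f = 0 := by
  obtain ⟨x, hx⟩ := Ext.contravariant_sequence_exact₁ hS _ _ (add_zero 1) hf
  obtain ⟨g, rfl⟩ := (Ext.mk₀_bijective S.X₂ Y).2 x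
  rw [Ext.mk₀_comp_mk₀, h, Ext.mk₀_zero] at hx
  exact (Ext.mk₀_eq_zero_iff f).1 hx.symm

theorem exists_extClass_comp_mk₀ (hS : S.ShortExact) [Projective S.X₂] {Y : C}
    (x : Ext S.X₃ Y 1) : ∃ f : S.X₁ ⟶ Y, hS.extClass.comp (Ext.mk₀ f) (add_zero 1) = x := by
  obtain ⟨x', hx'⟩ := Ext.contravariant_sequence_exact₃ hS _ x (Ext.eq_zero_of_projective _)
    (add_zero 1)
  obtain ⟨f, rfl⟩ := (Ext.mk₀_bijective S.X₁ Y).2 x'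
  exact ⟨f, hx'⟩

theorem eq_zero_of_extClass_comp (hS : S.ShortExact) [Projective S.X₂] {Y : C}
    {x : Ext S.X₁ Y 1} (hx : hS.extClass.comp x (rfl : 1 + 1 = 2) = 0) : x = 0 := by
  obtain ⟨y, rfl⟩ := Ext.contravariant_sequence_exact₁ hS _ _ rfl hx
  rw [Ext.eq_zero_of_projective y, Ext.comp_zero]

end DimensionShift

section Ext

open Abelian

variable (I) in
theorem shortExact_rad : (toTop I).shortComplexKer.ShortExact :=
  LinearMap.shortExact_shortComplexKer toTop_surjective

/-- The multiplication by scalars on `Ext` is induced by the action of the scalars in `A` on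
modules. -/
theorem comp_mk₀_eq_smul {M N P : ModuleCat.{max u v w} (BoundQuiverAlgebra I)} (c : k)
    (f g : M ⟶ N) (h : ∀ m, g.hom m = algebraMap k (BoundQuiverAlgebra I) c • f.hom m)
    (x : Ext P M 1) :
    x.comp (Ext.mk₀ g) (add_zero 1) = c • x.comp (Ext.mk₀ f) (add_zero 1) := by
  have hg : g = c • f := ModuleCat.hom_ext (LinearMap.ext h)
  rw [hg, Ext.mk₀_smul, Ext.comp_smul]

variable [∀ a b : V, Finite (a ⟶ b)] (hadm : IsAdmissible I)

theorem shortExact_relations : (coverToRad hadm).shortComplexKer.ShortExact :=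
  LinearMap.shortExact_shortComplexKer (coverToRad_surjective hadm)

instance : Projective (ModuleCat.of (BoundQuiverAlgebra I) (BoundQuiverAlgebra I)) :=
  (IsProjective.iff_projective _).1 inferInstance

theorem apply_rad_eq_zero (hadm : IsAdmissible I)
    (f : BoundQuiverAlgebra I →ₗ[BoundQuiverAlgebra I] Top I) (x : Rad I) :
    f x.1 = 0 := by
  refine charTop_ext hadm fun i => ?_
  rw [← mul_one x.1, ← smul_eq_mul, map_smul, charTop_smul, charA_eq_zero_of_mem_Rad, zero_mul,
    map_zero]

theorem apply_relation_eq_zero (f : ArrowCover I →ₗ[BoundQuiverAlgebra I] Top I)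
    (z : Relations hadm) : f z.1 = 0 := by
  refine charTop_ext hadm fun i => ?_
  rw [← sum_smul_coverGen z.1, map_sum, map_sum, map_zero]
  refine Finset.sum_eq_zero fun β _ => ?_
  rw [map_smul, charTop_smul, charA_relation, zero_mul]

open Classical in
/-- The map `rad A → A / rad A` with prescribed coefficients on the arrows: it sends the arrow `β`
to `c β e_(t β)`. -/
def radHom (c : QuiverArrow V → k) : Rad I →ₗ[BoundQuiverAlgebra I] Top I :=
  topHom hadm (fun i => ∑ β, if β.tgt = i then
      c β • (coefA hadm β).toAddMonoidHom.comp (Rad I).subtype.toAddMonoidHom else 0)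
    (fun i a x => by
      simp only [AddMonoidHom.finsetSum_apply, Finset.mul_sum]
      refine Finset.sum_congr rfl fun β _ => ?_
      split_ifs with h
      · subst h
        have : coefA hadm β (a * x.1) = charA hadm β.tgt a * coefA hadm β x.1 := by
          rw [coefA_mul, charA_eq_zero_of_mem_Rad, zero_mul, add_zero]
        change c β * coefA hadm β (a * x.1) = _ * (c β * coefA hadm β x.1)
        rw [this, mul_left_comm]
      · simp)

open Classical in
theorem charTop_radHom (c : QuiverArrow V → k) (i : V) (x : Rad I) :
    charTop hadm i (radHom hadm c x) =
      ∑ β, if β.tgt = i then c β * coefA hadm β x.1 else 0 := by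
  rw [radHom, charTop_topHom, AddMonoidHom.finsetSum_apply]
  refine Finset.sum_congr rfl fun β _ => ?_
  split_ifs <;> rfl

theorem charTop_radHom_radArr (c : QuiverArrow V → k) (β : QuiverArrow V) :
    charTop hadm β.tgt (radHom hadm c (radArr hadm β)) = c β := by
  classical
  rw [charTop_radHom, Finset.sum_eq_single β]
  · rw [if_pos rfl]
    refine (congrArg (c β * ·) (coefA_arrA hadm β β)).trans ?_
    rw [if_pos rfl, mul_one]
  · intro γ _ hγ
    have : coefA hadm γ (radArr hadm β).1 = 0 := (coefA_arrA hadm β γ).trans (if_neg hγ)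
    rw [this, mul_zero, ite_self]
  · simp

theorem radHom_eq (f : Rad I →ₗ[BoundQuiverAlgebra I] Top I) :
    radHom hadm (fun β => charTop hadm β.tgt (f (radArr hadm β))) = f := by
  refine rad_hom_ext hadm fun β => charTop_ext hadm fun i => ?_
  by_cases h : β.tgt = i
  · subst h; exact charTop_radHom_radArr hadm _ β
  · classical
    rw [← idemA_smul_radArr, LinearMap.map_smul, LinearMap.map_smul, charTop_smul, charTop_smul,
      charA_idemA, if_neg h, zero_mul, zero_mul]

theorem radHom_add (c d : QuiverArrow V → k) :
    radHom hadm (c + d) = radHom hadm c + radHom hadm d := by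
  classical
  refine LinearMap.ext fun x => charTop_ext hadm fun i => ?_
  rw [LinearMap.add_apply, map_add, charTop_radHom, charTop_radHom, charTop_radHom,
    ← Finset.sum_add_distrib]
  refine Finset.sum_congr rfl fun β _ => ?_
  split_ifs
  · rw [Pi.add_apply, add_mul]
  · exact (add_zero 0).symm

theorem radHom_smul (r : k) (c : QuiverArrow V → k) (x : Rad I) :
    radHom hadm (r • c) x = algebraMap k (BoundQuiverAlgebra I) r • radHom hadm c x := by
  classical
  refine charTop_ext hadm fun i => ?_
  rw [charTop_smul, AlgHom.commutes, charTop_radHom, charTop_radHom, Finset.mul_sum]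
  refine Finset.sum_congr rfl fun β _ => ?_
  rw [Pi.smul_apply, smul_eq_mul, mul_assoc, mul_ite, mul_zero]
  rfl

/-- The class in `Ext¹ (L, L)` with prescribed coefficients on the arrows: the image of `radHom`
under the connecting map of `0 → rad A → A → A / rad A → 0`. -/
def extOne : (QuiverArrow V → k) →ₗ[k] ExtL I 1 where
  toFun c := (shortExact_rad I).extClass.comp
    (Ext.mk₀ (ModuleCat.ofHom (radHom hadm c) : ModuleCat.of _ (Rad I) ⟶ L I)) (add_zero 1)
  map_add' c d := by
    rw [radHom_add, ModuleCat.ofHom_add, Ext.mk₀_add, Ext.comp_add]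
  map_smul' r c := by
    exact comp_mk₀_eq_smul r _ _ (radHom_smul hadm r c) _

theorem extOne_apply (c : QuiverArrow V → k) :
    extOne hadm c = (shortExact_rad I).extClass.comp
      (Ext.mk₀ (ModuleCat.ofHom (radHom hadm c) : ModuleCat.of _ (Rad I) ⟶ L I)) (add_zero 1) :=
  rfl

/-- The connecting map is surjective since `A` is projective, and injective since all maps from `A`
to `A / rad A` vanish on the radical. -/
theorem extOne_bijective : Function.Bijective (extOne hadm) := by
  constructor
  · rw [← LinearMap.ker_eq_bot, LinearMap.ker_eq_bot']
    intro c hc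
    have h := eq_zero_of_extClass_comp_mk₀ (shortExact_rad I)
      (fun g => ModuleCat.hom_ext (LinearMap.ext fun x => apply_rad_eq_zero hadm g.hom x)) hc
    funext β
    rw [← charTop_radHom_radArr hadm c β]
    have h' : radHom hadm c = 0 := congrArg ModuleCat.Hom.hom h
    rw [h', LinearMap.zero_apply, map_zero, Pi.zero_apply]
  · intro x
    obtain ⟨f, hf⟩ := exists_extClass_comp_mk₀ (shortExact_rad I) x
    refine ⟨fun β => charTop hadm β.tgt (f.hom (radArr hadm β)), ?_⟩
    rw [extOne_apply, radHom_eq]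
    exact hf

/-- The basis of `Ext¹ (L, L)` indexed by the arrows. -/
def extOneBasis : Module.Basis (QuiverArrow V) k (ExtL I 1) :=
  Module.Basis.ofEquivFun (LinearEquiv.ofBijective (extOne hadm) (extOne_bijective hadm)).symm

open Classical in
theorem extOneBasis_apply (β : QuiverArrow V) :
    extOneBasis hadm β = extOne hadm (Pi.single β 1) := by
  rw [extOneBasis, Module.Basis.coe_ofEquivFun]
  rfl

theorem coord_extOne (c : QuiverArrow V → k) (β : QuiverArrow V) :
    (extOneBasis hadm).coord β (extOne hadm c) = c β := by
  have h : (LinearEquiv.ofBijective (extOne hadm) (extOne_bijective hadm)).symm (extOne hadm c) =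
      c := (LinearEquiv.ofBijective (extOne hadm) (extOne_bijective hadm)).symm_apply_apply c
  refine Eq.trans ?_ (congrFun h β)
  rfl

open Classical in
/-- The map from the module of relations to `A / rad A` defined by a matrix of coefficients on
pairs of arrows: it sends `z` to the sum of the `T α β c_α (z β) e_(t α)`, where `c_α` is the
coefficient of `α`. -/
def relHom (T : QuiverArrow V → QuiverArrow V → k) :
    Relations hadm →ₗ[BoundQuiverAlgebra I] Top I :=
  topHom hadm (fun i => AddMonoidHom.mk' (fun z : Relations hadm => ∑ α, if α.tgt = i then
      ∑ β, T α β * coefA hadm α (z.1.1 β) else 0) (fun z z' => by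
        rw [← Finset.sum_add_distrib]
        refine Finset.sum_congr rfl fun α _ => ?_
        split_ifs
        · rw [← Finset.sum_add_distrib]
          refine Finset.sum_congr rfl fun β _ => ?_
          rw [← mul_add, ← map_add]
          rfl
        · exact (add_zero 0).symm))
    (fun i a z => by
      simp only [AddMonoidHom.mk'_apply, Finset.mul_sum]
      refine Finset.sum_congr rfl fun α _ => ?_
      split_ifs with h
      · subst h
        rw [Finset.mul_sum]
        refine Finset.sum_congr rfl fun β _ => ?_
        have : coefA hadm α (a * z.1.1 β) = charA hadm α.tgt a * coefA hadm α (z.1.1 β) := by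
          rw [coefA_mul, charA_relation, zero_mul, add_zero]
        change T α β * coefA hadm α (a * z.1.1 β) = _
        rw [this, mul_left_comm]
      · exact (mul_zero _).symm)

open Classical in
theorem charTop_relHom (T : QuiverArrow V → QuiverArrow V → k) (i : V) (z : Relations hadm) :
    charTop hadm i (relHom hadm T z) =
      ∑ α, if α.tgt = i then ∑ β, T α β * coefA hadm α (z.1.1 β) else 0 := by
  rw [relHom, charTop_topHom]
  rfl

/-- The class in `Ext² (L, L)` with prescribed coefficients on the pairs of arrows: the image of
`relHom` under the connecting maps of `0 → Relations → ⨁ A e_(t β) → rad A → 0` and of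
`0 → rad A → A → A / rad A → 0`. -/
def extTwo (T : QuiverArrow V → QuiverArrow V → k) : ExtL I 2 :=
  (shortExact_rad I).extClass.comp ((shortExact_relations hadm).extClass.comp
    (Ext.mk₀ (ModuleCat.ofHom (relHom hadm T) : ModuleCat.of _ (Relations hadm) ⟶ L I))
    (add_zero 1)) rfl

theorem relHom_add (T T' : QuiverArrow V → QuiverArrow V → k) :
    relHom hadm (T + T') = relHom hadm T + relHom hadm T' := by
  classical
  refine LinearMap.ext fun z => charTop_ext hadm fun i => ?_
  rw [LinearMap.add_apply, map_add, charTop_relHom, charTop_relHom, charTop_relHom,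
    ← Finset.sum_add_distrib]
  refine Finset.sum_congr rfl fun α _ => ?_
  split_ifs
  · simp only [Pi.add_apply, add_mul, Finset.sum_add_distrib]
  · exact (add_zero 0).symm

theorem extTwo_add (T T' : QuiverArrow V → QuiverArrow V → k) :
    extTwo hadm (T + T') = extTwo hadm T + extTwo hadm T' := by
  rw [extTwo, relHom_add, ModuleCat.ofHom_add, Ext.mk₀_add, Ext.comp_add, Ext.comp_add]
  rfl

/-- The connecting maps that define `extTwo` are injective, by minimality of the covers. -/
theorem extTwo_eq_zero_iff (T : QuiverArrow V → QuiverArrow V → k) :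
    extTwo hadm T = 0 ↔ relHom hadm T = 0 := by
  constructor
  · intro h
    have h1 := eq_zero_of_extClass_comp (shortExact_rad I) h
    have h2 := eq_zero_of_extClass_comp_mk₀ (shortExact_relations hadm)
      (fun g => ModuleCat.hom_ext (LinearMap.ext fun x => apply_relation_eq_zero hadm g.hom x)) h1
    exact congrArg ModuleCat.Hom.hom h2
  · intro h
    rw [extTwo, h, ModuleCat.ofHom_zero, Ext.mk₀_zero, Ext.comp_zero, Ext.comp_zero]

/-- The lift `⨁ A e_(t β) → A` of the composite of `⨁ A e_(t β) → rad A` with the map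
`rad A → A / rad A` given by a family of coefficients. -/
def coverLift (d : QuiverArrow V → k) :
    ArrowCover I →ₗ[BoundQuiverAlgebra I] BoundQuiverAlgebra I :=
  coverDesc fun β => d β • 1

theorem coverLift_apply (d : QuiverArrow V → k) (z : ArrowCover I) :
    coverLift d z = ∑ β, d β • z.1 β := by
  rw [coverLift, coverDesc_apply]
  simp

theorem toTop_coverLift (d : QuiverArrow V → k) (z : ArrowCover I) :
    toTop I (coverLift d z) = radHom hadm d (coverToRad hadm z) := by
  classical
  refine charTop_ext hadm fun i => ?_
  rw [charTop_toTop, coverLift_apply, charTop_radHom, map_sum]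
  refine Finset.sum_congr rfl fun β _ => ?_
  rw [map_smul, coefA_coverToRad, charA_apply_eq_ite, smul_eq_mul, mul_ite, mul_zero]

/-- The restriction of `coverLift` to the relations, with values in the radical. -/
def relLift (d : QuiverArrow V → k) : Relations hadm →ₗ[BoundQuiverAlgebra I] Rad I :=
  LinearMap.codRestrict _ (coverLift d ∘ₗ (Relations hadm).subtype) fun z => by
    refine LinearMap.mem_ker.2 ((toTop_coverLift hadm d z.1).trans ?_)
    rw [LinearMap.mem_ker.1 z.2, map_zero]

theorem radHom_relLift (c d : QuiverArrow V → k) (z : Relations hadm) :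
    radHom hadm c (relLift hadm d z) = relHom hadm (fun α β => c α * d β) z := by
  classical
  refine charTop_ext hadm fun i => ?_
  rw [charTop_radHom, charTop_relHom]
  refine Finset.sum_congr rfl fun α _ => ?_
  have h : (relLift hadm d z).1 = ∑ β, d β • z.1.1 β := coverLift_apply d z.1
  rw [h, map_sum, Finset.mul_sum]
  refine if_congr Iff.rfl (Finset.sum_congr rfl fun β _ => ?_) rfl
  rw [map_smul, smul_eq_mul, mul_assoc]

/-- The Yoneda product on `Ext¹ (L, L)` in terms of coefficients. It is computed by lifting the
map `radHom d` to a map from the presentation of `rad A` to that of `A / rad A`. -/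
theorem yoneda_extOne (c d : QuiverArrow V → k) :
    yoneda I 1 1 2 rfl (extOne hadm c) (extOne hadm d) =
      extTwo hadm (fun α β => c α * d β) := by
  have h1 : yoneda I 1 1 2 rfl (extOne hadm c) (extOne hadm d) =
      (extOne hadm d).comp (extOne hadm c) rfl := rfl
  let φ : (coverToRad hadm).shortComplexKer ⟶ (toTop I).shortComplexKer :=
    { τ₁ := ModuleCat.ofHom (relLift hadm d)
      τ₂ := ModuleCat.ofHom (coverLift d)
      τ₃ := ModuleCat.ofHom (radHom hadm d)
      comm₁₂ := rfl
      comm₂₃ := ModuleCat.hom_ext (LinearMap.ext fun z => toTop_coverLift hadm d z) }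
  have h2 := ShortComplex.ShortExact.extClass_naturality (shortExact_relations hadm)
    (shortExact_rad I) φ
  have h3 : ModuleCat.ofHom (relHom hadm fun α β => c α * d β) =
      ModuleCat.ofHom (relLift hadm d) ≫ ModuleCat.ofHom (radHom hadm c) :=
    ModuleCat.hom_ext (LinearMap.ext fun z => (radHom_relLift hadm c d z).symm)
  rw [h1, extOne_apply, extOne_apply, extTwo, h3, ← Ext.mk₀_comp_mk₀,
    Ext.comp_assoc _ _ _ (add_zero 1) (zero_add 1) rfl,
    ← Ext.comp_assoc _ _ _ (zero_add 1) (add_zero 1) rfl]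
  refine congrArg (fun y => (shortExact_rad I).extClass.comp y rfl) ?_
  refine (congrArg (fun y => Ext.comp y _ (add_zero 1)) h2.symm).trans ?_
  exact Ext.comp_assoc _ _ _ (add_zero 1) (add_zero 0) rfl

end Ext

/-! ### The kernel of the Yoneda product and the quadratic relations -/

/-- The coefficients of an element of `kQ` on the paths `α β` of length two; they vanish if `α` and
`β` are not composable. -/
def twoCoef : PathAlgebra k V →ₗ[k] QuiverArrow V → QuiverArrow V → k :=
  LinearMap.pi fun α => LinearMap.pi fun β =>
    (char α.tgt).toLinearMap ∘ₗ PathAlgebra.deriv α ∘ₗ PathAlgebra.deriv β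

theorem twoCoef_apply (x : PathAlgebra k V) (α β : QuiverArrow V) :
    twoCoef x α β = char α.tgt (PathAlgebra.deriv α (PathAlgebra.deriv β x)) := rfl

open Classical in
theorem twoCoef_idem_mul (i : V) (x : PathAlgebra k V) (α β : QuiverArrow V) :
    twoCoef (idem k i * x) α β = if α.tgt = i then twoCoef x α β else 0 := by
  rw [twoCoef_apply, PathAlgebra.deriv_mul, deriv_idem, smul_zero, add_zero,
    PathAlgebra.deriv_mul, deriv_idem, smul_zero, add_zero, map_mul, char_idem, ite_mul, one_mul,
    zero_mul, twoCoef_apply]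
  exact if_congr eq_comm rfl rfl

theorem twoCoef_proj (x : PathAlgebra k V) : twoCoef (proj 2 x) = twoCoef x := by
  funext α β
  have h : PathAlgebra.deriv α (PathAlgebra.deriv β (proj 2 x)) =
      proj 0 (PathAlgebra.deriv α (PathAlgebra.deriv β x)) := by
    rw [proj_deriv, proj_deriv]; rfl
  rw [twoCoef_apply, h, proj_zero, map_sum, Finset.sum_eq_single α.tgt]
  · rw [map_smul, char_idem, if_pos rfl, smul_eq_mul, mul_one, twoCoef_apply]
  · intro i _ hi
    rw [map_smul, char_idem, if_neg hi, smul_zero]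
  · simp

section

variable [∀ a b : V, Finite (a ⟶ b)]

theorem sum_twoCoef {x : PathAlgebra k V} (hx : proj 2 x = x) :
    ∑ α, ∑ β, twoCoef x α β • (arr k α * arr k β) = x := by
  have h1 : ∑ β, PathAlgebra.deriv β x * arr k β = x := by
    conv_rhs => rw [← sum_char_add_sum_deriv x]
    simp only [char_eq_zero_of_proj two_ne_zero hx, zero_smul, Finset.sum_const_zero, zero_add]
  have h2 : ∀ β, ∑ α, twoCoef x α β • arr k α = PathAlgebra.deriv β x := by
    intro β
    have hd : proj 1 (PathAlgebra.deriv β x) = PathAlgebra.deriv β x := by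
      rw [proj_deriv]; exact congrArg _ hx
    have hd' : ∀ α, PathAlgebra.deriv α (PathAlgebra.deriv β x) =
        ∑ i, char i (PathAlgebra.deriv α (PathAlgebra.deriv β x)) • idem k i := by
      intro α
      rw [← proj_zero, proj_deriv]
      exact congrArg _ hd.symm
    conv_rhs => rw [← sum_char_add_sum_deriv (PathAlgebra.deriv β x)]
    simp only [char_eq_zero_of_proj one_ne_zero hd, zero_smul, Finset.sum_const_zero, zero_add]
    refine Finset.sum_congr rfl fun α _ => ?_
    rw [hd' α, Finset.sum_mul, Finset.sum_eq_single α.tgt]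
    · rw [smul_mul_assoc, idem_tgt_mul_arr, twoCoef_apply]
    · intro i _ hi
      rw [smul_mul_assoc, ← idem_tgt_mul_arr α, ← mul_assoc, idem_mul_idem, if_neg hi, zero_mul,
        smul_zero]
    · simp
  conv_rhs => rw [← h1]
  rw [Finset.sum_comm]
  refine Finset.sum_congr rfl fun β _ => ?_
  rw [← h2 β, Finset.sum_mul]
  exact Finset.sum_congr rfl fun α _ => (smul_mul_assoc _ _ _).symm

/-- The quadratic part of an element of a quadratic ideal is a relation in `A`. -/
theorem sum_twoCoef_eq_zero (hquad : IsQuadratic I) {x : PathAlgebra k V} (hx : x ∈ I) :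
    ∑ α, ∑ β, twoCoef x α β • (arrA I α * arrA I β) = 0 := by
  have h := congrArg (mk I) (sum_twoCoef (x := proj 2 x) (by rw [proj_proj, if_pos rfl]))
  rw [(mk_eq_zero_iff I).2 (proj_mem hquad hx 2), twoCoef_proj, map_sum] at h
  refine Eq.trans (Finset.sum_congr rfl fun α _ => ?_) h
  rw [map_sum]
  refine Finset.sum_congr rfl fun β _ => ?_
  rw [map_smul, map_mul]
  rfl

variable (hadm : IsAdmissible I)

/-- A matrix of coefficients defines the zero map on relations precisely if it annihilates the
coefficients of all elements of the ideal. -/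
theorem relHom_eq_zero_iff (T : QuiverArrow V → QuiverArrow V → k) :
    relHom hadm T = 0 ↔ ∀ x ∈ I, ∑ α, ∑ β, T α β * twoCoef x α β = 0 := by
  classical
  have key : ∀ x hx i, charTop hadm i (relHom hadm T (relOf hadm x hx)) =
      ∑ α, if α.tgt = i then ∑ β, T α β * twoCoef x α β else 0 := by
    intro x hx i
    rw [charTop_relHom]
    refine Finset.sum_congr rfl fun α _ => if_congr Iff.rfl
      (Finset.sum_congr rfl fun β _ => congrArg (T α β * ·) ?_) rfl
    exact coefA_mk hadm α _
  constructor
  · intro h x hx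
    have h' := fun i => key x hx i
    simp only [h, LinearMap.zero_apply, map_zero] at h'
    have h2 := Finset.sum_congr (s₁ := (Finset.univ : Finset V)) rfl fun i _ => h' i
    rw [Finset.sum_const_zero, Finset.sum_comm] at h2
    simpa using h2.symm
  · intro h
    refine LinearMap.ext fun z => charTop_ext hadm fun i => ?_
    obtain ⟨x, hx, rfl⟩ := relOf_surjective hadm z
    rw [key, LinearMap.zero_apply, map_zero]
    refine Eq.trans (Finset.sum_congr rfl fun α _ => ?_)
      (h (idem k i * x) (I.mul_mem_left _ _ hx))
    simp only [twoCoef_idem_mul]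
    split_ifs <;> simp

/-- Coordinates on `Ext¹ ⊗ Ext¹` with respect to the basis of `Ext¹` given by the arrows. -/
def tensorCoord (u : ExtL I 1 ⊗[k] ExtL I 1) (α β : QuiverArrow V) : k :=
  TensorProduct.dualDistrib k _ _
    ((extOneBasis hadm).coord α ⊗ₜ[k] (extOneBasis hadm).coord β) u

theorem lift_yoneda (u : ExtL I 1 ⊗[k] ExtL I 1) :
    TensorProduct.lift (yoneda I 1 1 2 rfl) u = extTwo hadm (tensorCoord hadm u) := by
  induction u with
  | zero =>
    rw [map_zero]
    refine ((extTwo_eq_zero_iff hadm _).2 ((relHom_eq_zero_iff hadm _).2 fun x _ => ?_)).symm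
    simp [tensorCoord]
  | tmul x y =>
    obtain ⟨c, rfl⟩ := (extOne_bijective hadm).2 x
    obtain ⟨d, rfl⟩ := (extOne_bijective hadm).2 y
    rw [TensorProduct.lift.tmul, yoneda_extOne]
    congr 1
    funext α β
    rw [tensorCoord, TensorProduct.dualDistrib_apply, coord_extOne, coord_extOne]
  | add x y hx hy =>
    rw [map_add, hx, hy, ← extTwo_add]
    congr 1
    funext α β
    exact (map_add _ x y).symm

theorem dualDistrib_eq_sum (t : DExt₁ I ⊗[k] DExt₁ I) (u : ExtL I 1 ⊗[k] ExtL I 1) :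
    TensorProduct.dualDistrib k _ _ t u = ∑ α, ∑ β, tensorCoord hadm u α β *
      TensorProduct.dualDistrib k _ _ t (extOneBasis hadm α ⊗ₜ extOneBasis hadm β) := by
  induction u with
  | zero => simp [tensorCoord]
  | tmul x y =>
    conv_lhs => rw [← (extOneBasis hadm).sum_repr x, ← (extOneBasis hadm).sum_repr y,
      TensorProduct.sum_tmul, map_sum]
    refine Finset.sum_congr rfl fun α _ => ?_
    rw [TensorProduct.tmul_sum, map_sum]
    refine Finset.sum_congr rfl fun β _ => ?_
    rw [TensorProduct.smul_tmul_smul, map_smul, tensorCoord, TensorProduct.dualDistrib_apply]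
    rfl
  | add x y hx hy =>
    have h : ∀ α β, tensorCoord hadm (x + y) α β =
        tensorCoord hadm x α β + tensorCoord hadm y α β := fun α β => map_add _ x y
    simp only [map_add, hx, hy, h, add_mul, Finset.sum_add_distrib]

theorem inImageDualYoneda_iff (t : DExt₁ I ⊗[k] DExt₁ I) :
    InImageDualYoneda I t ↔ ∀ u, relHom hadm (tensorCoord hadm u) = 0 →
      TensorProduct.dualDistrib k _ _ t u = 0 := by
  have h := LinearMap.range_dualMap_eq_dualAnnihilator_ker
    (TensorProduct.lift (yoneda I 1 1 2 rfl))
  have h1 : InImageDualYoneda I t ↔ TensorProduct.dualDistrib k _ _ t ∈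
      LinearMap.range (TensorProduct.lift (yoneda I 1 1 2 rfl)).dualMap := by
    constructor
    · rintro ⟨φ, hφ⟩; exact ⟨φ, hφ.symm⟩
    · rintro ⟨φ, hφ⟩; exact ⟨φ, hφ.symm⟩
  rw [h1, h, Submodule.mem_dualAnnihilator]
  refine forall_congr' fun u => ?_
  rw [LinearMap.mem_ker, lift_yoneda hadm, extTwo_eq_zero_iff]

theorem tensorCoord_sum (T : QuiverArrow V → QuiverArrow V → k) :
    tensorCoord hadm (∑ α, ∑ β, T α β • (extOneBasis hadm α ⊗ₜ[k] extOneBasis hadm β)) = T := by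
  classical
  funext α β
  rw [tensorCoord, map_sum, Finset.sum_eq_single α, map_sum, Finset.sum_eq_single β]
  · simp [TensorProduct.dualDistrib_apply]
  · intro β' _ h
    simp [TensorProduct.dualDistrib_apply, h]
  · simp
  · intro α' _ h
    rw [map_sum]
    refine Finset.sum_eq_zero fun β' _ => ?_
    simp [TensorProduct.dualDistrib_apply, h]
  · simp

/-- The coefficients of an element of the image of the dual of the Yoneda product are those of an
element of the ideal: otherwise some functional separates them from the coefficients of the ideal,
and this functional is a tensor killed by the Yoneda product. -/
theorem exists_twoCoef_of_inImageDualYoneda {t : DExt₁ I ⊗[k] DExt₁ I}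
    (ht : InImageDualYoneda I t) : ∃ x ∈ I, ∀ α β, twoCoef x α β =
      TensorProduct.dualDistrib k _ _ t (extOneBasis hadm α ⊗ₜ extOneBasis hadm β) := by
  classical
  set M : QuiverArrow V → QuiverArrow V → k := fun α β =>
    TensorProduct.dualDistrib k _ _ t (extOneBasis hadm α ⊗ₜ extOneBasis hadm β) with hM
  let W : Submodule k (QuiverArrow V → QuiverArrow V → k) :=
    { carrier := {N | ∃ x ∈ I, twoCoef x = N}
      zero_mem' := ⟨0, I.zero_mem, map_zero _⟩
      add_mem' := by
        rintro _ _ ⟨x, hx, rfl⟩ ⟨y, hy, rfl⟩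
        exact ⟨x + y, I.add_mem hx hy, map_add _ _ _⟩
      smul_mem' := by
        rintro c _ ⟨x, hx, rfl⟩
        refine ⟨c • x, ?_, map_smul _ _ _⟩
        rw [Algebra.smul_def]
        exact I.mul_mem_left _ _ hx }
  by_contra hcon
  have hMW : M ∉ W := by
    rintro ⟨x, hx, hxM⟩
    exact hcon ⟨x, hx, fun α β => congrFun (congrFun hxM α) β⟩
  -- a functional separating `M` from the coefficients of the ideal is a class killed by `m₂`
  obtain ⟨f, hfM, hfW⟩ := Submodule.exists_le_ker_of_notMem hMW
  set T : QuiverArrow V → QuiverArrow V → k := fun α β => f (Pi.single α (Pi.single β 1)) with hT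
  have hf : ∀ N, f N = ∑ α, ∑ β, T α β * N α β := by
    intro N
    have hN : N = ∑ α, ∑ β, N α β • Pi.single α (Pi.single β (1 : k)) := by
      funext α β
      rw [Finset.sum_apply, Finset.sum_apply, Finset.sum_eq_single α]
      · rw [Finset.sum_apply, Finset.sum_apply, Finset.sum_eq_single β]
        · simp
        · intro b _ hb; simp [hb.symm]
        · simp
      · intro b _ hb
        rw [Finset.sum_apply, Finset.sum_apply]
        refine Finset.sum_eq_zero fun c _ => ?_
        simp [hb.symm]
      · simp
    conv_lhs => rw [hN, map_sum]
    refine Finset.sum_congr rfl fun α _ => ?_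
    rw [map_sum]
    refine Finset.sum_congr rfl fun β _ => ?_
    rw [map_smul, smul_eq_mul, mul_comm]
  apply hfM
  have hT0 : relHom hadm T = 0 := (relHom_eq_zero_iff hadm T).2 fun x hx => by
    rw [← hf]; exact hfW ⟨x, hx, rfl⟩
  have := (inImageDualYoneda_iff hadm t).1 ht
    (∑ α, ∑ β, T α β • (extOneBasis hadm α ⊗ₜ[k] extOneBasis hadm β))
    (by rw [tensorCoord_sum]; exact hT0)
  rw [dualDistrib_eq_sum hadm, tensorCoord_sum] at this
  rw [hf]
  exact this

/-- The coefficients of an element of the ideal define an element of the image of the dual of the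
Yoneda product. -/
theorem inImageDualYoneda_twoCoef {x : PathAlgebra k V} (hx : x ∈ I) :
    InImageDualYoneda I (∑ α, ∑ β, twoCoef x α β •
      ((extOneBasis hadm).coord α ⊗ₜ[k] (extOneBasis hadm).coord β)) := by
  rw [inImageDualYoneda_iff hadm]
  intro u hu
  rw [← (relHom_eq_zero_iff hadm _).1 hu x hx, map_sum, LinearMap.sum_apply]
  refine Finset.sum_congr rfl fun α _ => ?_
  rw [map_sum, LinearMap.sum_apply]
  refine Finset.sum_congr rfl fun β _ => ?_
  rw [map_smul, LinearMap.smul_apply, smul_eq_mul, mul_comm]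
  rfl

/-! ### The bimodule structure of the dual of `Ext¹` -/

open Abelian

/-- The action of `A / rad A` on the target of an extension, through the targets of the arrows. -/
theorem yoneda_rightMul_extOne (a : Top I) (c : QuiverArrow V → k) :
    yoneda I 0 1 1 rfl (Ext.mk₀ (rightMul I a)) (extOne hadm c) =
      extOne hadm fun β => charTop hadm β.tgt a * c β := by
  classical
  have h1 : yoneda I 0 1 1 rfl (Ext.mk₀ (rightMul I a)) (extOne hadm c) =
      (extOne hadm c).comp (Ext.mk₀ (rightMul I a)) (add_zero 1) := rfl
  rw [h1, extOne_apply, extOne_apply, Ext.comp_assoc _ _ _ (add_zero 1) (add_zero 0) (add_zero 1),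
    Ext.mk₀_comp_mk₀]
  congr 2
  refine ModuleCat.hom_ext (LinearMap.ext fun x => charTop_ext hadm fun i => ?_)
  have h2 : charTop hadm i (radHom hadm c x * a) =
      charTop hadm i (radHom hadm (fun β => charTop hadm β.tgt a * c β) x) := by
    rw [map_mul, charTop_radHom, charTop_radHom, Finset.sum_mul]
    refine Finset.sum_congr rfl fun β _ => ?_
    split_ifs with h
    · subst h; ring
    · exact zero_mul _
  exact h2

/-- The action of `A / rad A` on the source of an extension, through the sources of the arrows: the
right multiplication by an element of `A` is an endomorphism of `0 → rad A → A → A / rad A → 0`,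
which multiplies the coefficient of an arrow by the character at its source. -/
theorem yoneda_extOne_rightMul (a : Top I) (c : QuiverArrow V → k) :
    yoneda I 1 0 1 rfl (extOne hadm c) (Ext.mk₀ (rightMul I a)) =
      extOne hadm fun β => charTop hadm β.src a * c β := by
  classical
  obtain ⟨b, rfl⟩ := toTop_surjective a
  have h1 : yoneda I 1 0 1 rfl (extOne hadm c) (Ext.mk₀ (rightMul I (toTop I b))) =
      (Ext.mk₀ (rightMul I (toTop I b))).comp (extOne hadm c) (zero_add 1) := rfl
  let r : BoundQuiverAlgebra I →ₗ[BoundQuiverAlgebra I] BoundQuiverAlgebra I :=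
    LinearMap.toSpanSingleton _ _ b
  let r' : Rad I →ₗ[BoundQuiverAlgebra I] Rad I :=
    LinearMap.codRestrict _ (r ∘ₗ (Rad I).subtype) fun x => by
      refine LinearMap.mem_ker.2 ?_
      change toTop I (x.1 * b) = 0
      rw [toTop_mul, LinearMap.mem_ker.1 x.2, zero_mul]
  let φ : (toTop I).shortComplexKer ⟶ (toTop I).shortComplexKer :=
    { τ₁ := ModuleCat.ofHom r'
      τ₂ := ModuleCat.ofHom r
      τ₃ := rightMul I (toTop I b)
      comm₁₂ := rfl
      comm₂₃ := ModuleCat.hom_ext (LinearMap.ext fun z => (toTop_mul z b).symm) }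
  have h2 := ShortComplex.ShortExact.extClass_naturality (shortExact_rad I)
    (shortExact_rad I) φ
  rw [h1, extOne_apply, extOne_apply,
    ← Ext.comp_assoc _ _ _ (zero_add 1) (add_zero 1) (zero_add 1)]
  refine (congrArg (fun y => Ext.comp y _ (add_zero 1)) h2.symm).trans ?_
  rw [Ext.comp_assoc _ _ _ (add_zero 1) (add_zero 0) (add_zero 1), Ext.mk₀_comp_mk₀]
  refine congrArg (fun f => (shortExact_rad I).extClass.comp (Ext.mk₀ f) (add_zero 1)) ?_
  refine ModuleCat.hom_ext (LinearMap.ext fun x => charTop_ext hadm fun i => ?_)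
  have h3 : charTop hadm i (radHom hadm c (r' x)) =
      charTop hadm i (radHom hadm (fun β => charTop hadm β.src (toTop I b) * c β) x) := by
    rw [charTop_radHom, charTop_radHom]
    refine Finset.sum_congr rfl fun β _ => if_congr Iff.rfl ?_ rfl
    have : coefA hadm β (r' x).1 = charA hadm β.src b * coefA hadm β x.1 := by
      change coefA hadm β (x.1 * b) = _
      rw [coefA_mul, charA_eq_zero_of_mem_Rad, zero_mul, zero_add]
    rw [this, charTop_toTop]
    ring
  exact h3

theorem leftAct_extOneBasis (a : Top I) (φ : DExt₁ I) (α : QuiverArrow V) :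
    leftAct I a φ (extOneBasis hadm α) = charTop hadm α.tgt a * φ (extOneBasis hadm α) := by
  classical
  have h : leftAct I a φ (extOneBasis hadm α) =
      φ (yoneda I 0 1 1 rfl (Ext.mk₀ (rightMul I a)) (extOneBasis hadm α)) := rfl
  have h' : (fun β => charTop hadm β.tgt a * Pi.single (M := fun _ => k) α 1 β) =
      charTop hadm α.tgt a • Pi.single α 1 := by
    funext β
    by_cases hβ : β = α
    · subst hβ; rfl
    · rw [Pi.smul_apply, Pi.single_eq_of_ne hβ, mul_zero, smul_zero]
  rw [h, extOneBasis_apply, yoneda_rightMul_extOne, h', (extOne hadm).map_smul, φ.map_smul, smul_eq_mul]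

theorem rightAct_extOneBasis (a : Top I) (φ : DExt₁ I) (α : QuiverArrow V) :
    rightAct I φ a (extOneBasis hadm α) = charTop hadm α.src a * φ (extOneBasis hadm α) := by
  classical
  have h : rightAct I φ a (extOneBasis hadm α) =
      φ (yoneda I 1 0 1 rfl (extOneBasis hadm α) (Ext.mk₀ (rightMul I a))) := rfl
  have h' : (fun β => charTop hadm β.src a * Pi.single (M := fun _ => k) α 1 β) =
      charTop hadm α.src a • Pi.single α 1 := by
    funext β
    by_cases hβ : β = α
    · subst hβ; rfl
    · rw [Pi.smul_apply, Pi.single_eq_of_ne hβ, mul_zero, smul_zero]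
  rw [h, extOneBasis_apply, yoneda_extOne_rightMul, h', (extOne hadm).map_smul, φ.map_smul, smul_eq_mul]

end

/-! ### The isomorphism with the reconstructed algebra -/

section Algebra

variable {B C M : Type*} [Semiring B] [Algebra k B] [Semiring C] [Algebra k C] [AddCommGroup M]
  [Module k M]

theorem map_sum_smul {ι : Type*} [Fintype ι] (f : B →ₗ[k] C) (c : ι → k) (x : ι → B) :
    f (∑ i, c i • x i) = ∑ i, c i • f (x i) := by
  rw [map_sum]
  exact Finset.sum_congr rfl fun i _ => map_smul f _ _

/-- The linear map `x ⊗ y ↦ m x * m y`. -/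
def mulTensor (m : M →ₗ[k] B) : M ⊗[k] M →ₗ[k] B :=
  TensorProduct.lift ((LinearMap.mul k B).compl₁₂ m m)

theorem mulTensor_tmul (m : M →ₗ[k] B) (x y : M) : mulTensor m (x ⊗ₜ y) = m x * m y := rfl

theorem map_mulTensor (f : B →ₐ[k] C) (m : M →ₗ[k] B) (t : M ⊗[k] M) :
    f (mulTensor m t) = mulTensor (f.toLinearMap ∘ₗ m) t := by
  induction t with
  | zero => simp
  | tmul x y => exact map_mul f _ _
  | add x y hx hy => rw [map_add, map_add, hx, hy, map_add]

theorem mulTensor_sum {ι : Type*} [Fintype ι] (m : M →ₗ[k] B) (c : ι → ι → k) (x : ι → M) :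
    mulTensor m (∑ i, ∑ j, c i j • (x i ⊗ₜ x j)) = ∑ i, ∑ j, c i j • (m (x i) * m (x j)) := by
  simp only [map_sum, map_smul, mulTensor_tmul]

theorem map_eq_sum_twoCoef [∀ a b : V, Finite (a ⟶ b)] (f : PathAlgebra k V →ₐ[k] B)
    {x : PathAlgebra k V} (hx : proj 2 x = x) :
    f x = ∑ α, ∑ β, twoCoef x α β • (f (arr k α) * f (arr k β)) := by
  conv_lhs => rw [← sum_twoCoef hx]
  simp only [map_sum, map_smul, map_mul]

end Algebra

theorem idemA_mul_arrA_of_ne {i : V} {α : QuiverArrow V} (h : i ≠ α.tgt) :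
    idemA I i * arrA I α = 0 := by
  classical
  rw [← idemA_tgt_mul_arrA, ← mul_assoc, idemA_mul_idemA, if_neg h, zero_mul]

theorem arrA_mul_idemA_of_ne {i : V} {α : QuiverArrow V} (h : i ≠ α.src) :
    arrA I α * idemA I i = 0 := by
  classical
  rw [← arrA_mul_idemA_src, mul_assoc, idemA_mul_idemA, if_neg h.symm, mul_zero]

/-- The projection of the free algebra onto `T_S (D Ext¹)` followed by the quotient map. -/
def reconMk : TensorAlgebra k (Top I × DExt₁ I) →ₐ[k] YonedaReconstruction I :=
  (RingQuot.mkAlgHom k (DualYonedaRel I)).comp (RingQuot.mkAlgHom k _)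

/-- The element of the reconstructed algebra given by an element of `A / rad A`. -/
def reconTop : Top I →ₗ[k] YonedaReconstruction I :=
  (reconMk (I := I)).toLinearMap ∘ₗ TensorAlgebra.ι k ∘ₗ LinearMap.inl k _ _

/-- The element of the reconstructed algebra given by an element of `D Ext¹`. -/
def reconDual : DExt₁ I →ₗ[k] YonedaReconstruction I :=
  (reconMk (I := I)).toLinearMap ∘ₗ TensorAlgebra.ι k ∘ₗ LinearMap.inr k _ _

theorem reconMk_eq {x y : TensorAlgebra k (Top I × DExt₁ I)}
    (h : TensorAlgebraOver.Rel (leftAct I) (rightAct I) x y) : reconMk x = reconMk y :=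
  congrArg (RingQuot.mkAlgHom k (DualYonedaRel I)) (RingQuot.mkAlgHom_rel k h)

theorem reconTop_one : reconTop (I := I) 1 = 1 :=
  (reconMk_eq TensorAlgebraOver.Rel.one).trans (map_one _)

theorem reconTop_mul (a b : Top I) : reconTop (a * b) = reconTop a * reconTop b :=
  (reconMk_eq (TensorAlgebraOver.Rel.mul a b)).symm.trans (map_mul _ _ _)

theorem reconDual_leftAct (a : Top I) (φ : DExt₁ I) :
    reconDual (leftAct I a φ) = reconTop a * reconDual φ :=
  (reconMk_eq (TensorAlgebraOver.Rel.left a φ)).symm.trans (map_mul _ _ _)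

theorem reconDual_rightAct (φ : DExt₁ I) (a : Top I) :
    reconDual (rightAct I φ a) = reconDual φ * reconTop a :=
  (reconMk_eq (TensorAlgebraOver.Rel.right φ a)).symm.trans (map_mul _ _ _)

theorem mulTensor_reconDual_eq_zero {t : DExt₁ I ⊗[k] DExt₁ I} (ht : InImageDualYoneda I t) :
    mulTensor (B := YonedaReconstruction I) reconDual t = 0 := by
  refine Eq.trans ?_ ((RingQuot.mkAlgHom_rel k (DualYonedaRel.mk t ht)).trans (map_zero _))
  exact (map_mulTensor (RingQuot.mkAlgHom k (DualYonedaRel I))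
    (TensorAlgebraOver.ι (leftAct I) (rightAct I)) t).symm

section

variable [∀ a b : V, Finite (a ⟶ b)] (hadm : IsAdmissible I)

theorem leftAct_toTop_idemA_coord (α : QuiverArrow V) :
    leftAct I (toTop I (idemA I α.tgt)) ((extOneBasis hadm).coord α) =
      (extOneBasis hadm).coord α := by
  classical
  refine (extOneBasis hadm).ext fun β => ?_
  rw [leftAct_extOneBasis hadm, charTop_toTop, charA_idemA, Module.Basis.coord_apply,
    Module.Basis.repr_self]
  by_cases h : β = α
  · subst h; rw [if_pos rfl, one_mul]
  · rw [Finsupp.single_eq_of_ne (Ne.symm h), mul_zero]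

theorem rightAct_coord_toTop_idemA (α : QuiverArrow V) :
    rightAct I ((extOneBasis hadm).coord α) (toTop I (idemA I α.src)) =
      (extOneBasis hadm).coord α := by
  classical
  refine (extOneBasis hadm).ext fun β => ?_
  rw [rightAct_extOneBasis hadm, charTop_toTop, charA_idemA, Module.Basis.coord_apply,
    Module.Basis.repr_self]
  by_cases h : β = α
  · subst h; rw [if_pos rfl, one_mul]
  · rw [Finsupp.single_eq_of_ne (Ne.symm h), mul_zero]

/-- The map from the path algebra to the reconstructed algebra, which sends each arrow to the
dual basis vector of the corresponding extension. -/
def pathToRecon : PathAlgebra k V →ₐ[k] YonedaReconstruction I :=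
  PathAlgebra.lift (e := fun i => reconTop (toTop I (idemA I i)))
    (a := fun α => reconDual ((extOneBasis hadm).coord α))
    (fun i => by classical rw [← reconTop_mul, ← toTop_mul, idemA_mul_idemA, if_pos rfl])
    (fun i j h => by
      classical rw [← reconTop_mul, ← toTop_mul, idemA_mul_idemA, if_neg h, map_zero, map_zero])
    (by rw [← map_sum, ← map_sum, sum_idemA]; exact reconTop_one)
    (fun α => by rw [← reconDual_leftAct, leftAct_toTop_idemA_coord])

theorem pathToRecon_idem (i : V) :
    pathToRecon hadm (idem k i) = reconTop (toTop I (idemA I i)) :=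
  lift_idem _ _ _ _ i

theorem pathToRecon_arr (α : QuiverArrow V) :
    pathToRecon hadm (arr k α) = reconDual ((extOneBasis hadm).coord α) :=
  lift_arr _ _ _ _ α (by rw [← reconDual_rightAct, rightAct_coord_toTop_idemA])

/-- The quadratic generators of `I` are sent to the image of the dual of the Yoneda product. -/
theorem pathToRecon_eq_zero (hquad : IsQuadratic I) {x : PathAlgebra k V} (hx : x ∈ I) :
    pathToRecon hadm x = 0 := by
  obtain ⟨S, hS, rfl⟩ := hquad
  have hle : TwoSidedIdeal.span S ≤ TwoSidedIdeal.ker (pathToRecon hadm) := by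
    refine TwoSidedIdeal.span_le.2 fun s hs => ?_
    refine (TwoSidedIdeal.mem_ker _).2 ?_
    have h := mulTensor_reconDual_eq_zero
      (inImageDualYoneda_twoCoef hadm (TwoSidedIdeal.subset_span hs))
    rw [mulTensor_sum] at h
    refine (map_eq_sum_twoCoef _ ((mem_lengthPart_iff 2 s).1 (hS hs))).trans (Eq.trans ?_ h)
    exact Finset.sum_congr rfl fun α _ => Finset.sum_congr rfl fun β _ => by
      rw [pathToRecon_arr, pathToRecon_arr]
  exact (TwoSidedIdeal.mem_ker _).1 (hle hx)

/-- The map from `A` to the reconstructed algebra. -/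
def toRecon (hquad : IsQuadratic I) : BoundQuiverAlgebra I →ₐ[k] YonedaReconstruction I :=
  Ideal.Quotient.liftₐ I.asIdeal (pathToRecon hadm) fun _ hx =>
    pathToRecon_eq_zero hadm hquad (TwoSidedIdeal.mem_asIdeal.1 hx)

/-- The linear map `A / rad A ⊕ D Ext¹ → A` which lifts the idempotents of `A / rad A` to the
trivial paths and sends the dual basis vectors to the arrows. -/
def genMap : Top I × DExt₁ I →ₗ[k] BoundQuiverAlgebra I :=
  LinearMap.coprod
    (∑ i, (charTop hadm i).toLinearMap.smulRight (idemA I i))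
    (∑ α, (Module.Dual.eval k (ExtL I 1) (extOneBasis hadm α)).smulRight (arrA I α))

theorem genMap_inl (s : Top I) : genMap hadm (s, 0) = ∑ i, charTop hadm i s • idemA I i := by
  rw [genMap, LinearMap.coprod_apply, map_zero, add_zero, LinearMap.sum_apply]
  rfl

theorem genMap_inr (φ : DExt₁ I) :
    genMap hadm (0, φ) = ∑ α, φ (extOneBasis hadm α) • arrA I α := by
  rw [genMap, LinearMap.coprod_apply, map_zero, zero_add, LinearMap.sum_apply]
  rfl

theorem genMap_inl_one : genMap hadm (1, 0) = 1 := by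
  rw [genMap_inl, ← sum_idemA]
  exact Finset.sum_congr rfl fun i _ => by rw [map_one, one_smul]

theorem genMap_inl_mul (a b : Top I) :
    genMap hadm (a, 0) * genMap hadm (b, 0) = genMap hadm (a * b, 0) := by
  classical
  rw [genMap_inl, genMap_inl, genMap_inl, Finset.sum_mul]
  refine Finset.sum_congr rfl fun i _ => ?_
  rw [Finset.mul_sum, Finset.sum_eq_single i]
  · rw [smul_mul_smul_comm, idemA_mul_idemA, if_pos rfl, map_mul]
  · intro j _ hj
    rw [smul_mul_smul_comm, idemA_mul_idemA, if_neg hj.symm, smul_zero]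
  · exact fun h => absurd (Finset.mem_univ _) h

theorem genMap_leftAct (a : Top I) (φ : DExt₁ I) :
    genMap hadm (a, 0) * genMap hadm (0, φ) = genMap hadm (0, leftAct I a φ) := by
  rw [genMap_inl, genMap_inr, genMap_inr, Finset.mul_sum]
  refine Finset.sum_congr rfl fun α _ => ?_
  rw [Finset.sum_mul, Finset.sum_eq_single α.tgt]
  · rw [smul_mul_smul_comm, idemA_tgt_mul_arrA, leftAct_extOneBasis hadm]
  · intro j _ hj
    rw [smul_mul_smul_comm, idemA_mul_arrA_of_ne hj, smul_zero]
  · exact fun h => absurd (Finset.mem_univ _) h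

theorem genMap_rightAct (φ : DExt₁ I) (a : Top I) :
    genMap hadm (0, φ) * genMap hadm (a, 0) = genMap hadm (0, rightAct I φ a) := by
  rw [genMap_inl, genMap_inr, genMap_inr, Finset.sum_mul]
  refine Finset.sum_congr rfl fun α _ => ?_
  rw [Finset.mul_sum, Finset.sum_eq_single α.src]
  · rw [smul_mul_smul_comm, arrA_mul_idemA_src, rightAct_extOneBasis hadm, mul_comm]
  · intro j _ hj
    rw [smul_mul_smul_comm, arrA_mul_idemA_of_ne hj, smul_zero]
  · exact fun h => absurd (Finset.mem_univ _) h

theorem lift_genMap_mul (p q : Top I × DExt₁ I) :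
    TensorAlgebra.lift k (genMap hadm) (TensorAlgebra.ι k p * TensorAlgebra.ι k q) =
      genMap hadm p * genMap hadm q :=
  (map_mul (TensorAlgebra.lift k (genMap hadm)) _ _).trans
    (congrArg₂ (· * ·) (TensorAlgebra.lift_ι_apply _ _) (TensorAlgebra.lift_ι_apply _ _))

theorem lift_genMap_rel {x y : TensorAlgebra k (Top I × DExt₁ I)}
    (h : TensorAlgebraOver.Rel (leftAct I) (rightAct I) x y) :
    TensorAlgebra.lift k (genMap hadm) x = TensorAlgebra.lift k (genMap hadm) y := by
  cases h with
  | one =>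
    exact ((TensorAlgebra.lift_ι_apply _ _).trans (genMap_inl_one hadm)).trans (map_one _).symm
  | mul a b =>
    exact ((lift_genMap_mul hadm _ _).trans (genMap_inl_mul hadm a b)).trans
      (TensorAlgebra.lift_ι_apply _ _).symm
  | left a φ =>
    exact ((lift_genMap_mul hadm _ _).trans (genMap_leftAct hadm a φ)).trans
      (TensorAlgebra.lift_ι_apply _ _).symm
  | right φ a =>
    exact ((lift_genMap_mul hadm _ _).trans (genMap_rightAct hadm φ a)).trans
      (TensorAlgebra.lift_ι_apply _ _).symm

/-- The map from the tensor algebra of `D Ext¹` to `A`. -/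
def ofTensor : TensorDExt₁ I →ₐ[k] BoundQuiverAlgebra I :=
  RingQuot.liftAlgHom k ⟨TensorAlgebra.lift k (genMap hadm), fun _ _ => lift_genMap_rel hadm⟩

theorem ofTensor_mk (x : TensorAlgebra k (Top I × DExt₁ I)) :
    ofTensor hadm (RingQuot.mkAlgHom k _ x) = TensorAlgebra.lift k (genMap hadm) x :=
  RingQuot.liftAlgHom_mkAlgHom_apply ..

theorem ofTensor_ι₂ (t : DExt₁ I ⊗[k] DExt₁ I) :
    ofTensor hadm (TensorAlgebraOver.ι₂ (leftAct I) (rightAct I) t) =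
      ∑ α, ∑ β, TensorProduct.dualDistrib k _ _ t (extOneBasis hadm α ⊗ₜ extOneBasis hadm β) •
        (arrA I α * arrA I β) := by
  induction t with
  | zero => simp
  | tmul φ ψ =>
    have h : ofTensor hadm (TensorAlgebraOver.ι₂ (leftAct I) (rightAct I) (φ ⊗ₜ ψ)) =
        genMap hadm (0, φ) * genMap hadm (0, ψ) := by
      refine (map_mul (ofTensor hadm) _ _).trans ?_
      refine congrArg₂ (· * ·) ?_ ?_
      · exact (ofTensor_mk hadm _).trans (TensorAlgebra.lift_ι_apply _ _)
      · exact (ofTensor_mk hadm _).trans (TensorAlgebra.lift_ι_apply _ _)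
    rw [h, genMap_inr, genMap_inr, Finset.sum_mul]
    refine Finset.sum_congr rfl fun α _ => ?_
    rw [Finset.mul_sum]
    refine Finset.sum_congr rfl fun β _ => ?_
    rw [smul_mul_smul_comm, TensorProduct.dualDistrib_apply]
  | add x y hx hy =>
    simp only [map_add, hx, hy, LinearMap.add_apply, add_smul, Finset.sum_add_distrib]

/-- The map from the reconstructed algebra to `A`. -/
def ofRecon (hquad : IsQuadratic I) : YonedaReconstruction I →ₐ[k] BoundQuiverAlgebra I :=
  RingQuot.liftAlgHom k ⟨ofTensor hadm, fun x y h => by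
    obtain ⟨t, ht⟩ := h
    obtain ⟨x, hx, hxt⟩ := exists_twoCoef_of_inImageDualYoneda hadm ht
    rw [map_zero, ofTensor_ι₂, ← sum_twoCoef_eq_zero hquad hx]
    exact Finset.sum_congr rfl fun α _ => Finset.sum_congr rfl fun β _ => by rw [hxt]⟩

theorem ofRecon_reconMk (hquad : IsQuadratic I) (x : TensorAlgebra k (Top I × DExt₁ I)) :
    ofRecon hadm hquad (reconMk x) = TensorAlgebra.lift k (genMap hadm) x :=
  (RingQuot.liftAlgHom_mkAlgHom_apply ..).trans (ofTensor_mk hadm x)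

theorem ofRecon_reconTop (hquad : IsQuadratic I) (s : Top I) :
    ofRecon hadm hquad (reconTop s) = ∑ i, charTop hadm i s • idemA I i :=
  ((ofRecon_reconMk hadm hquad _).trans (TensorAlgebra.lift_ι_apply _ _)).trans (genMap_inl hadm s)

theorem ofRecon_reconDual (hquad : IsQuadratic I) (φ : DExt₁ I) :
    ofRecon hadm hquad (reconDual φ) = ∑ α, φ (extOneBasis hadm α) • arrA I α :=
  ((ofRecon_reconMk hadm hquad _).trans (TensorAlgebra.lift_ι_apply _ _)).trans (genMap_inr hadm φ)

theorem sum_charTop_smul_idemA (s : Top I) :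
    ∑ i, charTop hadm i s • toTop I (idemA I i) = s := by
  classical
  refine charTop_ext hadm fun j => ?_
  rw [map_sum, Finset.sum_eq_single j]
  · rw [map_smul, charTop_toTop, charA_idemA, if_pos rfl, smul_eq_mul, mul_one]
  · intro i _ hi
    rw [map_smul, charTop_toTop, charA_idemA, if_neg hi, smul_zero]
  · simp

theorem toRecon_idemA (hquad : IsQuadratic I) (i : V) :
    toRecon hadm hquad (idemA I i) = reconTop (toTop I (idemA I i)) := by
  rw [← pathToRecon_idem hadm]
  rfl

theorem toRecon_arrA (hquad : IsQuadratic I) (α : QuiverArrow V) :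
    toRecon hadm hquad (arrA I α) = reconDual ((extOneBasis hadm).coord α) := by
  rw [← pathToRecon_arr hadm]
  rfl

theorem toRecon_ofRecon_reconTop (hquad : IsQuadratic I) (s : Top I) :
    toRecon hadm hquad (ofRecon hadm hquad (reconTop s)) = reconTop s := by
  have h1 := map_sum_smul (toRecon hadm hquad).toLinearMap (fun i => charTop hadm i s) (idemA I)
  have h2 := map_sum_smul (reconTop (I := I)) (fun i => charTop hadm i s)
    (fun i => toTop I (idemA I i))
  rw [sum_charTop_smul_idemA] at h2
  rw [ofRecon_reconTop, h2]
  exact h1.trans (Finset.sum_congr rfl fun i _ =>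
    congrArg (charTop hadm i s • ·) (toRecon_idemA hadm hquad i))

theorem toRecon_ofRecon_reconDual (hquad : IsQuadratic I) (φ : DExt₁ I) :
    toRecon hadm hquad (ofRecon hadm hquad (reconDual φ)) = reconDual φ := by
  have h1 := map_sum_smul (toRecon hadm hquad).toLinearMap (fun α => φ (extOneBasis hadm α))
    (arrA I)
  have h2 : reconDual φ = ∑ α, φ (extOneBasis hadm α) • reconDual ((extOneBasis hadm).coord α) := by
    conv_lhs => rw [← (extOneBasis hadm).sum_dual_apply_smul_coord φ]
    rw [map_sum]
    exact Finset.sum_congr rfl fun i _ => (reconDual (I := I)).map_smul _ _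
  rw [ofRecon_reconDual, h2]
  exact h1.trans (Finset.sum_congr rfl fun α _ =>
    congrArg (φ (extOneBasis hadm α) • ·) (toRecon_arrA hadm hquad α))

theorem ofRecon_pathToRecon_idem (hquad : IsQuadratic I) (i : V) :
    ofRecon hadm hquad (pathToRecon hadm (idem k i)) = idemA I i := by
  classical
  rw [pathToRecon_idem, ofRecon_reconTop, Finset.sum_eq_single i]
  · rw [charTop_toTop, charA_idemA, if_pos rfl, one_smul]
  · intro j _ hj
    rw [charTop_toTop, charA_idemA, if_neg hj.symm, zero_smul]
  · exact fun h => absurd (Finset.mem_univ _) h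

theorem ofRecon_pathToRecon_arr (hquad : IsQuadratic I) (α : QuiverArrow V) :
    ofRecon hadm hquad (pathToRecon hadm (arr k α)) = arrA I α := by
  rw [pathToRecon_arr, ofRecon_reconDual, Finset.sum_eq_single α]
  · rw [Module.Basis.coord_apply, Module.Basis.repr_self, Finsupp.single_eq_same, one_smul]
  · intro β _ hβ
    rw [Module.Basis.coord_apply, Module.Basis.repr_self, Finsupp.single_eq_of_ne hβ.symm,
      zero_smul]
  · exact fun h => absurd (Finset.mem_univ _) h

theorem toRecon_comp_ofRecon (hquad : IsQuadratic I) :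
    (toRecon hadm hquad).comp (ofRecon hadm hquad) = AlgHom.id k _ :=
  RingQuot.ringQuot_ext' k _ _ (RingQuot.ringQuot_ext' k _ _
    (TensorAlgebra.hom_ext (LinearMap.prod_ext
      (LinearMap.ext fun s => toRecon_ofRecon_reconTop hadm hquad s)
      (LinearMap.ext fun φ => toRecon_ofRecon_reconDual hadm hquad φ))))

theorem ofRecon_comp_toRecon (hquad : IsQuadratic I) :
    (ofRecon hadm hquad).comp (toRecon hadm hquad) = AlgHom.id k _ :=
  Ideal.Quotient.algHom_ext k (algHom_ext (fun i => ofRecon_pathToRecon_idem hadm hquad i)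
    fun α => ofRecon_pathToRecon_arr hadm hquad α)

/-- The quadratic algebra `A` is recovered from the Yoneda product. -/
def reconEquiv (hquad : IsQuadratic I) : BoundQuiverAlgebra I ≃ₐ[k] YonedaReconstruction I :=
  AlgEquiv.ofAlgHom (toRecon hadm hquad) (ofRecon hadm hquad) (toRecon_comp_ofRecon hadm hquad)
    (ofRecon_comp_toRecon hadm hquad)

end

end BoundQuiverAlgebra

/-! ### Projective resolutions and chain maps from their low degree parts -/

section Resolution

open Limits

variable {C : Type*} [Category* C] [Abelian C]

/-- An exact complex of projectives over an object is a projective resolution. -/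
def projectiveResolutionOfExact {Z : C} (K : ChainComplex C ℕ) (hK : ∀ n, Projective (K.X n))
    (p : K.X 0 ⟶ Z) (hp : K.d 1 0 ≫ p = 0) [Epi p] (h₀ : (ShortComplex.mk _ _ hp).Exact)
    (hs : ∀ n, (ShortComplex.mk _ _ (K.d_comp_d (n + 2) (n + 1) n)).Exact) :
    ProjectiveResolution Z where
  complex := K
  projective := hK
  π := (ChainComplex.toSingle₀Equiv K Z).symm ⟨p, hp⟩
  quasiIso := ⟨fun n => by
    cases n with
    | zero =>
      rw [ChainComplex.quasiIsoAt₀_iff, ShortComplex.quasiIso_iff_of_zeros']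
      · refine (ShortComplex.exact_and_epi_g_iff_of_iso ?_).2 ⟨h₀, ‹_›⟩
        exact ShortComplex.isoMk (Iso.refl _) (Iso.refl _) (Iso.refl _)
          ((Category.id_comp _).trans (Category.comp_id _).symm)
          ((Category.id_comp _).trans
            ((ChainComplex.toSingle₀Equiv_symm_apply_f_zero p hp).symm.trans
              (Category.comp_id _).symm))
      · exact K.shape 0 0 (by simp)
      all_goals rfl
    | succ n =>
      rw [quasiIsoAt_iff_exactAt' _ _ (ChainComplex.exactAt_succ_single_obj Z n),
        HomologicalComplex.exactAt_iff' _ (n + 2) (n + 1) n (by simp) (by simp)]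
      exact hs n⟩

theorem projectiveResolutionOfExact_π_f_zero {Z : C} (K : ChainComplex C ℕ)
    (hK : ∀ n, Projective (K.X n))
    (p : K.X 0 ⟶ Z) (hp : K.d 1 0 ≫ p = 0) [Epi p] (h₀ : (ShortComplex.mk _ _ hp).Exact)
    (hs : ∀ n, (ShortComplex.mk _ _ (K.d_comp_d (n + 2) (n + 1) n)).Exact) :
    (projectiveResolutionOfExact K hK p hp h₀ hs).π.f 0 = p := by
  exact ChainComplex.toSingle₀Equiv_symm_apply_f_zero _ _

/-- A class in `Ext²` vanishes if its cocycle on a resolution `P` vanishes after pulling it back to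
another resolution along some chain map, which has to be given in degrees at most two only. -/
theorem extMk_eq_zero_of_comp_eq_zero [HasExt C] {X Y : C} (R P : ProjectiveResolution X)
    (f : P.complex.X 2 ⟶ Y) (hf : P.complex.d 3 2 ≫ f = 0)
    (φ₀ : R.complex.X 0 ⟶ P.complex.X 0) (φ₁ : R.complex.X 1 ⟶ P.complex.X 1)
    (φ₂ : R.complex.X 2 ⟶ P.complex.X 2) (w₀ : φ₀ ≫ P.π.f 0 = R.π.f 0)
    (w₁ : φ₁ ≫ P.complex.d 1 0 = R.complex.d 1 0 ≫ φ₀)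
    (w₂ : φ₂ ≫ P.complex.d 2 1 = R.complex.d 2 1 ≫ φ₁) (h : φ₂ ≫ f = 0) :
    P.extMk f 3 rfl hf = 0 := by
  classical
  let succ : ∀ (n : ℕ) (p : Σ' (f : R.complex.X n ⟶ P.complex.X n)
      (f' : R.complex.X (n + 1) ⟶ P.complex.X (n + 1)),
        f' ≫ P.complex.d (n + 1) n = R.complex.d (n + 1) n ≫ f),
      Σ' f'' : R.complex.X (n + 2) ⟶ P.complex.X (n + 2),
        f'' ≫ P.complex.d (n + 2) (n + 1) = R.complex.d (n + 2) (n + 1) ≫ p.2.1 := fun n p =>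
    match n, p with
    | 0, p => if hp : p = ⟨φ₀, φ₁, w₁⟩ then ⟨φ₂, by subst hp; exact w₂⟩
      else ProjectiveResolution.liftFSucc R P 0 p.1 p.2.1 p.2.2
    | n + 1, p => ProjectiveResolution.liftFSucc R P (n + 1) p.1 p.2.1 p.2.2
  let φ : R.complex ⟶ P.complex := ChainComplex.mkHom _ _ φ₀ φ₁ w₁ succ
  have hφ₂ : φ.f 2 = φ₂ := by
    have h1 : succ 0 ⟨φ₀, φ₁, w₁⟩ = ⟨φ₂, w₂⟩ := dif_pos rfl
    exact congrArg PSigma.fst h1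
  let Φ : ProjectiveResolution.Hom R P (𝟙 X) :=
    { hom := φ, hom_f_zero_comp_π_f_zero := by
        rw [CategoryTheory.Functor.map_id]; exact w₀.trans (Category.comp_id _).symm }
  have h1 := ProjectiveResolution.mk₀_comp_extMk f 3 rfl hf Φ
  rw [Abelian.Ext.mk₀_id_comp] at h1
  rw [h1]
  have h2 : Φ.hom.f 2 ≫ f = 0 := by
    change φ.f 2 ≫ f = 0
    rw [hφ₂, h]
  simp only [h2]
  exact ProjectiveResolution.extMk_zero R 3 rfl

end Resolution

namespace BoundQuiverAlgebra

open PathAlgebra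

variable {k : Type u} {V : Type v} [Field k] [Quiver.{w} V] [Fintype V]
  {I : TwoSidedIdeal (PathAlgebra k V)}

/-! ### Graded modules -/

variable (hquad : IsQuadratic I)

/-- A `ℤ`-grading of a module over `A`, given by the projections to its parts: the part of degree
`j` consists of the elements fixed by `proj j`. That each element is the finite sum of its
components is stated for all large enough finite sets of degrees. -/
structure Grading (X : Type*) [AddCommGroup X] [Module (BoundQuiverAlgebra I) X] where
  proj : ℤ → X →+ X
  proj_proj : ∀ i j x, proj i (proj j x) = if i = j then proj j x else 0
  exists_sum : ∀ x, ∃ s : Finset ℤ, ∀ t, s ⊆ t → ∑ j ∈ t, proj j x = x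
  proj_smul : ∀ (d j : ℤ) (a : BoundQuiverAlgebra I) (x : X), proj d x = x →
    proj j (a • x) = projA hquad (j - d) a • x

namespace Grading

variable {hquad}

section

variable {X : Type*} [AddCommGroup X] [Module (BoundQuiverAlgebra I) X] (G : Grading hquad X)

/-- The part of degree `j` of a graded module. -/
def part (j : ℤ) : AddSubgroup X := (G.proj j).eqLocus (AddMonoidHom.id X)

theorem mem_part {j : ℤ} {x : X} : x ∈ G.part j ↔ G.proj j x = x := Iff.rfl

theorem proj_mem_part (j : ℤ) (x : X) : G.proj j x ∈ G.part j := by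
  rw [mem_part, proj_proj, if_pos rfl]

theorem proj_of_mem_part {i j : ℤ} {x : X} (hx : x ∈ G.part j) :
    G.proj i x = if i = j then x else 0 := by
  rw [← G.mem_part.1 hx, proj_proj]

theorem isInternal : DirectSum.IsInternal G.part := by
  constructor
  · rw [injective_iff_map_eq_zero]
    intro z hz
    refine DFinsupp.ext fun i => Subtype.ext ?_
    have h : ∀ z : DirectSum ℤ fun j => G.part j,
        G.proj i (DirectSum.coeAddMonoidHom G.part z) = (z i : X) := by
      intro z
      induction z using DirectSum.induction_on with
      | zero => simp
      | of j x =>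
        rw [DirectSum.coeAddMonoidHom_of, G.proj_of_mem_part x.2]
        by_cases hij : i = j
        · subst hij
          rw [if_pos rfl, DirectSum.of_eq_same]
        · rw [if_neg hij, DirectSum.of_eq_of_ne _ _ _ hij]
          rfl
      | add x y hx hy =>
        rw [map_add, map_add, hx, hy]
        rfl
    rw [← h z, hz, map_zero]
    rfl
  · intro x
    obtain ⟨s, hs⟩ := G.exists_sum x
    refine ⟨∑ j ∈ s, DirectSum.of (fun j => G.part j) j ⟨G.proj j x, G.proj_mem_part j x⟩, ?_⟩
    rw [map_sum]
    refine Eq.trans (Finset.sum_congr rfl fun j _ => ?_) (hs s subset_rfl)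
    rw [DirectSum.coeAddMonoidHom_of]

theorem smul_mem_part {i : ℕ} {j : ℤ} {a : BoundQuiverAlgebra I} {x : X}
    (ha : a ∈ gradedPart I i) (hx : x ∈ G.part j) : a • x ∈ G.part (i + j) := by
  rw [mem_part, G.proj_smul j _ a x hx, add_sub_cancel_right, projA_of_mem_gradedPart hquad ha]

end

theorem exists_sum_projA_sub (d : ℤ) (a : BoundQuiverAlgebra I) :
    ∃ s : Finset ℤ, ∀ t, s ⊆ t → ∑ j ∈ t, projA hquad (j - d) a = a := by
  classical
  obtain ⟨s, hs⟩ := exists_sum_projA hquad a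
  refine ⟨s.image (· + d), fun t ht => ?_⟩
  have h := hs (t.image (· - d)) fun j hj =>
    Finset.mem_image.2 ⟨j + d, ht (Finset.mem_image_of_mem _ hj), add_sub_cancel_right j d⟩
  rwa [Finset.sum_image fun x _ y _ hxy => sub_left_injective hxy] at h

theorem projA_mul_of_projA_eq {d : ℤ} (j : ℤ) (a : BoundQuiverAlgebra I)
    {x : BoundQuiverAlgebra I} (hx : projA hquad d x = x) :
    projA hquad j (a * x) = projA hquad (j - d) a * x := by
  classical
  obtain ⟨s, hs⟩ := exists_sum_projA hquad a
  have h := hs (insert (j - d) s) (Finset.subset_insert _ _)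
  conv_lhs => rw [← h, Finset.sum_mul, map_sum]
  rw [Finset.sum_eq_single (j - d)]
  · rw [projA_projA_mul, sub_sub_cancel, hx]
  · intro i _ hi
    have hne : j - i ≠ d := fun h => hi (by rw [← h, sub_sub_cancel])
    rw [projA_projA_mul, ← hx, projA_projA, if_neg hne, mul_zero]
  · exact fun h => absurd (Finset.mem_insert_self _ _) h

variable (hquad) in
/-- The grading of `A` by path length. -/
def self : Grading hquad (BoundQuiverAlgebra I) where
  proj j := (projA hquad j).toAddMonoidHom
  proj_proj := projA_projA hquad
  exists_sum := exists_sum_projA hquad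
  proj_smul _ j a _ hx := projA_mul_of_projA_eq j a hx

section Cover

variable [∀ a b : V, Finite (a ⟶ b)]

variable (hquad) in
/-- The grading of the module `⨁ A e_(t β)` whose generators have degree one. -/
def cover : Grading hquad (ArrowCover I) where
  proj j := AddMonoidHom.mk' (fun z => ⟨fun β => projA hquad (j - 1) (z.1 β), fun β => by
    rw [← projA_mul_idemA, z.2]⟩) fun z z' => Subtype.ext (funext fun β => map_add _ _ _)
  proj_proj i j z := by
    refine Subtype.ext (funext fun β => ?_)
    refine (projA_projA hquad _ _ _).trans ?_
    by_cases h : i = j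
    · subst h; rw [if_pos rfl, if_pos rfl]; rfl
    · rw [if_neg h, if_neg fun h' => h (sub_left_injective h')]; rfl
  exists_sum z := by
    classical
    choose s hs using fun β => exists_sum_projA_sub (hquad := hquad) 1 (z.1 β)
    refine ⟨Finset.univ.biUnion s, fun t ht => Subtype.ext (funext fun β => ?_)⟩
    rw [AddSubmonoidClass.coe_finsetSum, Finset.sum_apply]
    exact hs β t ((Finset.subset_biUnion_of_mem s (Finset.mem_univ β)).trans ht)
  proj_smul d j a z hz := by
    refine Subtype.ext (funext fun β => ?_)
    have h : projA hquad (d - 1) (z.1 β) = z.1 β := congrFun (congrArg Subtype.val hz) β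
    refine (projA_mul_of_projA_eq (j - 1) a h).trans ?_
    rw [sub_sub_sub_cancel_right]
    rfl

end Cover

section Free

variable {T : Type*} (deg : T → ℤ)

variable (hquad) in
/-- The grading of a free module with basis elements of prescribed degrees. -/
def free : Grading hquad (Π₀ _ : T, BoundQuiverAlgebra I) where
  proj j := DFinsupp.mapRange.addMonoidHom fun t => (projA hquad (j - deg t)).toAddMonoidHom
  proj_proj i j z := by
    refine DFinsupp.ext fun t => ?_
    refine (projA_projA hquad _ _ _).trans ?_
    by_cases h : i = j
    · subst h; rw [if_pos rfl, if_pos rfl]; rfl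
    · rw [if_neg h, if_neg fun h' => h (sub_left_injective h')]; rfl
  exists_sum z := by
    classical
    choose s hs using fun t => exists_sum_projA_sub (hquad := hquad) (deg t) (z t)
    refine ⟨z.support.biUnion s, fun r hr => DFinsupp.ext fun t => ?_⟩
    rw [DFinsupp.finsetSum_apply]
    by_cases ht : t ∈ z.support
    · exact hs t r ((Finset.subset_biUnion_of_mem s ht).trans hr)
    · rw [DFinsupp.notMem_support_iff] at ht
      rw [ht]
      refine Finset.sum_eq_zero fun j _ => ?_
      change projA hquad (j - deg t) (z t) = 0
      rw [ht, map_zero]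
  proj_smul d j a z hz := by
    refine DFinsupp.ext fun t => ?_
    have h : projA hquad (d - deg t) (z t) = z t := DFunLike.congr_fun hz t
    refine (projA_mul_of_projA_eq (j - deg t) a h).trans ?_
    rw [sub_sub_sub_cancel_right]
    rfl

open Classical in
theorem free_proj_single (j : ℤ) (t : T) (a : BoundQuiverAlgebra I) :
    (free hquad deg).proj j (DFinsupp.single t a) =
      DFinsupp.single t (projA hquad (j - deg t) a) :=
  DFinsupp.mapRange_single (hf := fun _ => map_zero _)

open Classical in
/-- The map out of a free module with prescribed values on the basis. -/
def freeDesc {X : Type*} [AddCommGroup X] [Module (BoundQuiverAlgebra I) X] (g : T → X) :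
    (Π₀ _ : T, BoundQuiverAlgebra I) →ₗ[BoundQuiverAlgebra I] X :=
  DFinsupp.lsum ℕ fun t => LinearMap.toSpanSingleton (BoundQuiverAlgebra I) X (g t)

open Classical in
theorem freeDesc_single {X : Type*} [AddCommGroup X] [Module (BoundQuiverAlgebra I) X]
    (g : T → X) (t : T) (a : BoundQuiverAlgebra I) :
    freeDesc g (DFinsupp.single t a) = a • g t := by
  rw [freeDesc, DFinsupp.lsum_single, LinearMap.toSpanSingleton_apply]

theorem freeDesc_proj {X : Type*} [AddCommGroup X] [Module (BoundQuiverAlgebra I) X]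
    (G : Grading hquad X) (g : T → X) (hg : ∀ t, g t ∈ G.part (deg t)) (j : ℤ)
    (z : Π₀ _ : T, BoundQuiverAlgebra I) :
    freeDesc g ((free hquad deg).proj j z) = G.proj j (freeDesc g z) := by
  classical
  induction z using DFinsupp.induction with
  | h0 => simp only [map_zero]
  | ha t a z _ _ hz =>
    rw [map_add, map_add, map_add, map_add, hz, free_proj_single, freeDesc_single,
      freeDesc_single, G.proj_smul _ _ _ _ (hg t)]

theorem range_freeDesc {X : Type*} [AddCommGroup X] [Module (BoundQuiverAlgebra I) X]
    (g : T → X) : LinearMap.range (freeDesc g) =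
      Submodule.span (BoundQuiverAlgebra I) (Set.range g) := by
  classical
  apply le_antisymm
  · rintro _ ⟨z, rfl⟩
    induction z using DFinsupp.induction with
    | h0 => rw [map_zero]; exact zero_mem _
    | ha t a z _ _ hz =>
      rw [map_add, freeDesc_single]
      exact add_mem (Submodule.smul_mem _ _ (Submodule.subset_span ⟨t, rfl⟩)) hz
  · rw [Submodule.span_le]
    rintro _ ⟨t, rfl⟩
    exact ⟨DFinsupp.single t 1, by rw [freeDesc_single, one_smul]⟩

open Classical in
theorem free_hom_ext {X : Type*} [AddCommGroup X] [Module (BoundQuiverAlgebra I) X]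
    {f g : (Π₀ _ : T, BoundQuiverAlgebra I) →ₗ[BoundQuiverAlgebra I] X}
    (h : ∀ t : T, f (DFinsupp.single t 1) = g (DFinsupp.single t 1)) : f = g := by
  refine LinearMap.ext fun z => ?_
  induction z using DFinsupp.induction with
  | h0 => rw [map_zero, map_zero]
  | ha t a z _ _ hz =>
    have h1 : DFinsupp.single t a = a • (DFinsupp.single t 1 : Π₀ _ : T, BoundQuiverAlgebra I) := by
      rw [← DFinsupp.single_smul, smul_eq_mul, mul_one]
    rw [map_add, map_add, hz, h1, map_smul, map_smul, h]

end Free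

end Grading

/-! ### A graded projective resolution generated in degrees zero, one and two -/

variable (hquad : IsQuadratic I)

/-- A graded projective module together with a homogeneous submodule: a term of a graded resolution
together with the submodule that the next term has to cover. -/
structure Stage where
  X : ModuleCat.{max u v w} (BoundQuiverAlgebra I)
  projective : Module.Projective (BoundQuiverAlgebra I) X
  G : Grading hquad X
  K : Submodule (BoundQuiverAlgebra I) X
  proj_mem : ∀ (j : ℤ) (x : X), x ∈ K → G.proj j x ∈ K

namespace Stage

variable {hquad}

/-- The free module on a family of homogeneous elements, with the kernel of its map to the
original module. -/
def ofFamily (S : Stage hquad) {T : Type max u v w} (deg : T → ℤ) (g : T → S.X)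
    (hg : ∀ t, g t ∈ S.G.part (deg t)) : Stage hquad where
  X := ModuleCat.of _ (Π₀ _ : T, BoundQuiverAlgebra I)
  projective := inferInstanceAs (Module.Projective _ (Π₀ _ : T, BoundQuiverAlgebra I))
  G := Grading.free hquad deg
  K := LinearMap.ker (Grading.freeDesc g)
  proj_mem j x hx := by
    refine LinearMap.mem_ker.2 ((Grading.freeDesc_proj deg S.G g hg j x).trans ?_)
    rw [LinearMap.mem_ker.1 hx, map_zero]

/-- The pairs of a degree and an element of this degree in the submodule to be covered. -/
abbrev Homogeneous (S : Stage hquad) : Type max u v w :=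
  {p : ℤ × S.X // p.2 ∈ S.G.part p.1 ∧ p.2 ∈ S.K}

/-- The next term of a resolution: the free module on all homogeneous elements of the submodule to
be covered. -/
def next (S : Stage hquad) : Stage hquad :=
  S.ofFamily (T := S.Homogeneous) (fun t => t.1.1) (fun t => t.1.2) fun t => t.2.1

theorem span_homogeneous (S : Stage hquad) :
    Submodule.span (BoundQuiverAlgebra I) (Set.range fun t : S.Homogeneous => t.1.2) = S.K := by
  apply le_antisymm
  · rw [Submodule.span_le]
    rintro _ ⟨t, rfl⟩
    exact t.2.2
  · intro x hx
    obtain ⟨s, hs⟩ := S.G.exists_sum x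
    rw [← hs s subset_rfl]
    exact sum_mem fun j _ =>
      Submodule.subset_span ⟨⟨(j, S.G.proj j x), S.G.proj_mem_part j x, S.proj_mem j x hx⟩, rfl⟩

end Stage

theorem mem_rad_of_toTop_eq_zero (x : BoundQuiverAlgebra I) (hx : toTop I x = 0) : x ∈ Rad I :=
  LinearMap.mem_ker.2 hx

variable [∀ a b : V, Finite (a ⟶ b)] (hadm : IsAdmissible I)

/-- The first differential `⨁ A e_(t β) → A`. -/
def coverMap : ArrowCover I →ₗ[BoundQuiverAlgebra I] BoundQuiverAlgebra I :=
  (Rad I).subtype ∘ₗ coverToRad hadm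

theorem coverMap_apply (z : ArrowCover I) : coverMap hadm z = ∑ β, z.1 β * arrA I β :=
  coe_coverToRad hadm z

theorem coverMap_proj (j : ℤ) (z : ArrowCover I) :
    coverMap hadm ((Grading.cover hquad).proj j z) = projA hquad j (coverMap hadm z) := by
  rw [coverMap_apply, coverMap_apply, map_sum]
  exact Finset.sum_congr rfl fun β _ =>
    (Grading.projA_mul_of_projA_eq j _ (projA_arrA hquad β)).symm

theorem range_coverMap : LinearMap.range (coverMap hadm) = Rad I := by
  rw [coverMap, LinearMap.range_comp, LinearMap.range_eq_top.2 (coverToRad_surjective hadm),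
    Submodule.map_top, Submodule.range_subtype]

theorem ker_coverMap : LinearMap.ker (coverMap hadm) = Relations hadm :=
  LinearMap.ker_comp_of_ker_eq_bot _ (Submodule.ker_subtype _)

/-- The ring `A` with its radical. -/
def stageZero : Stage hquad where
  X := ModuleCat.of _ (BoundQuiverAlgebra I)
  projective := inferInstanceAs (Module.Projective _ (BoundQuiverAlgebra I))
  G := Grading.self hquad
  K := Rad I
  proj_mem j x hx := by
    rw [← range_coverMap hadm] at hx ⊢
    obtain ⟨z, rfl⟩ := hx
    exact ⟨_, coverMap_proj hquad hadm j z⟩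

/-- The cover of the radical, with the module of relations. -/
def stageOne : Stage hquad where
  X := ModuleCat.of _ (ArrowCover I)
  projective := inferInstanceAs (Module.Projective _ (ArrowCover I))
  G := Grading.cover hquad
  K := Relations hadm
  proj_mem j x hx := by
    rw [← ker_coverMap] at hx ⊢
    refine LinearMap.mem_ker.2 ((coverMap_proj hquad hadm j x).trans ?_)
    rw [LinearMap.mem_ker.1 hx, map_zero]

/-- The relations of degree two. -/
abbrev QuadraticRelation : Type max u v w :=
  {z : ArrowCover I // z ∈ (Grading.cover hquad).part 2 ∧ z ∈ Relations hadm}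

theorem relOf_mem_part {s : PathAlgebra k V} (hs : s ∈ I) (hs2 : proj 2 s = s) :
    (relOf hadm s hs).1 ∈ (Grading.cover hquad).part 2 := by
  refine Subtype.ext (funext fun β => ?_)
  change mk I (proj (2 - 1) (PathAlgebra.deriv β s)) = mk I (PathAlgebra.deriv β s)
  rw [proj_deriv]
  exact congrArg (fun x => mk I (PathAlgebra.deriv β x)) hs2

/-- As the algebra is quadratic, its relations are generated in degree two. -/
theorem span_quadraticRelation : Submodule.span (BoundQuiverAlgebra I)
    (Set.range fun t : QuadraticRelation hquad hadm => t.1) = Relations hadm := by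
  apply le_antisymm
  · rw [Submodule.span_le]
    rintro _ ⟨t, rfl⟩
    exact t.2.2
  · intro z hz
    exact relations_induction hadm hquad
      (p := fun z => z.1 ∈ Submodule.span (BoundQuiverAlgebra I)
        (Set.range fun t : QuadraticRelation hquad hadm => t.1))
      (fun s hs hs2 => Submodule.subset_span
        ⟨⟨(relOf hadm s hs).1, relOf_mem_part hquad hadm hs hs2, (relOf hadm s hs).2⟩, rfl⟩)
      (zero_mem _) (fun _ _ => add_mem) (fun a _ => Submodule.smul_mem _ a) ⟨z, hz⟩

/-- The terms of a graded projective resolution of `A / rad A` with generators of degree `n` in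
homological degree `n ≤ 2`. -/
def stage : ℕ → Stage hquad
  | 0 => stageZero hquad hadm
  | 1 => stageOne hquad hadm
  | 2 => (stageOne hquad hadm).ofFamily (T := QuadraticRelation hquad hadm) (fun _ => 2)
      (fun t => t.1) fun t => t.2.1
  | n + 3 => (stage (n + 2)).next

/-- The differential of the resolution. -/
def stageMap : ∀ n : ℕ, (stage hquad hadm (n + 1)).X →ₗ[BoundQuiverAlgebra I] (stage hquad hadm n).X
  | 0 => coverMap hadm
  | 1 => Grading.freeDesc fun t : QuadraticRelation hquad hadm => t.1
  | n + 2 => Grading.freeDesc fun t : (stage hquad hadm (n + 2)).Homogeneous => t.1.2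

theorem range_stageMap : ∀ n, LinearMap.range (stageMap hquad hadm n) = (stage hquad hadm n).K
  | 0 => range_coverMap hadm
  | 1 => (Grading.range_freeDesc _).trans (span_quadraticRelation hquad hadm)
  | _ + 2 => (Grading.range_freeDesc _).trans (Stage.span_homogeneous _)

theorem ker_stageMap : ∀ n, LinearMap.ker (stageMap hquad hadm n) = (stage hquad hadm (n + 1)).K
  | 0 => ker_coverMap hadm
  | 1 => rfl
  | _ + 2 => rfl

theorem stageMap_proj : ∀ n j x, stageMap hquad hadm n ((stage hquad hadm (n + 1)).G.proj j x) =
    (stage hquad hadm n).G.proj j (stageMap hquad hadm n x)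
  | 0, j, x => coverMap_proj hquad hadm j x
  | 1, j, x => Grading.freeDesc_proj _ (Grading.cover hquad) _ (fun t => t.2.1) j x
  | n + 2, j, x => Grading.freeDesc_proj _ (stage hquad hadm (n + 2)).G _ (fun t => t.2.1) j x

/-- The complex of the resolution. -/
def stageComplex : ChainComplex (ModuleCat.{max u v w} (BoundQuiverAlgebra I)) ℕ :=
  ChainComplex.of (fun n => (stage hquad hadm n).X)
    (fun n => ModuleCat.ofHom (stageMap hquad hadm n)) fun n => by
      refine ModuleCat.hom_ext (LinearMap.ext fun x => ?_)
      have h : stageMap hquad hadm (n + 1) x ∈ LinearMap.ker (stageMap hquad hadm n) := by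
        rw [ker_stageMap, ← range_stageMap]
        exact ⟨x, rfl⟩
      exact LinearMap.mem_ker.1 h

theorem stageComplex_d (n : ℕ) :
    (stageComplex hquad hadm).d (n + 1) n = ModuleCat.ofHom (stageMap hquad hadm n) :=
  ChainComplex.of_d (fun n => (stage hquad hadm n).X)
    (fun n => ModuleCat.ofHom (stageMap hquad hadm n)) n

theorem stageComplex_d_apply (n : ℕ) (x : (stage hquad hadm (n + 1)).X) :
    ((stageComplex hquad hadm).d (n + 1) n).hom x = stageMap hquad hadm n x :=
  congrArg (fun f => ModuleCat.Hom.hom f x) (stageComplex_d hquad hadm n)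

/-- The augmentation of the resolution. -/
def stageAug : (stageComplex hquad hadm).X 0 ⟶ L I := ModuleCat.ofHom (toTop I)

instance : Epi (stageAug hquad hadm) := (ModuleCat.epi_iff_surjective _).2 toTop_surjective

theorem stageComplex_d_comp_stageAug :
    (stageComplex hquad hadm).d 1 0 ≫ stageAug hquad hadm = 0 := by
  rw [stageComplex_d]
  exact ModuleCat.hom_ext (LinearMap.ext fun z => LinearMap.mem_ker.1 (coverToRad hadm z).2)

theorem exact_stageAug :
    (ShortComplex.mk _ _ (stageComplex_d_comp_stageAug hquad hadm)).Exact := by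
  refine (ShortComplex.moduleCat_exact_iff _).2 fun (x : (stage hquad hadm 0).X) hx => ?_
  have hx' : x ∈ LinearMap.range (stageMap hquad hadm 0) := by
    rw [range_stageMap]; exact mem_rad_of_toTop_eq_zero x hx
  obtain ⟨z, hz⟩ := hx'
  exact ⟨z, (stageComplex_d_apply hquad hadm 0 z).trans hz⟩

theorem exact_stageComplex (n : ℕ) :
    (ShortComplex.mk _ _ ((stageComplex hquad hadm).d_comp_d (n + 2) (n + 1) n)).Exact := by
  refine (ShortComplex.moduleCat_exact_iff _).2 fun (x : (stage hquad hadm (n + 1)).X) hx => ?_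
  have hx' : x ∈ LinearMap.range (stageMap hquad hadm (n + 1)) := by
    rw [range_stageMap, ← ker_stageMap]
    exact LinearMap.mem_ker.2 ((stageComplex_d_apply hquad hadm n x).symm.trans hx)
  obtain ⟨z, hz⟩ := hx'
  exact ⟨z, (stageComplex_d_apply hquad hadm (n + 1) z).trans hz⟩

theorem stageComplex_projective (n : ℕ) : Projective ((stageComplex hquad hadm).X n) :=
  (IsProjective.iff_projective _).1 (stage hquad hadm n).projective

/-- The graded projective resolution of `A / rad A`, as a projective resolution. -/
def stageResolution : ProjectiveResolution (L I) :=
  projectiveResolutionOfExact (stageComplex hquad hadm) (stageComplex_projective hquad hadm)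
    (stageAug hquad hadm) (stageComplex_d_comp_stageAug hquad hadm) (exact_stageAug hquad hadm)
    (exact_stageComplex hquad hadm)

theorem stageResolution_π_f_zero : (stageResolution hquad hadm).π.f 0 = stageAug hquad hadm :=
  projectiveResolutionOfExact_π_f_zero ..

theorem toTop_eq_zero_of_projA (hadm : IsAdmissible I) {j : ℤ} (hj : j ≠ 0) {a : BoundQuiverAlgebra I}
    (ha : projA hquad j a = a) : toTop I a = 0 := by
  refine charTop_ext hadm fun i => ?_
  rw [charTop_toTop, map_zero]
  exact charA_eq_zero_of_projA hquad hadm hj ha i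

/-- The graded projective resolution of `A / rad A`. -/
def gradedResolution : GradedProjectiveResolution I where
  res := stageResolution hquad hadm
  part n := (stage hquad hadm n).G.part
  isInternal n := (stage hquad hadm n).G.isInternal
  smul_mem n _ _ _ _ ha hp := (stage hquad hadm n).G.smul_mem_part ha hp
  d_mem n j p hp := by
    have h := stageComplex_d_apply hquad hadm n p
    refine (congrArg (· ∈ (stage hquad hadm n).G.part j) h).mpr ?_
    refine (stageMap_proj hquad hadm n j p).symm.trans ?_
    exact congrArg _ hp
  augmentation j p hp hj := by
    have h : ((stageResolution hquad hadm).π.f 0).hom p = toTop I p :=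
      congrArg (fun f => ModuleCat.Hom.hom f p) (stageResolution_π_f_zero hquad hadm)
    exact h.trans (toTop_eq_zero_of_projA hquad hadm hj hp)

/-- All classes in `Ext¹` have internal degree one, as the first term of the resolution is generated
in degree one and all maps to `A / rad A` kill the multiples of elements of the radical. -/
theorem hasInternalDegree_one (hquad : IsQuadratic I) (hadm : IsAdmissible I)
    (x : ExtL I 1) : HasInternalDegree I x 1 := by
  obtain ⟨f, hf, rfl⟩ := (gradedResolution hquad hadm).res.extMk_surjective x 2 rfl
  refine ⟨gradedResolution hquad hadm, f, hf, fun i p hp hi => ?_, rfl⟩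
  let g : ArrowCover I →ₗ[BoundQuiverAlgebra I] Top I := f.hom
  let z : ArrowCover I := p
  have hz : (Grading.cover hquad).proj i z = z := hp
  change g z = 0
  refine charTop_ext hadm fun v => ?_
  rw [← sum_smul_coverGen z, map_sum, map_sum, map_zero]
  refine Finset.sum_eq_zero fun β _ => ?_
  rw [map_smul, charTop_smul, charA_eq_zero_of_projA hquad hadm (sub_ne_zero.2 hi)
    (congrFun (congrArg Subtype.val hz) β), zero_mul]

end BoundQuiverAlgebra

/-! ### Lifting homogeneous elements -/

section Homogeneous

variable {M N : Type*} [AddCommGroup M] [AddCommGroup N] {p : ℤ → AddSubgroup M}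
  {q : ℤ → AddSubgroup N}

/-- A homogeneous value of a map of degree zero is the value of a homogeneous element. -/
theorem exists_homogeneous_map_eq (hp : DirectSum.IsInternal p) (hq : DirectSum.IsInternal q)
    (d : M →+ N) (hd : ∀ j, ∀ x ∈ p j, d x ∈ q j) {i : ℤ} {x : M} (hx : d x ∈ q i) :
    ∃ y ∈ p i, d y = d x := by
  classical
  let := hp.chooseDecomposition
  let := hq.chooseDecomposition
  refine ⟨DirectSum.decompose p x i, SetLike.coe_mem _, ?_⟩
  conv_rhs => rw [← DirectSum.decompose_of_mem_same q hx, ← DirectSum.sum_support_decompose p x,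
    map_sum, DirectSum.decompose_sum, DFinsupp.finsetSum_apply, AddSubmonoidClass.coe_finsetSum]
  rw [Finset.sum_eq_single i]
  · rw [DirectSum.decompose_of_mem_same q (hd i _ (SetLike.coe_mem _))]
  · intro j _ hj
    rw [DirectSum.decompose_of_mem_ne q (hd j _ (SetLike.coe_mem _)) hj]
  · intro h
    rw [DFinsupp.notMem_support_iff.1 h]
    simp

/-- The values of a map which kills all parts but one are taken on this part. -/
theorem exists_homogeneous_map_eq_of_eq_zero (hp : DirectSum.IsInternal p)
    (d : M →+ N) {i : ℤ} (hd : ∀ j, ∀ x ∈ p j, j ≠ i → d x = 0) (x : M) :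
    ∃ y ∈ p i, d y = d x := by
  classical
  let := hp.chooseDecomposition
  refine ⟨DirectSum.decompose p x i, SetLike.coe_mem _, ?_⟩
  conv_rhs => rw [← DirectSum.sum_support_decompose p x, map_sum]
  rw [Finset.sum_eq_single i]
  · intro j _ hj
    exact hd j _ (SetLike.coe_mem _) hj
  · intro h
    rw [DFinsupp.notMem_support_iff.1 h]
    simp

end Homogeneous

namespace BoundQuiverAlgebra

open PathAlgebra

variable {k : Type u} {V : Type v} [Field k] [Quiver.{w} V] [Fintype V]
  {I : TwoSidedIdeal (PathAlgebra k V)}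

/-! ### Internal degrees of classes in `Ext²` -/

theorem mem_gradedPart_of_projA (hquad : IsQuadratic I) {n : ℕ} {a : BoundQuiverAlgebra I}
    (ha : projA hquad n a = a) : a ∈ gradedPart I n := by
  obtain ⟨x, rfl⟩ := mk_surjective I a
  exact (mem_gradedPart_iff I).2 ⟨proj n x, by rw [proj_proj, if_pos rfl], ha⟩

theorem smul_toTop_one (a : BoundQuiverAlgebra I) : a • toTop I 1 = toTop I a := by
  rw [← map_smul, smul_eq_mul, mul_one]

namespace GradedProjectiveResolution

variable (P : GradedProjectiveResolution I)

theorem exists_mem_part_zero (x : Top I) : ∃ y ∈ P.part 0 0, (P.res.π.f 0).hom y = x := by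
  obtain ⟨z, hz⟩ := (ModuleCat.epi_iff_surjective (P.res.π.f 0)).1 inferInstance x
  obtain ⟨y, hy, hyz⟩ := exists_homogeneous_map_eq_of_eq_zero (P.isInternal 0)
    (P.res.π.f 0).hom.toAddMonoidHom (i := 0) (fun j p hp hj => P.augmentation j p hp hj) z
  exact ⟨y, hy, hyz.trans hz⟩

theorem exists_mem_part_one {i : ℤ} {x : P.res.complex.X 0} (hx : x ∈ P.part 0 i)
    (hx' : (P.res.π.f 0).hom x = 0) :
    ∃ y ∈ P.part 1 i, (P.res.complex.d 1 0).hom y = x := by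
  obtain ⟨z, hz⟩ := (ShortComplex.moduleCat_exact_iff _).1 P.res.exact₀ x hx'
  have hz' : (P.res.complex.d 1 0).hom z = x := hz
  obtain ⟨y, hy, hyz⟩ := exists_homogeneous_map_eq (P.isInternal 1) (P.isInternal 0)
    (P.res.complex.d 1 0).hom.toAddMonoidHom (fun j p hp => P.d_mem 0 j p hp) (i := i) (x := z)
    (by rw [← hz'] at hx; exact hx)
  exact ⟨y, hy, hyz.trans hz'⟩

theorem exists_mem_part_succ (n : ℕ) {i : ℤ} {x : P.res.complex.X (n + 1)}
    (hx : x ∈ P.part (n + 1) i) (hx' : (P.res.complex.d (n + 1) n).hom x = 0) :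
    ∃ y ∈ P.part (n + 2) i, (P.res.complex.d (n + 2) (n + 1)).hom y = x := by
  obtain ⟨z, hz⟩ := (ShortComplex.moduleCat_exact_iff _).1 (P.res.exact_succ n) x hx'
  have hz' : (P.res.complex.d (n + 2) (n + 1)).hom z = x := hz
  obtain ⟨y, hy, hyz⟩ := exists_homogeneous_map_eq (P.isInternal (n + 2)) (P.isInternal (n + 1))
    (P.res.complex.d (n + 2) (n + 1)).hom.toAddMonoidHom (fun j p hp => P.d_mem (n + 1) j p hp)
    (i := i) (x := z) (by rw [← hz'] at hx; exact hx)
  exact ⟨y, hy, hyz.trans hz'⟩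

end GradedProjectiveResolution

variable [∀ a b : V, Finite (a ⟶ b)]

/-- A class in `Ext²` of internal degree different from two vanishes. Since the quadratic algebra has
a graded resolution whose term in homological degree two is generated in internal degree two, and
since this resolution maps to any other one by a map of degree zero, a cocycle which kills the part
of degree two pulls back to zero. -/
theorem eq_zero_of_hasInternalDegree (hquad : IsQuadratic I) (hadm : IsAdmissible I)
    {x : ExtL I 2} {j : ℤ} (hx : HasInternalDegree I x j) (hj : j ≠ 2) : x = 0 := by
  obtain ⟨P, f, hf, hdeg, rfl⟩ := hx
  obtain ⟨y, hy, hyπ⟩ := P.exists_mem_part_zero (toTop I 1)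
  have hq : ∀ β : QuiverArrow V, ∃ q ∈ P.part 1 1,
      (P.res.complex.d 1 0).hom q = arrA I β • y := fun β => by
    refine P.exists_mem_part_one ?_ ?_
    · have := P.smul_mem 0 1 0 (arrA I β) y
        (mem_gradedPart_of_projA hquad (projA_arrA hquad β)) hy
      simpa using this
    · rw [map_smul, hyπ]
      exact (smul_toTop_one _).trans (LinearMap.mem_ker.1 (radArr hadm β).2)
  choose q hq hdq using hq
  -- the comparison map in degrees zero and one sends the generators to homogeneous lifts
  let φ₀ : BoundQuiverAlgebra I →ₗ[BoundQuiverAlgebra I] P.res.complex.X 0 :=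
    LinearMap.toSpanSingleton _ _ y
  let φ₁ : ArrowCover I →ₗ[BoundQuiverAlgebra I] P.res.complex.X 1 := coverDesc q
  have hφ₁ : ∀ z, (P.res.complex.d 1 0).hom (φ₁ z) = φ₀ (coverMap hadm z) := fun z => by
    change (P.res.complex.d 1 0).hom (coverDesc q z) = coverMap hadm z • y
    rw [coverDesc_apply, map_sum, coverMap_apply, Finset.sum_smul]
    exact Finset.sum_congr rfl fun β _ => by rw [map_smul, hdq, mul_smul]
  have hr : ∀ t : QuadraticRelation hquad hadm, ∃ r ∈ P.part 2 2,
      (P.res.complex.d 2 1).hom r = φ₁ t.1 := fun t => by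
    refine P.exists_mem_part_succ 0 ?_ ?_
    · refine sum_mem fun β _ => ?_
      have h : projA hquad (2 - 1) (t.1.1 β) = t.1.1 β := congrFun (congrArg Subtype.val t.2.1) β
      exact P.smul_mem 1 1 1 (t.1.1 β) (q β) (mem_gradedPart_of_projA hquad h) (hq β)
    · refine (hφ₁ t.1).trans ?_
      have h : coverMap hadm t.1 = 0 := by
        rw [← LinearMap.mem_ker, ker_coverMap]; exact t.2.2
      rw [h, map_zero]
  choose r hr hdr using hr
  -- all values of the comparison map on the generators in degree two have internal degree two
  let φ₂ : (Π₀ _ : QuadraticRelation hquad hadm, BoundQuiverAlgebra I) →ₗ[BoundQuiverAlgebra I]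
    P.res.complex.X 2 := Grading.freeDesc r
  refine extMk_eq_zero_of_comp_eq_zero (stageResolution hquad hadm) P.res f hf
    (ModuleCat.ofHom φ₀) (ModuleCat.ofHom φ₁) (ModuleCat.ofHom φ₂) ?_ ?_ ?_ ?_
  · rw [stageResolution_π_f_zero]
    refine ModuleCat.hom_ext (LinearMap.ext fun (a : BoundQuiverAlgebra I) => ?_)
    change (P.res.π.f 0).hom (a • y) = toTop I a
    rw [map_smul, hyπ]
    exact smul_toTop_one a
  · refine ModuleCat.hom_ext (LinearMap.ext fun z => ?_)
    refine (hφ₁ z).trans (congrArg φ₀ ?_)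
    exact (stageComplex_d_apply hquad hadm 0 z).symm
  · have h : (P.res.complex.d 2 1).hom ∘ₗ φ₂ =
        φ₁ ∘ₗ Grading.freeDesc fun t : QuadraticRelation hquad hadm => t.1 := by
      refine Grading.free_hom_ext fun t => ?_
      change (P.res.complex.d 2 1).hom (Grading.freeDesc r _) = φ₁ (Grading.freeDesc _ _)
      rw [Grading.freeDesc_single, Grading.freeDesc_single, one_smul, one_smul, hdr]
    refine ModuleCat.hom_ext (LinearMap.ext fun z => ?_)
    refine (LinearMap.congr_fun h z).trans (congrArg φ₁ ?_)
    exact (stageComplex_d_apply hquad hadm 1 z).symm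
  · have h : f.hom ∘ₗ φ₂ = 0 := by
      refine Grading.free_hom_ext fun t => ?_
      change f.hom (Grading.freeDesc r _) = 0
      rw [Grading.freeDesc_single, one_smul, hdeg 2 _ (hr t) hj.symm]
    exact ModuleCat.hom_ext h

end BoundQuiverAlgebra

end

theorem mainTheorem2 {k : Type u} {V : Type v} [Field k] [Quiver.{w} V] [Fintype V]
    [∀ a b : V, Finite (a ⟶ b)] (I : TwoSidedIdeal (PathAlgebra k V))
    (hadm : IsAdmissible I) (hquad : IsQuadratic I) :
    (∀ M : ExtAInfinityStructure I, M.HasInternalDegreeZero →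
      ∀ n : ℕ, 1 ≤ n → n ≠ 2 → M.mExt n = 0) ∧
    Nonempty (BoundQuiverAlgebra I ≃ₐ[k] BoundQuiverAlgebra.YonedaReconstruction I) := by
  refine ⟨fun M hM n hn hn2 => MultilinearMap.ext fun x => ?_,
    ⟨BoundQuiverAlgebra.reconEquiv hadm hquad⟩⟩
  refine BoundQuiverAlgebra.eq_zero_of_hasInternalDegree hquad hadm
    (hM n hn x (fun _ => 1) fun i => BoundQuiverAlgebra.hasInternalDegree_one hquad hadm (x i)) ?_
  simpa using fun h : (n : ℤ) = 2 => hn2 (by exact_mod_cast h)
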